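/- Let $r>0$ and $T>0$. Let $X=\{X(t):t\in[0,T]\}$ be a mean-zero Gaussian process on a probability space $(\Omega,\mathcal F,\Pr)$ with covariance function $\Gamma_X(s,t)=E[X(s)X(t)]$, and put $\sigma_X(s,t)=(E[X(t)-X(s)]^2)^{1/2}$. Let $\rho:[0,T]\to[0,\infty)$ satisfy $\rho(0)=0$, be continuous at $0$, and satisfy $0<\inf_{[\delta,T]}\rho\le\sup_{[\delta,T]}\rho<\infty$ for each $\delta\in(0,T)$. Suppose that $X\in\mathcal{LSI}(\rho(\cdot))$, that is: (A1) there is a finite constant $L$ with $\sigma_X(s,t)\le L\rho(|t-s|)$ for all $s,t\in[0,T]$; (A2) for each $\epsilon\in(0,T)$, $$\lim_{\delta\downarrow0}\sup\Big\{\Big|\frac{\sigma_X(s,s+h)}{\rho(h)}-1\Big|:\ s\in[\epsilon,T),\ h\in(0,\delta\wedge(T-s)]\Big\}=0.$$ For $p\ge1$ let $$V_p(\Gamma_X;[s,t]^2)=\sup\Big(\sum_{i,j}\big|E[X(s_i)-X(s_{i-1})][X(t_j)-X(t_{j-1})]\big|^p\Big)^{1/p},$$ the supremum being over all pairs of partitions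 $(s_i)$, $(t_j)$ of $[s,t]$. Suppose that for a constant $C_1$ and a number $p\ge1$, $$V_p(\Gamma_X;[s,t]^2)\le C_1[\rho(t-s)]^2\qquad\text{for all }0\le s<t\le T.$$ If $p=1$, let $f:[0,T]\to\mathbb R$ be regulated (one-sided limits exist at every point). If $p>1$, let $f:[0,T]\to\mathbb R$ have bounded $q$-variation for some $q\in[1,p/(p-1))$, that is, $\sup\sum_i|f(s_i)-f(s_{i-1})|^q<\infty$ over all partitions $(s_i)$ of $[0,T]$. Say that the q.m. (quadratic mean) integral $\int_0^tf\,dX$ exists and equals $I\in L^2(\Omega,\mathcal F,\Pr)$ if for each $\epsilon>0$ there is $\delta>0$ such that $E\big[\sum_if(u_i)(X(t_i)-X(t_{i-1}))-I\big]^2<\epsilon$ for every partition $0=t_0<\dots<t_n=t$ with mesh less than $\delta$ and all tags $u_i\in[t_{i-1},t_i]$ (for $t=0$ the integral is $0$). Then there exists a q.m. integral process of $f$ with respect to $X$, that is, a measurable and separable real-valued process $Y=\{Y(t):t\in[0,T]\}$ on $(\Omega,\mathcal F,\Pr)$ such that, for each $t\in[0,T]$, the q.m. integral $\int_0^tf\,dX$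 exists and equals $Y(t)$ almost surely. Moreover, for any such $Y$ the expectations $E|Y(t)-Y(s)|^r$ are finite, $|f|^r$ is integrable on $[0,T]$, and for each sequence of partitions $0=t_0^n<t_1^n<\dots<t_{m_n}^n=T$ with $\max_i(t_i^n-t_{i-1}^n)\to0$ as $n\to\infty$, $$\lim_{n\to\infty}\sum_{i=1}^{m_n}\frac{E|Y(t_i^n)-Y(t_{i-1}^n)|^r}{[\rho(t_i^n-t_{i-1}^n)]^r}\,(t_i^n-t_{i-1}^n)=E|\eta|^r\int_0^T|f|^r,$$ where $\eta$ is a $N(0,1)$ random variable. -/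

import Mathlib

open MeasureTheory ProbabilityTheory Filter Topology Set
open scoped ENNReal

namespace QMIntegral

/-- A partition `a = t 0 < t 1 < ... < t n = b` of the interval `[a, b]`. Only the values `t i` with
`i ≤ n` matter. If `a = b` the only partition is the one-point partition, with `n = 0`. -/
structure IntervalPartition (a b : ℝ) where
  n : ℕ
  t : ℕ → ℝ
  t_zero : t 0 = a
  t_last : t n = b
  strictMonoOn : StrictMonoOn t (Set.Iic n)

/-- The length of the `i`-th subinterval `[t i, t (i + 1)]`, for `i < n`. -/
def IntervalPartition.step {a b : ℝ} (κ : IntervalPartition a b) (i : ℕ) : ℝ :=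
  κ.t (i + 1) - κ.t i

/-- The mesh of a partition: the largest length of a subinterval. -/
noncomputable def IntervalPartition.mesh {a b : ℝ} (κ : IntervalPartition a b) : ℝ :=
  ⨆ i : Fin κ.n, κ.step i

/-- `u i` lies in the `i`-th subinterval of the partition, for each `i`. -/
def IntervalPartition.IsTag {a b : ℝ} (κ : IntervalPartition a b) (u : ℕ → ℝ) : Prop :=
  ∀ i < κ.n, u i ∈ Set.Icc (κ.t i) (κ.t (i + 1))

/-- The `p`-variation seminorm of `f` on `[a, b]`, as an extended nonnegative number. -/
noncomputable def pVariation (p : ℝ) (f : ℝ → ℝ) (a b : ℝ) : ℝ≥0∞ :=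
  ⨆ κ : IntervalPartition a b,
    ENNReal.ofReal ((∑ i ∈ Finset.range κ.n, |f (κ.t (i + 1)) - f (κ.t i)| ^ p) ^ (1 / p))

/-- The double increment of `G` over the rectangle `[s, s'] × [t, t']`. -/
def doubleIncrement (G : ℝ → ℝ → ℝ) (s s' t t' : ℝ) : ℝ :=
  G s' t' - G s t' - G s' t + G s t

/-- The `p`-variation seminorm of `G` on the rectangle `[a, b] × [c, d]`, as an extended nonnegative
number; the supremum is over all grid partitions of the rectangle. -/
noncomputable def pVariation₂ (p : ℝ) (G : ℝ → ℝ → ℝ) (a b c d : ℝ) : ℝ≥0∞ :=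
  ⨆ (κ : IntervalPartition a b) (l : IntervalPartition c d),
    ENNReal.ofReal ((∑ i ∈ Finset.range κ.n, ∑ j ∈ Finset.range l.n,
      |doubleIncrement G (κ.t i) (κ.t (i + 1)) (l.t j) (l.t (j + 1))| ^ p) ^ (1 / p))

/-- `f` is regulated on `[a, b]`: it has left limits on `(a, b]` and right limits on `[a, b)`. -/
def IsRegulatedOn (f : ℝ → ℝ) (a b : ℝ) : Prop :=
  (∀ x ∈ Set.Ioc a b, ∃ l : ℝ, Tendsto f (𝓝[<] x) (𝓝 l)) ∧
  (∀ x ∈ Set.Ico a b, ∃ l : ℝ, Tendsto f (𝓝[>] x) (𝓝 l))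

/-- The class `W_q[a, b]`, `1 ≤ q ≤ ∞`: functions of bounded `q`-variation if `q < ∞`, and regulated
functions if `q = ∞`. -/
def MemW (q : ℝ≥0∞) (f : ℝ → ℝ) (a b : ℝ) : Prop :=
  (q = ∞ → IsRegulatedOn f a b) ∧ (q ≠ ∞ → pVariation q.toReal f a b < ∞)

/-- The set of admissible exponents: `Q_1 = {∞}`, and `Q_p = [1, p / (p - 1))` if `p > 1`. -/
def Q (p : ℝ) : Set ℝ≥0∞ :=
  {q | (p = 1 ∧ q = ∞) ∨ (1 < p ∧ 1 ≤ q ∧ q < ENNReal.ofReal (p / (p - 1)))}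

/-- The class `R[0, T]` of candidate local variance functions. -/
structure IsVarianceScale (T : ℝ) (ρ : ℝ → ℝ) : Prop where
  nonneg : ∀ u ∈ Set.Icc 0 T, 0 ≤ ρ u
  zero : ρ 0 = 0
  continuous_zero : ContinuousWithinAt ρ (Set.Icc 0 T) 0
  inf_pos : ∀ δ ∈ Set.Ioo 0 T, 0 < sInf (ρ '' Set.Icc δ T)
  sup_finite : ∀ δ ∈ Set.Ioo 0 T, BddAbove (ρ '' Set.Icc δ T)

variable {Ω : Type*} [MeasurableSpace Ω]

/-- The covariance function `E[X(s) X(t)]` (of a mean-zero process). -/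
noncomputable def covFun (P : Measure Ω) (X : ℝ → Ω → ℝ) (s t : ℝ) : ℝ :=
  ∫ ω, X s ω * X t ω ∂P

/-- The square root `σ_X` of the incremental variance `E[X(t) - X(s)]²`. -/
noncomputable def incrStd (P : Measure Ω) (X : ℝ → Ω → ℝ) (s t : ℝ) : ℝ :=
  Real.sqrt (∫ ω, (X t ω - X s ω) ^ 2 ∂P)

/-- `X ∈ LSI(ρ)`: the second order process `(X(t))`, `t ∈ [0, T]`, has local variance with `ρ`.
The last field says that, for each `ε ∈ (0, T)`, the supremum of `|σ_X(s, s + h) / ρ(h) - 1|` over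
`s ∈ [ε, T)` and `h ∈ (0, min δ (T - s)]` tends to `0` as `δ ↓ 0`. -/
structure LSI (P : Measure Ω) (T : ℝ) (ρ : ℝ → ℝ) (X : ℝ → Ω → ℝ) : Prop where
  scale : IsVarianceScale T ρ
  second_order : ∀ t ∈ Set.Icc 0 T, MemLp (X t) 2 P
  upper : ∃ L : ℝ, ∀ s ∈ Set.Icc 0 T, ∀ t ∈ Set.Icc 0 T, incrStd P X s t ≤ L * ρ |t - s|
  asymp : ∀ ε ∈ Set.Ioo 0 T, ∀ θ > 0, ∃ δ > 0, ∀ s ∈ Set.Ico ε T,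
    ∀ h ∈ Set.Ioc 0 (min δ (T - s)), |incrStd P X s (s + h) / ρ h - 1| ≤ θ

/-- The Riemann-Stieltjes sum of `f` with respect to `X` with tags `u`. -/
def rsSum (f : ℝ → ℝ) (X : ℝ → Ω → ℝ) {a b : ℝ} (κ : IntervalPartition a b) (u : ℕ → ℝ) (ω : Ω) :
    ℝ :=
  ∑ i ∈ Finset.range κ.n, f (u i) * (X (κ.t (i + 1)) ω - X (κ.t i) ω)

/-- The quadratic mean Riemann-Stieltjes integral of `f` with respect to the second order process
`X` over `[a, b]` exists and equals `I`. -/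
def IsQMIntegral (P : Measure Ω) (f : ℝ → ℝ) (X : ℝ → Ω → ℝ) (a b : ℝ) (I : Ω → ℝ) : Prop :=
  MemLp I 2 P ∧ ∀ ε > 0, ∃ δ > 0, ∀ (κ : IntervalPartition a b) (u : ℕ → ℝ),
    κ.IsTag u → κ.mesh < δ → ∫ ω, (rsSum f X κ u ω - I ω) ^ 2 ∂P < ε

/-- Separability of the process `(Y(t))`, `t ∈ [0, T]`: there is a countable `S ⊆ [0, T]` such that,
outside a null set, for every open interval `(a, b)` and closed set `F`, if `Y(s) ∈ F` for all
`s ∈ S ∩ (a, b)` then `Y(t) ∈ F` for all `t ∈ [0, T] ∩ (a, b)`. -/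
def IsSeparableProcess (P : Measure Ω) (T : ℝ) (Y : ℝ → Ω → ℝ) : Prop :=
  ∃ S : Set ℝ, S.Countable ∧ S ⊆ Set.Icc 0 T ∧ ∀ᵐ ω ∂P, ∀ (a b : ℝ) (F : Set ℝ), IsClosed F →
    (∀ s ∈ S ∩ Set.Ioo a b, Y s ω ∈ F) → ∀ t ∈ Set.Icc 0 T ∩ Set.Ioo a b, Y t ω ∈ F

/-- `Y` is a q.m. integral process of `f` with respect to `X` on `[0, T]`: a (jointly) measurable and
separable process such that for each `t ∈ [0, T]` the q.m. integral of `f` over `[0, t]` exists and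
equals `Y(t)` almost surely. -/
structure IsQMIntegralProcess (P : Measure Ω) (T : ℝ) (f : ℝ → ℝ) (X Y : ℝ → Ω → ℝ) : Prop where
  measurable : Measurable (fun z : Set.Icc (0 : ℝ) T × Ω => Y z.1 z.2)
  separable : IsSeparableProcess P T Y
  eq_integral : ∀ t ∈ Set.Icc 0 T, ∃ I : Ω → ℝ, IsQMIntegral P f X 0 t I ∧ Y t =ᵐ[P] I

end QMIntegral

/-! Regard X as a path x in L². By Hölder duality, the bound on the p-variation of the covariance
passes to the scalar functions ⟨h, x⟩: on [s, t] their p-variation is at most ‖h‖ w, where w = c ρ(t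
- s) (`sum_abs_inner_rpow_le`). The Young–Loève inequality (for p = 1, the sup-norm bound), applied
with h equal to a Riemann–Stieltjes sum itself, bounds the norm of that sum by a constant times w.

The integrand f is uniformly close to step functions that are constant on the levels of a bounded
monotone function N with values in ℕ. For p > 1, interpolation makes the remainder small in
q'-variation too, for some q' slightly above q that is still admissible in Young's inequality. Hence
the sums of f and of the step function differ by at most ε w (`IsControlled`). Sums of step
functions converge because x is continuous, so the integral y(t) exists. On an interval [s, t] that
crosses no level, y(t) - y(s) is, up to ε w, a value of f near f on [s, t] times x(t) - x(s). By the
local variance condition, ‖y(t) - y(s)‖ / ρ(t - s) is then close to |f| on short intervals of this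
kind away from 0. The other intervals have small total length, and there the ratio is bounded.

The integrals lie in the closed span of X, which consists of centered Gaussian variables. So E|Y(t)
- Y(s)|^r is E|η|^r times ‖y(t) - y(s)‖^r, and the sums of the theorem are perturbed Riemann sums of
|f|^r (`tendsto_sum_rpow_mul_step`).

It remains to find a real-valued version of y that is jointly measurable and separable. The obstacle
is a time at which the path, along the rationals, tends to infinity in absolute value. Almost surely
there is none (`ae_not_blowUp`). First, the path cannot change sign while skipping [-1, 1]: a
finite-dimensional projection is continuous in time, and the residual is small and independent of
it. Second, boundedness on exactly one side is independent of finitely many values of the process,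
which together with symmetry of the law forces probability zero. A path tending to infinity in
absolute value would violate one of the two. -/

namespace QMIntegral

/-! ### Partitions of an interval: concatenation, mesh, sums. -/

section

namespace IntervalPartition

variable {a b c : ℝ}

lemma monotoneOn (κ : IntervalPartition a b) : MonotoneOn κ.t (Set.Iic κ.n) :=
  κ.strictMonoOn.monotoneOn

lemma le (κ : IntervalPartition a b) : a ≤ b := by
  have := κ.monotoneOn (Set.mem_Iic.2 (Nat.zero_le κ.n)) (Set.mem_Iic.2 le_rfl) (Nat.zero_le _)
  rwa [κ.t_zero, κ.t_last] at this

lemma mem_Icc (κ : IntervalPartition a b) {i : ℕ} (hi : i ≤ κ.n) : κ.t i ∈ Set.Icc a b := by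
  have h1 := κ.monotoneOn (Set.mem_Iic.2 (Nat.zero_le κ.n)) (Set.mem_Iic.2 hi) (Nat.zero_le i)
  have h2 := κ.monotoneOn (Set.mem_Iic.2 hi) (Set.mem_Iic.2 le_rfl) hi
  rw [κ.t_zero] at h1
  rw [κ.t_last] at h2
  exact ⟨h1, h2⟩

lemma lt_succ (κ : IntervalPartition a b) {i : ℕ} (hi : i < κ.n) : κ.t i < κ.t (i + 1) :=
  κ.strictMonoOn (Set.mem_Iic.2 hi.le) (Set.mem_Iic.2 hi) (Nat.lt_succ_self i)

lemma step_pos (κ : IntervalPartition a b) {i : ℕ} (hi : i < κ.n) : 0 < κ.step i :=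
  sub_pos.2 (κ.lt_succ hi)

lemma step_le_mesh (κ : IntervalPartition a b) {i : ℕ} (hi : i < κ.n) : κ.step i ≤ κ.mesh :=
  le_ciSup (f := fun i : Fin κ.n => κ.step i) (Set.finite_range _).bddAbove ⟨i, hi⟩

lemma mesh_le (κ : IntervalPartition a b) {d : ℝ} (hd : 0 ≤ d) (h : ∀ i < κ.n, κ.step i ≤ d) :
    κ.mesh ≤ d :=
  Real.iSup_le (fun i => h i i.2) hd

lemma mesh_nonneg (κ : IntervalPartition a b) : 0 ≤ κ.mesh :=
  Real.iSup_nonneg fun i => (κ.step_pos i.2).le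

lemma sum_step (κ : IntervalPartition a b) : ∑ i ∈ Finset.range κ.n, κ.step i = b - a := by
  simp only [step]
  rw [Finset.sum_range_sub, κ.t_zero, κ.t_last]

/-- The values of a partition, extended by a constant to a monotone sequence. -/
def clamp (κ : IntervalPartition a b) (i : ℕ) : ℝ := κ.t (min i κ.n)

lemma clamp_of_le (κ : IntervalPartition a b) {i : ℕ} (hi : i ≤ κ.n) : κ.clamp i = κ.t i := by
  simp [clamp, hi]

lemma clamp_monotone (κ : IntervalPartition a b) : Monotone κ.clamp := fun i j hij =>
  κ.monotoneOn (by simp) (by simp) (min_le_min_right _ hij)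

lemma clamp_mem (κ : IntervalPartition a b) (i : ℕ) : κ.clamp i ∈ Set.Icc a b :=
  κ.mem_Icc (min_le_right _ _)

/-- The partition of a one-point interval. -/
def nil (a : ℝ) : IntervalPartition a a where
  n := 0
  t := fun _ => a
  t_zero := rfl
  t_last := rfl
  strictMonoOn := by
    intro i hi j hj hij
    simp at hi hj
    omega

/-- The partition with a single subinterval. -/
def single (h : a < b) : IntervalPartition a b where
  n := 1
  t := fun i => if i = 0 then a else b
  t_zero := by simp
  t_last := by simp
  strictMonoOn := by
    intro i hi j hj hij
    simp only [Set.mem_Iic] at hi hj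
    obtain rfl : i = 0 := by omega
    obtain rfl : j = 1 := by omega
    simpa using h

/-- The concatenation of two partitions of adjacent intervals. -/
def concat (κ : IntervalPartition a b) (l : IntervalPartition b c) : IntervalPartition a c where
  n := κ.n + l.n
  t := fun i => if i < κ.n then κ.t i else l.t (i - κ.n)
  t_zero := by
    by_cases h : 0 < κ.n
    · simp [h, κ.t_zero]
    · have h0 : κ.n = 0 := by omega
      have h1 := κ.t_zero
      have h2 := κ.t_last
      rw [h0] at h2
      simp [h0, l.t_zero, ← h1, h2]
  t_last := by simp [l.t_last]
  strictMonoOn := by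
    intro i hi j hj hij
    simp only [Set.mem_Iic] at hi hj
    by_cases h2 : j < κ.n
    · have h1 : i < κ.n := by omega
      simp only [h1, h2, if_true]
      exact κ.strictMonoOn (Set.mem_Iic.2 h1.le) (Set.mem_Iic.2 h2.le) hij
    · by_cases h1 : i < κ.n
      · simp only [h1, h2, if_true, if_false]
        calc κ.t i < κ.t κ.n := κ.strictMonoOn (Set.mem_Iic.2 h1.le) (Set.mem_Iic.2 le_rfl) h1
          _ = b := κ.t_last
          _ ≤ _ := (l.mem_Icc (by omega)).1
      · simp only [h1, h2, if_false]
        exact l.strictMonoOn (Set.mem_Iic.2 (by omega)) (Set.mem_Iic.2 (by omega)) (by omega)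

@[simp] lemma concat_n (κ : IntervalPartition a b) (l : IntervalPartition b c) :
    (κ.concat l).n = κ.n + l.n := rfl

lemma concat_t_left (κ : IntervalPartition a b) (l : IntervalPartition b c) {i : ℕ}
    (hi : i ≤ κ.n) : (κ.concat l).t i = κ.t i := by
  rcases hi.lt_or_eq with h | rfl
  · simp [concat, h]
  · simp [concat, l.t_zero, κ.t_last]

lemma concat_t_right (κ : IntervalPartition a b) (l : IntervalPartition b c) (i : ℕ) :
    (κ.concat l).t (κ.n + i) = l.t i := by
  simp [concat]

lemma sum_concat {M : Type*} [AddCommMonoid M] (κ : IntervalPartition a b)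
    (l : IntervalPartition b c) (φ : ℝ → ℝ → M) :
    ∑ i ∈ Finset.range (κ.concat l).n, φ ((κ.concat l).t i) ((κ.concat l).t (i + 1)) =
      ∑ i ∈ Finset.range κ.n, φ (κ.t i) (κ.t (i + 1)) +
        ∑ i ∈ Finset.range l.n, φ (l.t i) (l.t (i + 1)) := by
  rw [concat_n, Finset.sum_range_add]
  congr 1
  · refine Finset.sum_congr rfl fun i hi => ?_
    have hi' := Finset.mem_range.1 hi
    rw [concat_t_left _ _ hi'.le, concat_t_left _ _ hi']
  · refine Finset.sum_congr rfl fun i _ => ?_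
    rw [concat_t_right, add_assoc, concat_t_right]

lemma concat_mesh_le (κ : IntervalPartition a b) (l : IntervalPartition b c) :
    (κ.concat l).mesh ≤ max κ.mesh l.mesh := by
  refine mesh_le _ (κ.mesh_nonneg.trans (le_max_left _ _)) fun i hi => ?_
  rw [concat_n] at hi
  by_cases h : i < κ.n
  · rw [step, concat_t_left _ _ h.le, concat_t_left _ _ h]
    exact (κ.step_le_mesh h).trans (le_max_left _ _)
  · obtain ⟨j, rfl⟩ := Nat.exists_eq_add_of_le (not_lt.1 h)
    rw [step, concat_t_right, add_assoc, concat_t_right]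
    exact (l.step_le_mesh (by omega)).trans (le_max_right _ _)

lemma isTag_left (κ : IntervalPartition a b) : κ.IsTag κ.t := fun _ hi =>
  ⟨le_rfl, (κ.lt_succ hi).le⟩

lemma exists_mesh_lt (hab : a ≤ b) {δ : ℝ} (hδ : 0 < δ) :
    ∃ κ : IntervalPartition a b, κ.mesh < δ := by
  rcases hab.eq_or_lt with rfl | h
  · refine ⟨nil a, ?_⟩
    have : IsEmpty (Fin (nil a).n) := Fin.isEmpty
    simpa [mesh] using hδ
  · obtain ⟨n, hn⟩ := exists_nat_gt ((b - a) / (δ / 2))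
    have hba : 0 < b - a := sub_pos.2 h
    have hn0 : (0 : ℝ) < n := lt_trans (by positivity) hn
    refine ⟨⟨n, fun i => a + i * ((b - a) / n), by simp, by field_simp; ring, ?_⟩, ?_⟩
    · intro i _ j _ hij
      have : (i : ℝ) < j := by exact_mod_cast hij
      have := mul_lt_mul_of_pos_right this (div_pos hba hn0)
      simpa using this
    · refine lt_of_le_of_lt (mesh_le _ (by positivity : 0 ≤ δ / 2) fun i _ => ?_) (half_lt_self hδ)
      simp only [step]
      push_cast
      have : (b - a) / n ≤ δ / 2 := by
        rw [div_le_iff₀ hn0]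
        rw [div_lt_iff₀ (by positivity)] at hn
        linarith
      linarith

/-- Sums of a nonnegative functional, vanishing on the diagonal, along monotone sequences are
dominated by sums over partitions. -/
lemma sum_monotone_le {φ : ℝ → ℝ → ℝ} (h0 : ∀ x y, 0 ≤ φ x y) (hd : ∀ x, φ x x = 0) {C : ℝ}
    (hC : ∀ κ : IntervalPartition a b,
      ∑ i ∈ Finset.range κ.n, φ (κ.t i) (κ.t (i + 1)) ≤ C)
    {u : ℕ → ℝ} (hu : Monotone u) (hmem : ∀ i, u i ∈ Set.Icc a b) (m : ℕ) :
    ∑ i ∈ Finset.range m, φ (u i) (u (i + 1)) ≤ C := by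
  -- Repeated points of the sequence are dropped, at no cost since φ vanishes on the diagonal. The
  -- pieces [a, u 0] and, below, [u m, b] are added, which only increases the sum.
  have key : ∃ κ : IntervalPartition a (u m), ∑ i ∈ Finset.range m, φ (u i) (u (i + 1)) ≤
      ∑ i ∈ Finset.range κ.n, φ (κ.t i) (κ.t (i + 1)) := by
    induction m with
    | zero =>
      rcases (hmem 0).1.eq_or_lt with h | h
      · rw [← h]
        exact ⟨nil a, by simpa using Finset.sum_nonneg fun i _ => h0 _ _⟩
      · exact ⟨single h, by simpa using Finset.sum_nonneg fun i _ => h0 _ _⟩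
    | succ m ih =>
      obtain ⟨κ, hκ⟩ := ih
      rcases (hu (Nat.le_succ m)).eq_or_lt with h | h
      · rw [Nat.succ_eq_add_one] at h
        rw [Finset.sum_range_succ, ← h, hd, add_zero]
        exact ⟨κ, hκ⟩
      · refine ⟨κ.concat (single h), ?_⟩
        rw [sum_concat, Finset.sum_range_succ]
        gcongr
        simp [single]
  obtain ⟨κ, hκ⟩ := key
  rcases (hmem m).2.eq_or_lt with h | h
  · rw [h] at κ
    subst_vars
    exact hκ.trans (hC _)
  · refine hκ.trans (le_trans ?_ (hC (κ.concat (single h))))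
    rw [sum_concat]
    exact le_add_of_nonneg_right (Finset.sum_nonneg fun i _ => h0 _ _)

end IntervalPartition

end

/-! ### The Young–Loève inequality. -/

section

/-- The minimum is at most the mean: with θ = 1/p + 1/q, Hölder's inequality bounds the sum of the
powers |x i * y i| ^ θ⁻¹ by (A * B) ^ θ⁻¹, so the n summands cannot all exceed one n-th of it. In
Young's argument this selects the partition point to be removed. -/
lemma exists_abs_mul_le_of_sum_rpow_le {p q A B : ℝ} (hp : 0 < p) (hq : 0 < q) (hA : 0 ≤ A)
    (hB : 0 ≤ B) {n : ℕ} (hn : 0 < n) {x y : ℕ → ℝ}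
    (hx : ∑ i ∈ Finset.range n, |x i| ^ q ≤ A ^ q) (hy : ∑ i ∈ Finset.range n, |y i| ^ p ≤ B ^ p) :
    ∃ k < n, |x k * y k| ≤ (n : ℝ) ^ (-(1 / p + 1 / q)) * (A * B) := by
  set θ : ℝ := 1 / p + 1 / q with hθ
  have hθ0 : 0 < θ := by positivity
  have hn' : (0 : ℝ) < n := by exact_mod_cast hn
  by_contra! hcon
  have htr : Real.HolderTriple q p θ⁻¹ := by
    refine ⟨?_, hq, hp⟩
    rw [inv_inv, hθ, one_div, one_div, add_comm]
  have h1 := Real.Lr_rpow_le_Lp_mul_Lq (Finset.range n) x y htr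
  have h2 : (∑ i ∈ Finset.range n, |x i| ^ q) ^ (θ⁻¹ / q) ≤ A ^ θ⁻¹ := by
    calc _ ≤ (A ^ q) ^ (θ⁻¹ / q) :=
          Real.rpow_le_rpow (Finset.sum_nonneg fun i _ => by positivity) hx (by positivity)
      _ = A ^ θ⁻¹ := by rw [← Real.rpow_mul hA]; congr 1; field_simp
  have h3 : (∑ i ∈ Finset.range n, |y i| ^ p) ^ (θ⁻¹ / p) ≤ B ^ θ⁻¹ := by
    calc _ ≤ (B ^ p) ^ (θ⁻¹ / p) :=
          Real.rpow_le_rpow (Finset.sum_nonneg fun i _ => by positivity) hy (by positivity)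
      _ = B ^ θ⁻¹ := by rw [← Real.rpow_mul hB]; congr 1; field_simp
  have h4 : ∑ i ∈ Finset.range n, |x i * y i| ^ θ⁻¹ ≤ (A * B) ^ θ⁻¹ := by
    rw [Real.mul_rpow hA hB]
    exact h1.trans (mul_le_mul h2 h3 (Real.rpow_nonneg (Finset.sum_nonneg fun i _ => by positivity) _)
      (by positivity))
  have h5 : ∀ i ∈ Finset.range n, (n : ℝ)⁻¹ * (A * B) ^ θ⁻¹ < |x i * y i| ^ θ⁻¹ := by
    intro i hi
    have := Real.rpow_lt_rpow (by positivity) (hcon i (Finset.mem_range.1 hi)) (inv_pos.2 hθ0)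
    rwa [Real.mul_rpow (by positivity) (by positivity), ← Real.rpow_mul hn'.le,
      neg_mul, mul_inv_cancel₀ hθ0.ne', Real.rpow_neg_one] at this
  have h6 := Finset.sum_lt_sum_of_nonempty (by simpa using hn.ne') h5
  rw [Finset.sum_const, Finset.card_range, nsmul_eq_mul, ← mul_assoc, mul_inv_cancel₀ hn'.ne',
    one_mul] at h6
  exact absurd h6 (not_lt.2 h4)

/-- The reindexing skips the point j + 1. Merging the two intervals that meet there replaces the
factor a (j + 1) of the second one by a j, which accounts for the last product. -/
lemma sum_mul_sub_remove (a g : ℕ → ℝ) {j n : ℕ} (hj : j ≤ n) :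
    ∑ i ∈ Finset.range (n + 2), a i * (g (i + 1) - g i) =
      ∑ i ∈ Finset.range (n + 1), a (if i < j + 1 then i else i + 1) *
        (g (if i + 1 < j + 1 then i + 1 else i + 1 + 1) - g (if i < j + 1 then i else i + 1)) +
      (a (j + 1) - a j) * (g (j + 2) - g (j + 1)) := by
  induction n, hj using Nat.le_induction with
  | base =>
    rw [Finset.sum_range_succ, Finset.sum_range_succ, Finset.sum_range_succ]
    have : ∑ i ∈ Finset.range j, a i * (g (i + 1) - g i) =
      ∑ i ∈ Finset.range j, a (if i < j + 1 then i else i + 1) *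
        (g (if i + 1 < j + 1 then i + 1 else i + 1 + 1) - g (if i < j + 1 then i else i + 1)) := by
      refine Finset.sum_congr rfl fun i hi => ?_
      have := Finset.mem_range.1 hi
      rw [if_pos (by omega), if_pos (by omega)]
    rw [this, if_pos (by omega), if_neg (by omega)]
    ring
  | succ n hn ih =>
    rw [Finset.sum_range_succ, ih, Finset.sum_range_succ _ (n + 1), if_neg (by omega),
      if_neg (by omega)]
    ring

/-- The Young–Loève inequality for sums. -/
theorem abs_sum_mul_sub_le {p q A B : ℝ} (hp : 0 < p) (hq : 0 < q) (hA : 0 ≤ A) (hB : 0 ≤ B)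
    (n : ℕ) (a g : ℕ → ℝ)
    (ha : ∀ φ : ℕ → ℕ, Monotone φ → ∀ m,
      ∑ i ∈ Finset.range m, |a (φ (i + 1)) - a (φ i)| ^ q ≤ A ^ q)
    (hg : ∀ φ : ℕ → ℕ, Monotone φ → ∀ m,
      ∑ i ∈ Finset.range m, |g (φ (i + 1)) - g (φ i)| ^ p ≤ B ^ p) :
    |∑ i ∈ Finset.range (n + 1), a i * (g (i + 1) - g i) - a 0 * (g (n + 1) - g 0)| ≤
      (∑ k ∈ Finset.range n, ((k + 1 : ℕ) : ℝ) ^ (-(1 / p + 1 / q))) * (A * B) := by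
  induction n generalizing a g with
  | zero => simp
  | succ n ih =>
    -- The increments of g are shifted by one, so that the selected product is exactly the cost of
    -- removing the point j + 1. There are n + 1 candidates, hence the new term of the series.
    obtain ⟨j, hj, hjle⟩ := exists_abs_mul_le_of_sum_rpow_le hp hq hA hB (Nat.succ_pos n)
      (x := fun i => a (i + 1) - a i) (y := fun i => g (i + 1 + 1) - g (i + 1))
      (ha id monotone_id _) (hg (· + 1) (fun i k h => Nat.succ_le_succ h) _)
    set d : ℕ → ℕ := fun i => if i < j + 1 then i else i + 1 with hd
    have hdm : Monotone d := by
      intro i k hik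
      simp only [hd]
      split_ifs <;> omega
    -- The variation hypotheses range over all monotone reindexings precisely so that they survive
    -- the removal of a point.
    have h1 := ih (a ∘ d) (g ∘ d) (fun φ hφ m => ha (d ∘ φ) (hdm.comp hφ) m)
      (fun φ hφ m => hg (d ∘ φ) (hdm.comp hφ) m)
    have h2 := sum_mul_sub_remove a g (j := j) (n := n) (by omega)
    have h3 : d 0 = 0 := by simp [hd]
    have h4 : d (n + 1) = n + 1 + 1 := by
      simp only [hd]
      rw [if_neg (by omega)]
    simp only [Function.comp, h3, h4] at h1
    rw [h2, Finset.sum_range_succ (fun k : ℕ => ((k + 1 : ℕ) : ℝ) ^ (-(1 / p + 1 / q))), add_mul]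
    calc _ = |(∑ i ∈ Finset.range (n + 1), a (d i) * (g (d (i + 1)) - g (d i)) -
            a 0 * (g (n + 1 + 1) - g 0)) +
            (a (j + 1) - a j) * (g (j + 1 + 1) - g (j + 1))| := by
          congr 1
          simp only [hd]
          ring
      _ ≤ _ := (abs_add_le _ _).trans (add_le_add h1 hjle)

/-- The constant of the Young–Loève inequality. -/
noncomputable def youngConst (p q : ℝ) : ℝ :=
  ∑' k : ℕ, ((k + 1 : ℕ) : ℝ) ^ (-(1 / p + 1 / q))

lemma youngConst_nonneg (p q : ℝ) : 0 ≤ youngConst p q :=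
  tsum_nonneg fun k => by positivity

lemma sum_le_youngConst {p q : ℝ} (h : 1 < 1 / p + 1 / q) (n : ℕ) :
    ∑ k ∈ Finset.range n, ((k + 1 : ℕ) : ℝ) ^ (-(1 / p + 1 / q)) ≤ youngConst p q := by
  refine Summable.sum_le_tsum _ (fun k _ => by positivity) ?_
  exact (summable_nat_add_iff 1).2 (Real.summable_nat_rpow.2 (neg_lt_neg h))

end

/-! ### Level functions and step approximation of the integrand. -/

section

/-- `N` is a bounded monotone function on whose level sets in `[a, b]` the oscillation of `f` is at
most `ε`. -/
structure IsLevelFunction (N : ℝ → ℕ) (f : ℝ → ℝ) (ε a b : ℝ) : Prop where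
  monotone : Monotone N
  bounded : ∃ B, ∀ x, N x ≤ B
  surj : ∀ x, ∃ y ∈ Set.Icc a b, N y = N x
  osc : ∀ x ∈ Set.Icc a b, ∀ y ∈ Set.Icc a b, N x = N y → |f x - f y| ≤ ε

/-- Composing with the projection onto [a, b] makes N monotone on the whole line and ensures that
each of its values is attained in [a, b], as the choice of representatives requires. -/
lemma exists_isLevelFunction {f : ℝ → ℝ} {ε a b : ℝ} (hab : a ≤ b) {N : ℝ → ℕ}
    (hN : MonotoneOn N (Set.Icc a b)) {B : ℕ} (hB : ∀ x ∈ Set.Icc a b, N x ≤ B)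
    (hosc : ∀ x ∈ Set.Icc a b, ∀ y ∈ Set.Icc a b, N x = N y → |f x - f y| ≤ ε) :
    ∃ N : ℝ → ℕ, IsLevelFunction N f ε a b := by
  have hmem : ∀ x : ℝ, (Set.projIcc a b hab x : ℝ) ∈ Set.Icc a b := fun x => Subtype.coe_prop _
  have hfix : ∀ x ∈ Set.Icc a b, (Set.projIcc a b hab x : ℝ) = x := fun x hx => by
    rw [Set.projIcc_of_mem hab hx]
  refine ⟨fun x => N (Set.projIcc a b hab x), ?_, ⟨B, fun x => hB _ (hmem x)⟩, ?_, ?_⟩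
  · intro x y hxy
    exact hN (hmem x) (hmem y) (Set.monotone_projIcc hab hxy)
  · intro x
    exact ⟨_, hmem x, by simp⟩
  · intro x hx y hy h
    simp only [hfix x hx, hfix y hy] at h
    exact hosc x hx y hy h

section Representative

open Classical in
/-- A choice of representatives of the level sets of `N` in `[a, b]`. -/
noncomputable def levelRep (N : ℝ → ℕ) (a b : ℝ) (k : ℕ) : ℝ :=
  if h : ∃ y ∈ Set.Icc a b, N y = k then h.choose else a

variable {N : ℝ → ℕ} {f : ℝ → ℝ} {ε a b : ℝ}

lemma IsLevelFunction.rep_mem (h : IsLevelFunction N f ε a b) (x : ℝ) :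
    levelRep N a b (N x) ∈ Set.Icc a b := by
  have h' := h.surj x
  simp only [levelRep, h', dif_pos]
  exact h'.choose_spec.1

lemma IsLevelFunction.rep_level (h : IsLevelFunction N f ε a b) (x : ℝ) :
    N (levelRep N a b (N x)) = N x := by
  have h' := h.surj x
  simp only [levelRep, h', dif_pos]
  exact h'.choose_spec.2

/-- Distinct levels are ordered like their representatives. Consequently the variation sums of the
step approximant are themselves variation sums of f. -/
lemma IsLevelFunction.rep_monotone (h : IsLevelFunction N f ε a b) :
    Monotone fun x => levelRep N a b (N x) := by
  intro x y hxy
  rcases (h.monotone hxy).eq_or_lt with h1 | h1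
  · simp only [h1, le_refl]
  · refine le_of_lt (lt_of_not_ge fun h2 => ?_)
    have := h.monotone h2
    rw [h.rep_level, h.rep_level] at this
    omega

lemma IsLevelFunction.abs_sub_rep_le (h : IsLevelFunction N f ε a b) {x : ℝ}
    (hx : x ∈ Set.Icc a b) : |f x - f (levelRep N a b (N x))| ≤ ε :=
  h.osc x hx _ (h.rep_mem x) (h.rep_level x).symm

end Representative

lemma IsLevelFunction.bounded_on {N : ℝ → ℕ} {f : ℝ → ℝ} {ε a b : ℝ}
    (h : IsLevelFunction N f ε a b) : ∃ M, ∀ x ∈ Set.Icc a b, |f x| ≤ M := by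
  obtain ⟨B, hB⟩ := h.bounded
  refine ⟨∑ k ∈ Finset.range (B + 1), |f (levelRep N a b k)| + ε, fun x hx => ?_⟩
  have h1 := h.abs_sub_rep_le hx
  have h2 : |f (levelRep N a b (N x))| ≤ ∑ k ∈ Finset.range (B + 1), |f (levelRep N a b k)| :=
    Finset.single_le_sum (f := fun k => |f (levelRep N a b k)|) (fun k _ => abs_nonneg _)
      (Finset.mem_range.2 (Nat.lt_succ_of_le (hB x)))
  have h3 := abs_sub_abs_le_abs_sub (f x) (f (levelRep N a b (N x)))
  linarith

/-- A monotone bounded function changes its level at few subintervals of a partition. -/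
lemma card_level_ne_le {N : ℝ → ℕ} (hN : Monotone N) {B : ℕ} (hB : ∀ x, N x ≤ B) {a b : ℝ}
    (κ : IntervalPartition a b) :
    ((Finset.range κ.n).filter fun i => N (κ.t i) ≠ N (κ.t (i + 1))).card ≤ B + 1 := by
  rw [← Finset.card_range (B + 1)]
  refine Finset.card_le_card_of_injOn (fun i => N (κ.t i))
    (fun i _ => by simpa using Nat.lt_succ_of_le (hB _)) ?_
  -- Once left, a level is never revisited. So the level at the left endpoint is injective on the
  -- subintervals where the level changes.
  have key : ∀ i j, i < j → j < κ.n → N (κ.t i) ≠ N (κ.t (i + 1)) → N (κ.t i) ≠ N (κ.t j) := by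
    intro i j hij hj hne h
    have h1 : N (κ.t i) ≤ N (κ.t (i + 1)) := hN (κ.lt_succ (by omega)).le
    have h2 : N (κ.t (i + 1)) ≤ N (κ.t j) :=
      hN (κ.monotoneOn (Set.mem_Iic.2 (by omega)) (Set.mem_Iic.2 hj.le) hij)
    omega
  intro i hi j hj h
  simp only [Finset.coe_filter, Finset.mem_range, Set.mem_ofPred_eq] at hi hj
  rcases lt_trichotomy i j with hij | hij | hij
  · exact absurd h (key i j hij hj.1 hi.2)
  · exact hij
  · exact absurd h.symm (key j i hij hi.1 hj.2)

section Variation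

variable {f : ℝ → ℝ} {q C a b : ℝ}

/-- The sums of `q`-th powers of increments of `f` along monotone sequences in `[a, b]` are at most
`C`. -/
def VariationLE (q : ℝ) (f : ℝ → ℝ) (a b C : ℝ) : Prop :=
  ∀ u : ℕ → ℝ, Monotone u → (∀ i, u i ∈ Set.Icc a b) → ∀ m,
    ∑ i ∈ Finset.range m, |f (u (i + 1)) - f (u i)| ^ q ≤ C

lemma VariationLE.of_partition (hq : 0 < q) (h : ∀ κ : IntervalPartition a b,
    ∑ i ∈ Finset.range κ.n, |f (κ.t (i + 1)) - f (κ.t i)| ^ q ≤ C) : VariationLE q f a b C :=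
  fun u hu hmem m => IntervalPartition.sum_monotone_le (φ := fun x y => |f y - f x| ^ q)
    (fun x y => by positivity) (fun x => by simp [hq.ne']) h hu hmem m

lemma exists_variationLE_of_pVariation (hq : 0 < q) (h : pVariation q f a b < ∞) :
    ∃ C, 0 ≤ C ∧ VariationLE q f a b C := by
  refine ⟨(pVariation q f a b).toReal ^ q, by positivity, .of_partition hq fun κ => ?_⟩
  have h0 : 0 ≤ ∑ i ∈ Finset.range κ.n, |f (κ.t (i + 1)) - f (κ.t i)| ^ q :=
    Finset.sum_nonneg fun i _ => by positivity
  have h1 : ENNReal.ofReal ((∑ i ∈ Finset.range κ.n, |f (κ.t (i + 1)) - f (κ.t i)| ^ q) ^ (1 / q))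
      ≤ pVariation q f a b := le_iSup (fun κ : IntervalPartition a b => ENNReal.ofReal
        ((∑ i ∈ Finset.range κ.n, |f (κ.t (i + 1)) - f (κ.t i)| ^ q) ^ (1 / q))) κ
  rw [ENNReal.ofReal_le_iff_le_toReal h.ne] at h1
  have h2 := Real.rpow_le_rpow (by positivity) h1 hq.le
  rwa [← Real.rpow_mul h0, one_div_mul_cancel hq.ne', Real.rpow_one] at h2

lemma VariationLE.mono {s t : ℝ} (h : VariationLE q f a b C) (hs : a ≤ s) (ht : t ≤ b) :
    VariationLE q f s t C := fun u hu hmem m =>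
  h u hu (fun i => ⟨hs.trans (hmem i).1, (hmem i).2.trans ht⟩) m

/-- The sums of powers of increments of `f` over a partition. -/
noncomputable def powSum (q : ℝ) (f : ℝ → ℝ) {a b : ℝ} (κ : IntervalPartition a b) : ℝ :=
  ∑ i ∈ Finset.range κ.n, |f (κ.t (i + 1)) - f (κ.t i)| ^ q

lemma VariationLE.powSum_le (h : VariationLE q f a b C) {y : ℝ} (hy : y ≤ b)
    (κ : IntervalPartition a y) : powSum q f κ ≤ C := by
  refine le_of_eq_of_le (Finset.sum_congr rfl fun i hi => ?_)
    (h κ.clamp κ.clamp_monotone (fun i => ⟨(κ.clamp_mem i).1, (κ.clamp_mem i).2.trans hy⟩) κ.n)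
  have := Finset.mem_range.1 hi
  rw [κ.clamp_of_le this, κ.clamp_of_le this.le]

/-- Appending the single interval [y, z] to a partition of [a, y] gives a partition of [a, z]. -/
lemma VariationLE.abs_sub_rpow_le (h : VariationLE q f a b C) (hq : 0 < q) {y z : ℝ}
    (hy : y ∈ Set.Icc a b) (hz : z ∈ Set.Icc a b) (hyz : y ≤ z) :
    (⨆ κ : IntervalPartition a y, powSum q f κ) + |f z - f y| ^ q ≤
      ⨆ κ : IntervalPartition a z, powSum q f κ := by
  have hbdd : BddAbove (Set.range fun κ : IntervalPartition a z => powSum q f κ) :=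
    ⟨C, by rintro _ ⟨κ, rfl⟩; exact h.powSum_le hz.2 κ⟩
  rcases hyz.eq_or_lt with rfl | hlt
  · simp [hq.ne']
  · obtain ⟨κ₀, _⟩ := IntervalPartition.exists_mesh_lt hy.1 one_pos
    have : Nonempty (IntervalPartition a y) := ⟨κ₀⟩
    rw [← le_sub_iff_add_le]
    refine ciSup_le fun κ => ?_
    rw [le_sub_iff_add_le]
    refine le_trans (le_of_eq ?_) (le_ciSup hbdd (κ.concat (.single hlt)))
    rw [powSum, powSum, IntervalPartition.sum_concat κ (.single hlt) fun x y => |f y - f x| ^ q]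
    simp [IntervalPartition.single]

/-- The levels cut the range of the variation function v into blocks of length ε ^ q. Within a block
v grows by less than ε ^ q, and this growth dominates |f z - f y| ^ q. -/
lemma VariationLE.exists_isLevelFunction (h : VariationLE q f a b C) (hq : 0 < q) (hab : a ≤ b)
    {ε : ℝ} (hε : 0 < ε) : ∃ N : ℝ → ℕ, IsLevelFunction N f ε a b := by
  set v : ℝ → ℝ := fun y => ⨆ κ : IntervalPartition a y, powSum q f κ with hv
  have hεq : 0 < ε ^ q := by positivity
  have hv0 : ∀ y, 0 ≤ v y := fun y =>
    Real.iSup_nonneg fun κ => Finset.sum_nonneg fun i _ => by positivity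
  have hstep : ∀ y ∈ Set.Icc a b, ∀ z ∈ Set.Icc a b, y ≤ z → v y + |f z - f y| ^ q ≤ v z :=
    fun y hy z hz hyz => h.abs_sub_rpow_le hq hy hz hyz
  have hmono : MonotoneOn v (Set.Icc a b) := fun y hy z hz hyz =>
    le_trans (le_add_of_nonneg_right (by positivity)) (hstep y hy z hz hyz)
  refine QMIntegral.exists_isLevelFunction hab (N := fun y => ⌊v y / ε ^ q⌋₊)
    (B := ⌊v b / ε ^ q⌋₊) ?_ ?_ ?_
  · intro y hy z hz hyz
    exact Nat.floor_mono (by gcongr; exact hmono hy hz hyz)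
  · intro y hy
    exact Nat.floor_mono (by gcongr; exact hmono hy ⟨hab, le_rfl⟩ hy.2)
  · have key : ∀ y ∈ Set.Icc a b, ∀ z ∈ Set.Icc a b, y ≤ z →
        ⌊v y / ε ^ q⌋₊ = ⌊v z / ε ^ q⌋₊ → |f z - f y| ≤ ε := by
      intro y hy z hz hyz hN
      have h1 : v z / ε ^ q < ⌊v z / ε ^ q⌋₊ + 1 := Nat.lt_floor_add_one _
      have h2 : (⌊v y / ε ^ q⌋₊ : ℝ) ≤ v y / ε ^ q := Nat.floor_le (div_nonneg (hv0 y) hεq.le)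
      rw [← hN] at h1
      have h3 : v z / ε ^ q - v y / ε ^ q < 1 := by linarith
      rw [← sub_div, div_lt_one hεq] at h3
      have h4 := hstep y hy z hz hyz
      have h5 : |f z - f y| ^ q < ε ^ q := by linarith
      exact ((Real.rpow_lt_rpow_iff (abs_nonneg _) hε.le hq).1 h5).le
    intro x hx y hy hN
    rcases le_total x y with hxy | hxy
    · rw [abs_sub_comm]
      exact key x hx y hy hxy hN
    · exact key y hy x hx hxy hN.symm

end Variation

section Regulated

variable {f : ℝ → ℝ} {a b : ℝ}

lemma IsRegulatedOn.exists_osc_le (h : IsRegulatedOn f a b) {ε : ℝ} (hε : 0 < ε) {x : ℝ}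
    (hx : x ∈ Set.Icc a b) :
    ∃ δ > 0, (∀ y ∈ Set.Ioo (x - δ) x ∩ Set.Icc a b, ∀ z ∈ Set.Ioo (x - δ) x ∩ Set.Icc a b,
        |f y - f z| ≤ ε) ∧
      (∀ y ∈ Set.Ioo x (x + δ) ∩ Set.Icc a b, ∀ z ∈ Set.Ioo x (x + δ) ∩ Set.Icc a b,
        |f y - f z| ≤ ε) := by
  have hl : ∃ δ > 0, ∀ y ∈ Set.Ioo (x - δ) x ∩ Set.Icc a b,
      ∀ z ∈ Set.Ioo (x - δ) x ∩ Set.Icc a b, |f y - f z| ≤ ε := by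
    rcases hx.1.eq_or_lt with rfl | hlt
    · refine ⟨1, one_pos, fun y hy => ?_⟩
      exact absurd hy.1.2 (not_lt.2 hy.2.1)
    · obtain ⟨l, hl⟩ := h.1 x ⟨hlt, hx.2⟩
      have h1 := hl (Metric.ball_mem_nhds l (half_pos hε))
      obtain ⟨c, hc, hsub⟩ := mem_nhdsLT_iff_exists_Ioo_subset.1 h1
      refine ⟨x - c, sub_pos.2 hc, fun y hy z hz => ?_⟩
      rw [sub_sub_cancel] at hy hz
      have h2 : |f y - l| < ε / 2 := hsub hy.1
      have h3 : |f z - l| < ε / 2 := hsub hz.1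
      rw [abs_lt] at h2 h3
      rw [abs_le]
      constructor <;> linarith
  have hr : ∃ δ > 0, ∀ y ∈ Set.Ioo x (x + δ) ∩ Set.Icc a b,
      ∀ z ∈ Set.Ioo x (x + δ) ∩ Set.Icc a b, |f y - f z| ≤ ε := by
    rcases hx.2.eq_or_lt with rfl | hlt
    · refine ⟨1, one_pos, fun y hy => ?_⟩
      exact absurd hy.1.1 (not_lt.2 hy.2.2)
    · obtain ⟨l, hl⟩ := h.2 x ⟨hx.1, hlt⟩
      have h1 := hl (Metric.ball_mem_nhds l (half_pos hε))
      obtain ⟨c, hc, hsub⟩ := mem_nhdsGT_iff_exists_Ioo_subset.1 h1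
      refine ⟨c - x, sub_pos.2 hc, fun y hy z hz => ?_⟩
      rw [add_sub_cancel] at hy hz
      have h2 : |f y - l| < ε / 2 := hsub hy.1
      have h3 : |f z - l| < ε / 2 := hsub hz.1
      rw [abs_lt] at h2 h3
      rw [abs_le]
      constructor <;> linarith
  obtain ⟨δ₁, hδ₁, h₁⟩ := hl
  obtain ⟨δ₂, hδ₂, h₂⟩ := hr
  refine ⟨min δ₁ δ₂, lt_min hδ₁ hδ₂, fun y hy z hz => h₁ y ?_ z ?_, fun y hy z hz => h₂ y ?_ z ?_⟩
  · exact ⟨⟨by linarith [hy.1.1, min_le_left δ₁ δ₂], hy.1.2⟩, hy.2⟩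
  · exact ⟨⟨by linarith [hz.1.1, min_le_left δ₁ δ₂], hz.1.2⟩, hz.2⟩
  · exact ⟨⟨hy.1.1, by linarith [hy.1.2, min_le_right δ₁ δ₂]⟩, hy.2⟩
  · exact ⟨⟨hz.1.1, by linarith [hz.1.2, min_le_right δ₁ δ₂]⟩, hz.2⟩

/-- A regulated function has small oscillation on intervals avoiding a suitable finite set. -/
lemma IsRegulatedOn.exists_finset (h : IsRegulatedOn f a b) {ε : ℝ} (hε : 0 < ε) :
    ∃ F : Finset ℝ, ∀ x ∈ Set.Icc a b, ∀ y ∈ Set.Icc a b, x ≤ y →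
      (∀ z ∈ F, z ∉ Set.Icc x y) → |f x - f y| ≤ ε := by
  choose! δ hδ hl hr using fun x hx => h.exists_osc_le hε (x := x) hx
  obtain ⟨t, ht, hcov⟩ := isCompact_Icc.elim_nhds_subcover
    (fun x => Set.Ioo (x - δ x) (x + δ x))
    (fun x hx => Ioo_mem_nhds (by linarith [hδ x hx]) (by linarith [hδ x hx]))
  -- An interval that starts in the neighbourhood of a centre c of the finite subcover and avoids
  -- both c and c + δ c stays on one side of c inside that neighbourhood.
  refine ⟨t ∪ t.image (fun x => x - δ x) ∪ t.image (fun x => x + δ x),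
    fun x hx y hy hxy hF => ?_⟩
  obtain ⟨c, hct, hc⟩ := Set.mem_iUnion₂.1 (hcov hx)
  have h1 := hF c (by simp [hct])
  have h3 := hF (c + δ c) (by
    simp only [Finset.mem_union, Finset.mem_image]
    exact Or.inr ⟨c, hct, rfl⟩)
  have hyc : y < c + δ c := by
    by_contra hcon
    exact h3 ⟨hc.2.le, not_lt.1 hcon⟩
  by_cases hxc : x < c
  · have hyc' : y < c := by
      by_contra hcon
      exact h1 ⟨hxc.le, not_lt.1 hcon⟩
    exact hl c (ht c hct) x ⟨⟨hc.1, hxc⟩, hx⟩ y ⟨⟨hc.1.trans_le hxy, hyc'⟩, hy⟩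
  · have hxc' : c < x := lt_of_not_ge fun hcon => h1 ⟨hcon, (not_lt.1 hxc).trans hxy⟩
    exact hr c (ht c hct) x ⟨⟨hxc', hc.2⟩, hx⟩ y ⟨⟨hxc'.trans_le hxy, hyc⟩, hy⟩

/-- Counting the points of F below x strictly and then weakly makes the count jump once on reaching
a point of F and once on leaving it. The levels are thus the single points of F and the gaps between
them. -/
lemma IsRegulatedOn.exists_isLevelFunction (h : IsRegulatedOn f a b) (hab : a ≤ b) {ε : ℝ}
    (hε : 0 < ε) : ∃ N : ℝ → ℕ, IsLevelFunction N f ε a b := by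
  obtain ⟨F, hF⟩ := h.exists_finset hε
  have hsub₁ : ∀ {x y : ℝ}, x ≤ y → F.filter (· < x) ⊆ F.filter (· < y) := fun hxy =>
    Finset.monotone_filter_right F fun z _ hz => lt_of_lt_of_le hz hxy
  have hsub₂ : ∀ {x y : ℝ}, x ≤ y → F.filter (· ≤ x) ⊆ F.filter (· ≤ y) := fun hxy =>
    Finset.monotone_filter_right F fun z _ hz => le_trans hz hxy
  refine QMIntegral.exists_isLevelFunction hab
    (N := fun x => (F.filter (· < x)).card + (F.filter (· ≤ x)).card) (B := F.card + F.card)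
    ?_ ?_ ?_
  · intro x _ y _ hxy
    exact add_le_add (Finset.card_le_card (hsub₁ hxy)) (Finset.card_le_card (hsub₂ hxy))
  · intro x _
    exact add_le_add (Finset.card_filter_le _ _) (Finset.card_filter_le _ _)
  · have key : ∀ x ∈ Set.Icc a b, ∀ y ∈ Set.Icc a b, x ≤ y →
        (F.filter (· < x)).card + (F.filter (· ≤ x)).card =
        (F.filter (· < y)).card + (F.filter (· ≤ y)).card → |f x - f y| ≤ ε := by
      intro x hx y hy hxy hN
      have c1 := Finset.card_le_card (hsub₁ hxy)
      have c2 := Finset.card_le_card (hsub₂ hxy)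
      have e1 := Finset.eq_of_subset_of_card_le (hsub₁ hxy) (by omega)
      have e2 := Finset.eq_of_subset_of_card_le (hsub₂ hxy) (by omega)
      rcases hxy.eq_or_lt with rfl | hlt
      · simpa using hε.le
      refine hF x hx y hy hxy fun z hz hzm => ?_
      rcases hzm.2.eq_or_lt with h1 | h1
      · have : z ∈ F.filter (· ≤ x) := by
          rw [e2]
          simp [hz, hzm.2]
        have := (Finset.mem_filter.1 this).2
        linarith
      · have : z ∈ F.filter (· < x) := by
          rw [e1]
          simp [hz, h1]
        have := (Finset.mem_filter.1 this).2
        linarith [hzm.1]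
    intro x hx y hy hN
    rcases le_total x y with hxy | hxy
    · exact key x hx y hy hxy hN
    · rw [abs_sub_comm]
      exact key y hy x hx hxy hN.symm

end Regulated

end

/-! ### Riemann–Stieltjes sums in a Hilbert space, controlled by the Gram matrix. -/

section

open scoped RealInnerProductSpace

variable {E : Type*} [NormedAddCommGroup E] [InnerProductSpace ℝ E]

lemma norm_sum_smul_sq_le {ι : Type*} (s : Finset ι) (β : ι → ℝ) (v : ι → E) :
    ‖∑ i ∈ s, β i • v i‖ ^ 2 ≤
      ∑ z ∈ s ×ˢ s, (|β z.1| * |β z.2|) * |⟪v z.1, v z.2⟫| := by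
  rw [← real_inner_self_eq_norm_sq, sum_inner, Finset.sum_product]
  refine Finset.sum_le_sum fun i _ => ?_
  rw [inner_sum]
  refine Finset.sum_le_sum fun j _ => ?_
  rw [real_inner_smul_left, real_inner_smul_right, ← mul_assoc, ← abs_mul, ← abs_mul]
  exact le_abs_self _

/-- If the Gram matrix of a finite family of vectors is `p`-summable, so are the inner products of
the family with a fixed vector. -/
theorem sum_abs_inner_rpow_le {ι : Type*} (s : Finset ι) (v : ι → E) {p w : ℝ} (hp : 1 ≤ p)
    (hw : 0 ≤ w) (hV : ∑ i ∈ s, ∑ j ∈ s, |⟪v i, v j⟫| ^ p ≤ (w ^ 2) ^ p) (h : E) :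
    ∑ i ∈ s, |⟪h, v i⟫| ^ p ≤ (‖h‖ * w) ^ p := by
  set d : ι → ℝ := fun i => ⟪h, v i⟫ with hd
  set D : ℝ := ∑ i ∈ s, |d i| ^ p with hD
  have hp0 : 0 < p := by linarith
  have hD0 : 0 ≤ D := Finset.sum_nonneg fun i _ => by positivity
  rcases hD0.eq_or_lt with hDz | hDpos
  · rw [← hDz]
    positivity
  -- The extremal sequence of Hölder duality: D = ∑ β i * d i is the inner product of h with ∑ β i •
  -- v i, and the norm of the latter is controlled by the Gram matrix.
  set β : ι → ℝ := fun i => SignType.sign (d i) * |d i| ^ (p - 1) with hβ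
  have hβd : ∀ i, β i * d i = |d i| ^ p := by
    intro i
    simp only [hβ]
    rcases eq_or_ne (d i) 0 with h0 | h0
    · simp [h0, hp0.ne']
    · rw [mul_right_comm, sign_mul_self, ← Real.rpow_one_add' (abs_nonneg _) (by linarith)]
      congr 1
      ring
  have hβabs : ∀ i, |β i| ≤ |d i| ^ (p - 1) := by
    intro i
    simp only [hβ]
    rw [abs_mul, abs_of_nonneg (by positivity : 0 ≤ |d i| ^ (p - 1))]
    refine mul_le_of_le_one_left (by positivity) ?_
    rcases lt_trichotomy (d i) 0 with h0 | h0 | h0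
    · simp [sign_neg h0]
    · simp [h0]
    · simp [sign_pos h0]
  have hV' : ∑ z ∈ s ×ˢ s, |⟪v z.1, v z.2⟫| ^ p ≤ (w ^ 2) ^ p := by
    rwa [Finset.sum_product]
  have hgram : ∑ z ∈ s ×ˢ s, (|β z.1| * |β z.2|) * |⟪v z.1, v z.2⟫| ≤
      (D ^ (1 - 1 / p)) ^ 2 * w ^ 2 := by
    -- For p = 1 the conjugate exponent is infinite, and |β i| ≤ 1 takes the place of Hölder's
    -- inequality on pairs of indices.
    rcases hp.eq_or_lt with rfl | hp1
    · simp only [Real.rpow_one, sub_self, div_one, Real.rpow_zero, one_pow, one_mul] at hV' hβabs ⊢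
      refine le_trans (Finset.sum_le_sum fun z _ => ?_) hV'
      refine mul_le_of_le_one_left (abs_nonneg _) ?_
      exact mul_le_one₀ (hβabs _) (abs_nonneg _) (hβabs _)
    · have hconj : p.HolderConjugate (p / (p - 1)) := Real.HolderConjugate.conjExponent hp1
      have h1 := Real.inner_le_Lp_mul_Lq (s ×ˢ s) (fun z => |β z.1| * |β z.2|)
        (fun z => |⟪v z.1, v z.2⟫|) hconj.symm
      refine h1.trans ?_
      have h2 : ∑ z ∈ s ×ˢ s, |(|β z.1| * |β z.2|)| ^ (p / (p - 1)) ≤ D * D := by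
        rw [hD, Finset.sum_mul_sum, Finset.sum_product]
        refine Finset.sum_le_sum fun i _ => Finset.sum_le_sum fun j _ => ?_
        have key : ∀ i, |β i| ^ (p / (p - 1)) ≤ |d i| ^ p := by
          intro i
          calc _ ≤ (|d i| ^ (p - 1)) ^ (p / (p - 1)) :=
                Real.rpow_le_rpow (abs_nonneg _) (hβabs i) hconj.symm.pos.le
            _ = |d i| ^ p := by
                rw [← Real.rpow_mul (abs_nonneg _)]
                congr 1
                field_simp [(sub_pos.2 hp1).ne']
        rw [abs_mul, abs_abs, abs_abs, Real.mul_rpow (abs_nonneg _) (abs_nonneg _)]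
        exact mul_le_mul (key i) (key j) (by positivity) (by positivity)
      have h3 : (∑ z ∈ s ×ˢ s, |(|β z.1| * |β z.2|)| ^ (p / (p - 1))) ^ (1 / (p / (p - 1))) ≤
          (D ^ (1 - 1 / p)) ^ 2 := by
        calc _ ≤ (D * D) ^ (1 / (p / (p - 1))) :=
              Real.rpow_le_rpow (Finset.sum_nonneg fun z _ => by positivity) h2
                (one_div_nonneg.2 hconj.symm.pos.le)
          _ = _ := by
              rw [Real.mul_rpow hD0 hD0, ← pow_two]
              congr 3
              field_simp [(sub_pos.2 hp1).ne']
      have h4 : (∑ z ∈ s ×ˢ s, |(|⟪v z.1, v z.2⟫|)| ^ p) ^ (1 / p) ≤ w ^ 2 := by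
        simp only [abs_abs]
        calc _ ≤ ((w ^ 2) ^ p) ^ (1 / p) :=
              Real.rpow_le_rpow (Finset.sum_nonneg fun z _ => by positivity) hV' (by positivity)
          _ = w ^ 2 := by
              rw [← Real.rpow_mul (by positivity), mul_one_div_cancel hp0.ne', Real.rpow_one]
      exact mul_le_mul h3 h4 (Real.rpow_nonneg (Finset.sum_nonneg fun z _ => by positivity) _)
        (by positivity)
  have hnorm : ‖∑ i ∈ s, β i • v i‖ ≤ D ^ (1 - 1 / p) * w := by
    refine abs_le_of_sq_le_sq' ?_ (by positivity) |>.2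
    rw [mul_pow]
    exact (norm_sum_smul_sq_le s β v).trans hgram
  have hDle : D ≤ D ^ (1 - 1 / p) * (‖h‖ * w) := by
    calc D = ⟪h, ∑ i ∈ s, β i • v i⟫ := by
          rw [inner_sum, hD]
          refine Finset.sum_congr rfl fun i _ => ?_
          rw [real_inner_smul_right, ← hβd i]
      _ ≤ ‖h‖ * ‖∑ i ∈ s, β i • v i‖ := real_inner_le_norm _ _
      _ ≤ ‖h‖ * (D ^ (1 - 1 / p) * w) := by gcongr
      _ = _ := by ring
  -- The inequality for D has the factor D ^ (1 - 1 / p) on its right side. Cancelling it leaves the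
  -- p-th root of D.
  have hsplit : D = D ^ (1 - 1 / p) * D ^ (1 / p) := by
    rw [← Real.rpow_add hDpos, sub_add_cancel, Real.rpow_one]
  have h5 : D ^ (1 / p) ≤ ‖h‖ * w := by
    refine le_of_mul_le_mul_left ?_ (Real.rpow_pos_of_pos hDpos (1 - 1 / p))
    rwa [← hsplit]
  have h6 := Real.rpow_le_rpow (by positivity) h5 hp0.le
  rwa [← Real.rpow_mul hD0, one_div_mul_cancel hp0.ne', Real.rpow_one] at h6

/-- The Riemann–Stieltjes sum of `f` with respect to the vector-valued function `x`. -/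
def rsSumE (f : ℝ → ℝ) (x : ℝ → E) {a b : ℝ} (κ : IntervalPartition a b) (u : ℕ → ℝ) : E :=
  ∑ i ∈ Finset.range κ.n, f (u i) • (x (κ.t (i + 1)) - x (κ.t i))

/-- The covariance of `x` has `p`-variation at most `w s t ^ 2` on each square `[s, t]²`. -/
def GramVariationLE (p T : ℝ) (x : ℝ → E) (w : ℝ → ℝ → ℝ) : Prop :=
  ∀ s t, 0 ≤ s → s < t → t ≤ T → ∀ κ : IntervalPartition s t,
    ∑ i ∈ Finset.range κ.n, ∑ j ∈ Finset.range κ.n,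
      |⟪x (κ.t (i + 1)) - x (κ.t i), x (κ.t (j + 1)) - x (κ.t j)⟫| ^ p ≤ (w s t ^ 2) ^ p

/-- This turns the two-dimensional covariance condition into one-dimensional p-variation, linear in
‖h‖, so that scalar Young theory applies. -/
lemma GramVariationLE.variationLE {p T : ℝ} {x : ℝ → E} {w : ℝ → ℝ → ℝ}
    (hx : GramVariationLE p T x w) (hp : 1 ≤ p) {s t : ℝ} (hs : 0 ≤ s) (hst : s < t) (ht : t ≤ T)
    (hw : 0 ≤ w s t) (h : E) : VariationLE p (fun z => ⟪h, x z⟫) s t ((‖h‖ * w s t) ^ p) := by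
  refine .of_partition (by linarith) fun κ => ?_
  simp only [← inner_sub_right]
  exact sum_abs_inner_rpow_le _ (fun i => x (κ.t (i + 1)) - x (κ.t i)) hp hw
    (hx s t hs hst ht κ) h

lemma inner_rsSumE (f : ℝ → ℝ) (x : ℝ → E) {a b : ℝ} (κ : IntervalPartition a b) (u : ℕ → ℝ)
    (h : E) : ⟪h, rsSumE f x κ u⟫ =
      ∑ i ∈ Finset.range κ.n, f (u i) * (⟪h, x (κ.t (i + 1))⟫ - ⟪h, x (κ.t i)⟫) := by
  simp only [rsSumE, inner_sum, real_inner_smul_right, inner_sub_right]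

/-- Used with v a Riemann–Stieltjes sum: tested against itself, it satisfies a scalar estimate
linear in ‖v‖, and one factor ‖v‖ cancels. -/
lemma norm_le_of_forall_inner_le {v : E} {c : ℝ} (hc : 0 ≤ c) (h : |⟪v, v⟫| ≤ ‖v‖ * c) :
    ‖v‖ ≤ c := by
  rw [real_inner_self_eq_norm_sq, abs_of_nonneg (by positivity), pow_two] at h
  rcases (norm_nonneg v).eq_or_lt with h0 | h0
  · rwa [← h0]
  · exact le_of_mul_le_mul_left h h0

lemma IntervalPartition.exists_monotone_tag {a b : ℝ} (κ : IntervalPartition a b) {u : ℕ → ℝ}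
    (hu : κ.IsTag u) (hn : 0 < κ.n) : ∃ v : ℕ → ℝ, Monotone v ∧ (∀ i, v i ∈ Set.Icc a b) ∧
      ∀ i < κ.n, v i = u i := by
  refine ⟨fun i => u (min i (κ.n - 1)), monotone_nat_of_le_succ fun i => ?_, fun i => ?_,
    fun i hi => congrArg u (min_eq_left (by omega))⟩
  · rcases lt_or_ge i (κ.n - 1) with h | h
    · rw [min_eq_left h.le, min_eq_left (by omega)]
      exact (hu i (by omega)).2.trans (hu (i + 1) (by omega)).1
    · rw [min_eq_right h, min_eq_right (by omega)]
  · have h := hu (min i (κ.n - 1)) (by omega)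
    exact ⟨(κ.mem_Icc (by omega)).1.trans h.1, h.2.trans (κ.mem_Icc (by omega)).2⟩

section Bounds

variable {p q T M A : ℝ} {x : ℝ → E} {w : ℝ → ℝ → ℝ} {f : ℝ → ℝ}

lemma GramVariationLE.norm_rsSumE_le_of_one (hx : GramVariationLE 1 T x w) {s t : ℝ} (hs : 0 ≤ s)
    (hst : s < t) (ht : t ≤ T) (hw : 0 ≤ w s t) (hM : ∀ z ∈ Set.Icc s t, |f z| ≤ M)
    (κ : IntervalPartition s t) {u : ℕ → ℝ} (hu : κ.IsTag u) :
    ‖rsSumE f x κ u‖ ≤ M * w s t := by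
  have hM0 : 0 ≤ M := (abs_nonneg _).trans (hM s ⟨le_rfl, hst.le⟩)
  refine norm_le_of_forall_inner_le (by positivity) ?_
  set h := rsSumE f x κ u with hh
  have h1 := (hx.variationLE le_rfl hs hst ht hw h).powSum_le le_rfl κ
  simp only [powSum, Real.rpow_one] at h1
  rw [hh, inner_rsSumE, ← hh]
  calc _ ≤ ∑ i ∈ Finset.range κ.n, M * |⟪h, x (κ.t (i + 1))⟫ - ⟪h, x (κ.t i)⟫| := by
        refine (Finset.abs_sum_le_sum_abs _ _).trans (Finset.sum_le_sum fun i hi => ?_)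
        have hi' := Finset.mem_range.1 hi
        rw [abs_mul]
        gcongr
        have h2 := hu i hi'
        exact hM _ ⟨(κ.mem_Icc hi'.le).1.trans h2.1, h2.2.trans (κ.mem_Icc hi').2⟩
    _ ≤ M * (‖h‖ * w s t) := by
        rw [← Finset.mul_sum]
        gcongr
    _ = _ := by ring

/-- Young–Loève for the values of f at the tags, which form a monotone sequence, against ⟨h, x⟩ with
h the sum itself. The leading term f (v 0) * ⟨h, x t - x s⟩ contributes M, and the error term
contributes `youngConst p q * A`. -/
lemma GramVariationLE.norm_rsSumE_le (hx : GramVariationLE p T x w) (hp : 1 ≤ p) (hq : 0 < q)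
    (hpq : 1 < 1 / p + 1 / q) {s t : ℝ} (hs : 0 ≤ s) (hst : s < t) (ht : t ≤ T)
    (hw : 0 ≤ w s t) (hM : ∀ z ∈ Set.Icc s t, |f z| ≤ M) (hA : 0 ≤ A)
    (hf : VariationLE q f s t (A ^ q)) (κ : IntervalPartition s t) {u : ℕ → ℝ} (hu : κ.IsTag u) :
    ‖rsSumE f x κ u‖ ≤ (M + youngConst p q * A) * w s t := by
  have hM0 : 0 ≤ M := (abs_nonneg _).trans (hM s ⟨le_rfl, hst.le⟩)
  have hy := youngConst_nonneg p q
  refine norm_le_of_forall_inner_le (by positivity) ?_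
  set h := rsSumE f x κ u with hh
  have hB : 0 ≤ ‖h‖ * w s t := by positivity
  have hvar := hx.variationLE hp hs hst ht hw h
  rw [hh, inner_rsSumE, ← hh]
  rcases Nat.eq_zero_or_pos κ.n with hn | hn
  · rw [hn]
    simp only [Finset.range_zero, Finset.sum_empty, abs_zero]
    positivity
  obtain ⟨v, hv, hvm, hvu⟩ := κ.exists_monotone_tag hu hn
  obtain ⟨n, hn'⟩ : ∃ n, κ.n = n + 1 := ⟨κ.n - 1, by omega⟩
  have h1 := abs_sum_mul_sub_le (p := p) (by linarith) hq hA hB n (fun i => f (v i))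
    (fun i => ⟪h, x (κ.clamp i)⟫)
    (fun φ hφ m => hf (v ∘ φ) (hv.comp hφ) (fun i => hvm _) m)
    (fun φ hφ m => hvar (κ.clamp ∘ φ) (κ.clamp_monotone.comp hφ) (fun i => κ.clamp_mem _) m)
  have h2 : |⟪h, x (κ.clamp (n + 1))⟫ - ⟪h, x (κ.clamp 0)⟫| ≤ ‖h‖ * w s t := by
    -- A sequence whose first step jumps from the first partition point to the last; one summand of
    -- its variation is the total increment.
    have h3 := hvar (fun i => κ.clamp (i * (n + 1)))
      (fun i j hij => κ.clamp_monotone (Nat.mul_le_mul_right _ hij)) (fun i => κ.clamp_mem _) 1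
    simp only [Finset.range_one, Finset.sum_singleton, zero_add, zero_mul, one_mul] at h3
    exact (Real.rpow_le_rpow_iff (abs_nonneg _) hB (by linarith)).1 h3
  have h4 : ∑ i ∈ Finset.range κ.n, f (u i) * (⟪h, x (κ.t (i + 1))⟫ - ⟪h, x (κ.t i)⟫) =
      ∑ i ∈ Finset.range (n + 1), f (v i) *
        (⟪h, x (κ.clamp (i + 1))⟫ - ⟪h, x (κ.clamp i)⟫) := by
    rw [hn']
    refine Finset.sum_congr rfl fun i hi => ?_
    have hi' : i < κ.n := by rw [hn']; exact Finset.mem_range.1 hi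
    rw [hvu i hi', κ.clamp_of_le hi', κ.clamp_of_le hi'.le]
  rw [h4]
  have h5 := abs_sub_abs_le_abs_sub
    (∑ i ∈ Finset.range (n + 1), f (v i) * (⟪h, x (κ.clamp (i + 1))⟫ - ⟪h, x (κ.clamp i)⟫))
    (f (v 0) * (⟪h, x (κ.clamp (n + 1))⟫ - ⟪h, x (κ.clamp 0)⟫))
  have h6 : |f (v 0) * (⟪h, x (κ.clamp (n + 1))⟫ - ⟪h, x (κ.clamp 0)⟫)| ≤ M * (‖h‖ * w s t) := by
    rw [abs_mul]
    exact mul_le_mul (hM _ (hvm 0)) h2 (abs_nonneg _) hM0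
  have h7 : (∑ k ∈ Finset.range n, ((k + 1 : ℕ) : ℝ) ^ (-(1 / p + 1 / q))) * (A * (‖h‖ * w s t)) ≤
      youngConst p q * (A * (‖h‖ * w s t)) := by
    gcongr
    exact sum_le_youngConst hpq n
  linarith

end Bounds

section Approximation

variable {p q T C : ℝ} {x : ℝ → E} {w : ℝ → ℝ → ℝ} {f : ℝ → ℝ}

/-- `f` can be integrated against `x`: Riemann–Stieltjes sums are controlled by `w`, and replacing
`f` by a step function with the same level sets as `N` changes them by little. -/
structure IsControlled (f : ℝ → ℝ) (x : ℝ → E) (T : ℝ) (w : ℝ → ℝ → ℝ) : Prop where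
  bound : ∃ K, 0 ≤ K ∧ ∀ s t, 0 ≤ s → s < t → t ≤ T → ∀ (κ : IntervalPartition s t) (u : ℕ → ℝ),
    κ.IsTag u → ‖rsSumE f x κ u‖ ≤ K * w s t
  approx : ∀ ε > 0, ∃ N, IsLevelFunction N f ε 0 T ∧
    ∀ s t, 0 ≤ s → s < t → t ≤ T → ∀ (κ : IntervalPartition s t) (u : ℕ → ℝ),
      κ.IsTag u → ‖rsSumE (fun z => f z - f (levelRep N 0 T (N z))) x κ u‖ ≤ ε * w s t

lemma isControlled_of_isRegulatedOn (hx : GramVariationLE 1 T x w) (hT : 0 ≤ T)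
    (hw : ∀ s t, 0 ≤ s → s ≤ t → t ≤ T → 0 ≤ w s t) (hf : IsRegulatedOn f 0 T) :
    IsControlled f x T w where
  bound := by
    obtain ⟨N, hN⟩ := hf.exists_isLevelFunction hT one_pos
    obtain ⟨M, hM⟩ := hN.bounded_on
    refine ⟨M, (abs_nonneg _).trans (hM 0 ⟨le_rfl, hT⟩), fun s t hs hst ht κ u hu => ?_⟩
    exact hx.norm_rsSumE_le_of_one hs hst ht (hw s t hs hst.le ht)
      (fun z hz => hM z ⟨hs.trans hz.1, hz.2.trans ht⟩) κ hu
  approx := by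
    intro ε hε
    obtain ⟨N, hN⟩ := hf.exists_isLevelFunction hT hε
    refine ⟨N, hN, fun s t hs hst ht κ u hu => ?_⟩
    exact hx.norm_rsSumE_le_of_one hs hst ht (hw s t hs hst.le ht)
      (fun z hz => hN.abs_sub_rep_le ⟨hs.trans hz.1, hz.2.trans ht⟩) κ hu

lemma add_rpow_le_two_rpow_mul {y z : ℝ} (hy : 0 ≤ y) (hz : 0 ≤ z) (hq : 0 ≤ q) :
    (y + z) ^ q ≤ 2 ^ q * (y ^ q + z ^ q) := by
  wlog hyz : y ≤ z generalizing y z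
  · rw [add_comm y z, add_comm (y ^ q)]
    exact this hz hy (le_of_not_ge hyz)
  calc (y + z) ^ q ≤ (2 * z) ^ q := Real.rpow_le_rpow (by positivity) (by linarith) hq
    _ = 2 ^ q * z ^ q := Real.mul_rpow (by norm_num) hz
    _ ≤ _ := by
      gcongr
      have : 0 ≤ y ^ q := by positivity
      linarith

/-- Interpolation between the `q`-variation and the sup norm. -/
lemma IsLevelFunction.variationLE_sub {N : ℝ → ℕ} {η a b q' : ℝ} (hN : IsLevelFunction N f η a b)
    (hq : 0 < q) (hqq : q < q') (hη : 0 < η) (hf : VariationLE q f a b C) :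
    VariationLE q' (fun z => f z - f (levelRep N a b (N z))) a b
      ((2 * η) ^ (q' - q) * (2 ^ q * (C + C))) := by
  intro v hv hvm m
  set φ : ℝ → ℝ := fun z => f z - f (levelRep N a b (N z)) with hφ
  set π : ℝ → ℝ := fun z => levelRep N a b (N z) with hπ
  have h1 := hf v hv hvm m
  have h2 := hf (π ∘ v) (hN.rep_monotone.comp hv) (fun i => hN.rep_mem _) m
  have h3 : ∀ z ∈ Set.Icc a b, |φ z| ≤ η := fun z hz => hN.abs_sub_rep_le hz
  calc ∑ i ∈ Finset.range m, |φ (v (i + 1)) - φ (v i)| ^ q'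
      ≤ ∑ i ∈ Finset.range m, (2 * η) ^ (q' - q) * (2 ^ q * (|f (v (i + 1)) - f (v i)| ^ q +
        |f ((π ∘ v) (i + 1)) - f ((π ∘ v) i)| ^ q)) := by
        refine Finset.sum_le_sum fun i _ => ?_
        have h4 : |φ (v (i + 1)) - φ (v i)| ≤ 2 * η := by
          have h5 := h3 _ (hvm (i + 1))
          have h6 := h3 _ (hvm i)
          have h7 := abs_sub (φ (v (i + 1))) (φ (v i))
          linarith
        have h8 : |φ (v (i + 1)) - φ (v i)| ≤ |f (v (i + 1)) - f (v i)| +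
            |f ((π ∘ v) (i + 1)) - f ((π ∘ v) i)| := by
          have : φ (v (i + 1)) - φ (v i) = (f (v (i + 1)) - f (v i)) -
              (f ((π ∘ v) (i + 1)) - f ((π ∘ v) i)) := by
            simp only [hφ, hπ, Function.comp]
            ring
          rw [this]
          exact abs_sub _ _
        -- Of the exponent q', the part q' - q is spent on the sup bound 2 * η, and the part q is
        -- kept for the variation of f and of its step approximant.
        rw [show q' = (q' - q) + q by ring, Real.rpow_add_of_nonneg (abs_nonneg _)
          (by linarith) hq.le, add_sub_cancel_right]
        refine mul_le_mul (Real.rpow_le_rpow (abs_nonneg _) h4 (by linarith)) ?_ (by positivity)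
          (by positivity)
        exact (Real.rpow_le_rpow (abs_nonneg _) h8 hq.le).trans
          (add_rpow_le_two_rpow_mul (abs_nonneg _) (abs_nonneg _) hq.le)
    _ ≤ _ := by
        rw [← Finset.mul_sum, ← Finset.mul_sum, Finset.sum_add_distrib]
        gcongr

/-- The expression is the constant of the Young bound for a remainder of sup norm η. It is
continuous in η and vanishes at 0. -/
lemma exists_small_young (K : ℝ) {D r q' ε : ℝ} (hr : 0 < r) (hq' : 0 < q') (hε : 0 < ε) :
    ∃ η > 0, η ≤ ε ∧ η + K * (((2 * η) ^ r * D) ^ (1 / q')) < ε := by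
  have hcont : Continuous fun η : ℝ => η + K * (((2 * η) ^ r * D) ^ (1 / q')) := by
    have h1 : Continuous fun η : ℝ => (2 * η) ^ r :=
      (continuous_const.mul continuous_id).rpow_const fun _ => Or.inr hr.le
    exact continuous_id.add (continuous_const.mul
      ((h1.mul continuous_const).rpow_const fun _ => Or.inr (by positivity)))
  have h0 : (0 : ℝ) + K * (((2 * 0) ^ r * D) ^ (1 / q')) < ε := by
    rw [mul_zero, Real.zero_rpow hr.ne', zero_mul, Real.zero_rpow (by positivity)]
    simpa using hε
  have hev : ∀ᶠ η in 𝓝[>] (0 : ℝ), η + K * (((2 * η) ^ r * D) ^ (1 / q')) < ε :=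
    nhdsWithin_le_nhds (hcont.continuousAt.eventually_lt continuousAt_const h0)
  have hev2 : ∀ᶠ η in 𝓝[>] (0 : ℝ), η ≤ ε :=
    nhdsWithin_le_nhds (eventually_le_nhds hε)
  obtain ⟨η, h1, h2, h3⟩ := (hev.and (hev2.and self_mem_nhdsWithin)).exists
  exact ⟨η, h3, h2, h1⟩

lemma isControlled_of_variationLE (hx : GramVariationLE p T x w) (hp : 1 ≤ p) (hT : 0 ≤ T)
    (hw : ∀ s t, 0 ≤ s → s ≤ t → t ≤ T → 0 ≤ w s t) (hq : 0 < q) (hpq : 1 < 1 / p + 1 / q)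
    (hC : 0 ≤ C) (hf : VariationLE q f 0 T C) : IsControlled f x T w where
  bound := by
    obtain ⟨N, hN⟩ := hf.exists_isLevelFunction hq hT one_pos
    obtain ⟨M, hM⟩ := hN.bounded_on
    have hM0 : 0 ≤ M := (abs_nonneg _).trans (hM 0 ⟨le_rfl, hT⟩)
    have hy := youngConst_nonneg p q
    refine ⟨M + youngConst p q * C ^ (1 / q), by positivity, fun s t hs hst ht κ u hu => ?_⟩
    refine hx.norm_rsSumE_le hp hq hpq hs hst ht (hw s t hs hst.le ht)
      (fun z hz => hM z ⟨hs.trans hz.1, hz.2.trans ht⟩) (by positivity) ?_ κ hu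
    rw [← Real.rpow_mul hC, one_div_mul_cancel hq.ne', Real.rpow_one]
    exact hf.mono hs ht
  approx := by
    intro ε hε
    -- The q-variation of the remainder need not be small, but its q'-variation is for every q' > q.
    -- The strict Young condition leaves room for such an exponent.
    obtain ⟨q', hqq, hpq'⟩ : ∃ q', q < q' ∧ 1 < 1 / p + 1 / q' := by
      have hcont : ContinuousAt (fun y : ℝ => 1 / p + 1 / y) q :=
        continuousAt_const.add (continuousAt_const.div continuousAt_id hq.ne')
      have hev : ∀ᶠ y in 𝓝[>] q, 1 < 1 / p + 1 / y :=
        nhdsWithin_le_nhds (continuousAt_const.eventually_lt hcont hpq)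
      obtain ⟨q', h1, h2⟩ := (hev.and self_mem_nhdsWithin).exists
      exact ⟨q', h2, h1⟩
    have hq' : 0 < q' := hq.trans hqq
    obtain ⟨η, hη, hηε, hsmall⟩ := exists_small_young (youngConst p q') (D := 2 ^ q * (C + C))
      (sub_pos.2 hqq) hq' hε
    obtain ⟨N, hN⟩ := hf.exists_isLevelFunction hq hT hη
    refine ⟨N, ⟨hN.monotone, hN.bounded, hN.surj,
      fun x hx y hy h => (hN.osc x hx y hy h).trans hηε⟩, fun s t hs hst ht κ u hu => ?_⟩
    have hw' := hw s t hs hst.le ht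
    refine le_trans (hx.norm_rsSumE_le hp hq' hpq' hs hst ht hw'
      (fun z hz => hN.abs_sub_rep_le ⟨hs.trans hz.1, hz.2.trans ht⟩)
      (by positivity : 0 ≤ ((2 * η) ^ (q' - q) * (2 ^ q * (C + C))) ^ (1 / q')) ?_ κ hu)
      (mul_le_mul_of_nonneg_right hsmall.le hw')
    rw [← Real.rpow_mul (by positivity), one_div_mul_cancel hq'.ne', Real.rpow_one]
    exact (hN.variationLE_sub hq hqq hη hf).mono hs ht

end Approximation

end

/-! ### Existence of the integral and local form of its increments. -/

section

variable {E : Type*} [NormedAddCommGroup E] [InnerProductSpace ℝ E]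

/-- The Riemann–Stieltjes sums of `f` with respect to `x` over `[a, b]` converge to `y` as the mesh
tends to zero. -/
def IsRSLimit (f : ℝ → ℝ) (x : ℝ → E) (a b : ℝ) (y : E) : Prop :=
  ∀ ε > 0, ∃ δ > 0, ∀ (κ : IntervalPartition a b) (u : ℕ → ℝ), κ.IsTag u → κ.mesh < δ →
    ‖rsSumE f x κ u - y‖ < ε

section Algebra

variable {f g : ℝ → ℝ} {x : ℝ → E} {a b : ℝ}

lemma rsSumE_add (κ : IntervalPartition a b) (u : ℕ → ℝ) :
    rsSumE (fun z => f z + g z) x κ u = rsSumE f x κ u + rsSumE g x κ u := by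
  simp only [rsSumE, add_smul, Finset.sum_add_distrib]

lemma rsSumE_sub (κ : IntervalPartition a b) (u : ℕ → ℝ) :
    rsSumE (fun z => f z - g z) x κ u = rsSumE f x κ u - rsSumE g x κ u := by
  simp only [rsSumE, sub_smul, Finset.sum_sub_distrib]

lemma rsSumE_const_mul (c : ℝ) (κ : IntervalPartition a b) (u : ℕ → ℝ) :
    rsSumE (fun z => c * f z) x κ u = c • rsSumE f x κ u := by
  simp only [rsSumE, mul_smul, Finset.smul_sum]

lemma IsRSLimit.add {y z : E} (hf : IsRSLimit f x a b y) (hg : IsRSLimit g x a b z) :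
    IsRSLimit (fun t => f t + g t) x a b (y + z) := by
  intro ε hε
  obtain ⟨δ₁, h₁, H₁⟩ := hf (ε / 2) (half_pos hε)
  obtain ⟨δ₂, h₂, H₂⟩ := hg (ε / 2) (half_pos hε)
  refine ⟨min δ₁ δ₂, lt_min h₁ h₂, fun κ u hu hm => ?_⟩
  rw [rsSumE_add, add_sub_add_comm]
  have e1 := H₁ κ u hu (hm.trans_le (min_le_left _ _))
  have e2 := H₂ κ u hu (hm.trans_le (min_le_right _ _))
  exact (norm_add_le _ _).trans_lt (by linarith)

lemma IsRSLimit.const_mul {y : E} (hf : IsRSLimit f x a b y) (c : ℝ) :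
    IsRSLimit (fun t => c * f t) x a b (c • y) := by
  intro ε hε
  obtain ⟨δ, h, H⟩ := hf (ε / (|c| + 1)) (by positivity)
  refine ⟨δ, h, fun κ u hu hm => ?_⟩
  rw [rsSumE_const_mul, ← smul_sub, norm_smul, Real.norm_eq_abs]
  have e1 := H κ u hu hm
  rw [lt_div_iff₀ (by positivity)] at e1
  have e2 := norm_nonneg (rsSumE f x κ u - y)
  nlinarith

lemma isRSLimit_zero : IsRSLimit (fun _ => 0) x a b 0 := fun ε hε =>
  ⟨1, one_pos, fun κ u _ _ => by simpa [rsSumE] using hε⟩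

lemma exists_isRSLimit_sum {ι : Type*} (s : Finset ι) (F : ι → ℝ → ℝ)
    (h : ∀ i ∈ s, ∃ y, IsRSLimit (F i) x a b y) :
    ∃ y, IsRSLimit (fun z => ∑ i ∈ s, F i z) x a b y := by
  classical
  induction s using Finset.induction_on with
  | empty => exact ⟨0, by simpa using isRSLimit_zero⟩
  | insert i s hi ih =>
    obtain ⟨y, hy⟩ := ih fun j hj => h j (Finset.mem_insert_of_mem hj)
    obtain ⟨z, hz⟩ := h i (Finset.mem_insert_self _ _)
    refine ⟨z + y, ?_⟩
    simp only [Finset.sum_insert hi]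
    exact hz.add hy

end Algebra

section Step

variable {x : ℝ → E} {T : ℝ}

/-- The Riemann–Stieltjes sum of the indicator of an upper set is an increment. -/
lemma exists_rsSumE_indicator {U : Set ℝ} [DecidablePred (· ∈ U)] (hU : IsUpperSet U) {a b : ℝ}
    (κ : IntervalPartition a b) {u : ℕ → ℝ} (hu : κ.IsTag u) :
    ∃ k ≤ κ.n, (∀ i < k, u i ∉ U) ∧ (k < κ.n → u k ∈ U) ∧
      rsSumE (fun z => if z ∈ U then 1 else 0) x κ u = x b - x (κ.t k) := by
  -- The first index whose tag lies in U. Tags increase and U is an upper set, so all later tags lie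
  -- in U and the sum telescopes from there.
  have hex : ∃ i, i = κ.n ∨ u i ∈ U := ⟨κ.n, Or.inl rfl⟩
  set k := Nat.find hex with hk
  have hkn : k ≤ κ.n := Nat.find_min' hex (Or.inl rfl)
  have hlt : ∀ i < k, u i ∉ U := fun i hi h => Nat.find_min hex hi (Or.inr h)
  have hmem : k < κ.n → u k ∈ U := fun h => (Nat.find_spec hex).resolve_left h.ne
  have hge : ∀ i, k ≤ i → i < κ.n → u i ∈ U := by
    intro i hki
    induction i, hki using Nat.le_induction with
    | base => exact hmem
    | succ i hki ih =>
      intro hi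
      exact hU ((hu i (by omega)).2.trans (hu (i + 1) hi).1) (ih (by omega))
  refine ⟨k, hkn, hlt, hmem, ?_⟩
  obtain ⟨m, hm⟩ := Nat.exists_eq_add_of_le hkn
  rw [rsSumE, hm, Finset.sum_range_add]
  have h1 : ∑ i ∈ Finset.range k, (if u i ∈ U then (1 : ℝ) else 0) • (x (κ.t (i + 1)) - x (κ.t i)) =
      0 := Finset.sum_eq_zero fun i hi => by
    rw [if_neg (hlt i (Finset.mem_range.1 hi)), zero_smul]
  have h2 : ∑ i ∈ Finset.range m, (if u (k + i) ∈ U then (1 : ℝ) else 0) •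
      (x (κ.t (k + i + 1)) - x (κ.t (k + i))) =
      ∑ i ∈ Finset.range m, (x (κ.t (k + (i + 1))) - x (κ.t (k + i))) :=
    Finset.sum_congr rfl fun i hi => by
      have := Finset.mem_range.1 hi
      rw [if_pos (hge _ (by omega) (by omega)), one_smul, add_assoc]
  rw [h1, h2, Finset.sum_range_sub (fun i => x (κ.t (k + i))), zero_add, ← hm, κ.t_last, add_zero]

/-- Each sum is the increment of x from a partition point to t. That point is within one mesh of the
threshold c at which U begins, and x is uniformly continuous. -/
lemma exists_isRSLimit_indicator (hx : ContinuousOn x (Set.Icc 0 T)) {U : Set ℝ}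
    [DecidablePred (· ∈ U)] (hU : IsUpperSet U) {t : ℝ} (ht : t ∈ Set.Icc 0 T) :
    ∃ y, IsRSLimit (fun z => if z ∈ U then 1 else 0) x 0 t y := by
  -- The point 0 keeps the set nonempty and gives the threshold 0 when U contains all of [0, t].
  set A : Set ℝ := insert 0 (Set.Icc 0 t \ U) with hA
  have hAsub : A ⊆ Set.Icc 0 t := by
    rintro z (rfl | hz)
    · exact ⟨le_rfl, ht.1⟩
    · exact hz.1
  have hAbdd : BddAbove A := ⟨t, fun z hz => (hAsub hz).2⟩
  have hAne : A.Nonempty := ⟨0, Set.mem_insert _ _⟩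
  set c := sSup A with hc
  have hc0 : 0 ≤ c := le_csSup hAbdd (Set.mem_insert _ _)
  have hct : c ≤ t := csSup_le hAne fun z hz => (hAsub hz).2
  refine ⟨x t - x c, fun ε hε => ?_⟩
  have hunif := isCompact_Icc.uniformContinuousOn_of_continuous hx
  obtain ⟨δ, hδ, H⟩ := Metric.uniformContinuousOn_iff.1 hunif ε hε
  refine ⟨δ, hδ, fun κ u hu hm => ?_⟩
  obtain ⟨k, hkn, hlt, hmem, hsum⟩ := exists_rsSumE_indicator (x := x) hU κ hu
  have htk := κ.mem_Icc hkn
  rw [hsum, sub_sub_sub_cancel_left, ← dist_eq_norm]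
  refine H _ ⟨hc0, hct.trans ht.2⟩ _ ⟨htk.1, htk.2.trans ht.2⟩ ?_
  have h1 : κ.t k ≤ c + κ.mesh := by
    rcases Nat.eq_zero_or_pos k with h0 | h0
    · rw [h0, κ.t_zero]
      exact add_nonneg hc0 κ.mesh_nonneg
    · obtain ⟨j, rfl⟩ : ∃ j, k = j + 1 := ⟨k - 1, by omega⟩
      have e1 := hu j (by omega)
      have e2 : u j ≤ c := le_csSup hAbdd (Set.mem_insert_of_mem _
        ⟨⟨(κ.mem_Icc (by omega)).1.trans e1.1, e1.2.trans (κ.mem_Icc (by omega)).2⟩,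
          hlt j (Nat.lt_succ_self j)⟩)
      have e3 := κ.step_le_mesh (i := j) (by omega)
      rw [IntervalPartition.step] at e3
      linarith [e1.1]
  have h2 : c ≤ κ.t k + κ.mesh := by
    rcases hkn.eq_or_lt with h0 | h0
    · rw [h0, κ.t_last]
      exact hct.trans (le_add_of_nonneg_right κ.mesh_nonneg)
    · have e3 := κ.step_le_mesh h0
      rw [IntervalPartition.step] at e3
      refine csSup_le hAne ?_
      rintro z (rfl | hz)
      · exact add_nonneg htk.1 κ.mesh_nonneg
      · have e4 : z ≤ u k := le_of_not_ge fun hle => hz.2 (hU hle (hmem h0))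
        linarith [(hu k h0).2]
  rw [Real.dist_eq, abs_lt]
  constructor <;> linarith

/-- A function of N is a finite combination of indicators of the upper sets where k ≤ N, the
indicator of a level being a difference of two of them. -/
lemma exists_isRSLimit_step (hx : ContinuousOn x (Set.Icc 0 T)) {N : ℝ → ℕ} (hN : Monotone N)
    {B : ℕ} (hB : ∀ z, N z ≤ B) (F : ℕ → ℝ) {t : ℝ} (ht : t ∈ Set.Icc 0 T) :
    ∃ y, IsRSLimit (fun z => F (N z)) x 0 t y := by
  classical
  have key : ∀ k, ∃ y, IsRSLimit (fun z => if k ≤ N z then (1 : ℝ) else 0) x 0 t y := by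
    intro k
    have hU : IsUpperSet {z | k ≤ N z} := fun y z hyz hy => le_trans (α := ℕ) hy (hN hyz)
    exact exists_isRSLimit_indicator hx hU ht
  have heq : (fun z => F (N z)) = fun z => ∑ k ∈ Finset.range (B + 1),
      (F k * (if k ≤ N z then (1 : ℝ) else 0) + -F k * (if k + 1 ≤ N z then (1 : ℝ) else 0)) := by
    funext z
    rw [Finset.sum_eq_single_of_mem (N z) (Finset.mem_range.2 (Nat.lt_succ_of_le (hB z)))]
    · simp
    · intro k _ hk
      rcases lt_or_gt_of_ne hk with h | h
      · rw [if_pos h.le, if_pos (show k + 1 ≤ N z from h)]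
        ring
      · rw [if_neg (by omega), if_neg (by omega)]
        ring
  rw [heq]
  refine exists_isRSLimit_sum _ _ fun k _ => ?_
  obtain ⟨y, hy⟩ := key k
  obtain ⟨z, hz⟩ := key (k + 1)
  exact ⟨_, (hy.const_mul _).add (hz.const_mul _)⟩

end Step

lemma IntervalPartition.n_eq_zero {a : ℝ} (κ : IntervalPartition a a) : κ.n = 0 := by
  by_contra h
  have := κ.strictMonoOn (Set.mem_Iic.2 (Nat.zero_le κ.n)) (Set.mem_Iic.2 le_rfl)
    (Nat.pos_of_ne_zero h)
  rw [κ.t_zero, κ.t_last] at this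
  exact lt_irrefl _ this

section Integral

variable {f : ℝ → ℝ} {x : ℝ → E} {T : ℝ} {w : ℝ → ℝ → ℝ}

/-- All fine sums of f are close to the limit for one step approximant. Hence they satisfy a Cauchy
condition as the mesh tends to zero, and completeness provides the limit. -/
theorem IsControlled.exists_isRSLimit [CompleteSpace E] (hf : IsControlled f x T w)
    (hx : ContinuousOn x (Set.Icc 0 T)) {t : ℝ} (ht : t ∈ Set.Icc 0 T) :
    ∃ y, IsRSLimit f x 0 t y := by
  rcases ht.1.eq_or_lt with rfl | ht0
  · refine ⟨0, fun ε hε => ⟨1, one_pos, fun κ u _ _ => ?_⟩⟩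
    simpa [rsSumE, κ.n_eq_zero] using hε
  have hcauchy : ∀ ε > 0, ∃ δ > 0, ∀ (κ κ' : IntervalPartition 0 t) (u u' : ℕ → ℝ), κ.IsTag u →
      κ'.IsTag u' → κ.mesh < δ → κ'.mesh < δ → ‖rsSumE f x κ u - rsSumE f x κ' u'‖ < ε := by
    intro ε hε
    obtain ⟨N, hN, happ⟩ := hf.approx (ε / (4 * (|w 0 t| + 1))) (by positivity)
    obtain ⟨B, hB⟩ := hN.bounded
    obtain ⟨y, hy⟩ := exists_isRSLimit_step hx hN.monotone hB (fun k => f (levelRep N 0 T k)) ht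
    obtain ⟨δ, hδ, H⟩ := hy (ε / 4) (by positivity)
    have key : ∀ (κ : IntervalPartition 0 t) (u : ℕ → ℝ), κ.IsTag u → κ.mesh < δ →
        ‖rsSumE f x κ u - y‖ < ε / 2 := by
      intro κ u hu hm
      have h1 := H κ u hu hm
      have h2 := happ 0 t le_rfl ht0 ht.2 κ u hu
      rw [rsSumE_sub] at h2
      have h3 : ε / (4 * (|w 0 t| + 1)) * w 0 t ≤ ε / 4 := by
        calc _ ≤ ε / (4 * (|w 0 t| + 1)) * (|w 0 t| + 1) := by
              gcongr
              linarith [le_abs_self (w 0 t)]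
          _ = ε / 4 := by field_simp
      calc _ = ‖(rsSumE f x κ u - rsSumE (fun z => f (levelRep N 0 T (N z))) x κ u) +
            (rsSumE (fun z => f (levelRep N 0 T (N z))) x κ u - y)‖ := by congr 1; abel
        _ < ε / 2 := (norm_add_le _ _).trans_lt (by linarith)
    refine ⟨δ, hδ, fun κ κ' u u' hu hu' hm hm' => ?_⟩
    have h1 := key κ u hu hm
    have h2 := key κ' u' hu' hm'
    calc _ = ‖(rsSumE f x κ u - y) - (rsSumE f x κ' u' - y)‖ := by congr 1; abel
      _ < ε := (norm_sub_le _ _).trans_lt (by linarith)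
  choose κ hκ using fun n : ℕ =>
    IntervalPartition.exists_mesh_lt ht.1 (Nat.one_div_pos_of_nat (α := ℝ) (n := n))
  have hseq : CauchySeq fun n => rsSumE f x (κ n) (κ n).t := by
    refine Metric.cauchySeq_iff.2 fun ε hε => ?_
    obtain ⟨δ, hδ, H⟩ := hcauchy ε hε
    obtain ⟨n₀, hn₀⟩ := exists_nat_one_div_lt hδ
    have hmesh : ∀ n ≥ n₀, (κ n).mesh < δ := fun n hn =>
      (hκ n).trans_le ((Nat.one_div_le_one_div hn).trans hn₀.le)
    refine ⟨n₀, fun m hm n hn => ?_⟩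
    rw [dist_eq_norm]
    exact H _ _ _ _ (κ m).isTag_left (κ n).isTag_left (hmesh m hm) (hmesh n hn)
  obtain ⟨y, hy⟩ := cauchySeq_tendsto_of_complete hseq
  refine ⟨y, fun ε hε => ?_⟩
  obtain ⟨δ, hδ, H⟩ := hcauchy (ε / 2) (half_pos hε)
  refine ⟨δ, hδ, fun κ' u hu hm => ?_⟩
  obtain ⟨n₀, hn₀⟩ := exists_nat_one_div_lt hδ
  have hlim : Tendsto (fun n => ‖rsSumE f x κ' u - rsSumE f x (κ n) (κ n).t‖) atTop
      (𝓝 ‖rsSumE f x κ' u - y‖) := (tendsto_const_nhds.sub hy).norm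
  refine lt_of_le_of_lt (le_of_tendsto hlim ?_) (half_lt_self hε)
  filter_upwards [eventually_ge_atTop n₀] with n hn
  exact (H _ _ _ _ hu (κ n).isTag_left hm
    ((hκ n).trans_le ((Nat.one_div_le_one_div hn).trans hn₀.le))).le

lemma rsSumE_concat_left {a b c : ℝ} (κ : IntervalPartition a b) (l : IntervalPartition b c) :
    rsSumE f x (κ.concat l) (κ.concat l).t = rsSumE f x κ κ.t + rsSumE f x l l.t :=
  IntervalPartition.sum_concat κ l fun s t => f s • (x t - x s)

/-- Increments of the integral are limits of Riemann–Stieltjes sums. -/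
lemma IsRSLimit.exists_rsSumE_sub_lt {s t : ℝ} {y z : E} (hy : IsRSLimit f x 0 s y)
    (hz : IsRSLimit f x 0 t z) (hs : 0 ≤ s) (hst : s ≤ t) {ε : ℝ} (hε : 0 < ε) :
    ∃ κ : IntervalPartition s t, ‖rsSumE f x κ κ.t - (z - y)‖ < ε := by
  obtain ⟨δ₁, h₁, H₁⟩ := hy (ε / 2) (half_pos hε)
  obtain ⟨δ₂, h₂, H₂⟩ := hz (ε / 2) (half_pos hε)
  obtain ⟨κ, hκ⟩ := IntervalPartition.exists_mesh_lt hs (lt_min h₁ h₂)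
  obtain ⟨l, hl⟩ := IntervalPartition.exists_mesh_lt hst (lt_min h₁ h₂)
  refine ⟨l, ?_⟩
  have e1 := H₁ κ κ.t κ.isTag_left (hκ.trans_le (min_le_left _ _))
  have e2 := H₂ (κ.concat l) (κ.concat l).t (κ.concat l).isTag_left
    ((κ.concat_mesh_le l).trans_lt ((max_lt hκ hl).trans_le (min_le_right _ _)))
  rw [rsSumE_concat_left] at e2
  calc _ = ‖(rsSumE f x κ κ.t + rsSumE f x l l.t - z) - (rsSumE f x κ κ.t - y)‖ := by
        congr 1; abel
    _ < ε := (norm_sub_le _ _).trans_lt (by linarith)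

lemma rsSumE_const_level {N : ℝ → ℕ} (hN : Monotone N) (F : ℕ → ℝ) {s t : ℝ}
    (h : N s = N t) (κ : IntervalPartition s t) :
    rsSumE (fun z => F (N z)) x κ κ.t = F (N s) • (x t - x s) := by
  have h1 : rsSumE (fun z => F (N z)) x κ κ.t =
      ∑ i ∈ Finset.range κ.n, F (N s) • (x (κ.t (i + 1)) - x (κ.t i)) := by
    refine Finset.sum_congr rfl fun i hi => ?_
    have h2 := κ.mem_Icc (Finset.mem_range.1 hi).le
    have h3 : N (κ.t i) = N s := le_antisymm ((hN h2.2).trans h.ge) (hN h2.1)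
    simp only [h3]
  rw [h1, ← Finset.smul_sum, Finset.sum_range_sub (fun i => x (κ.t i)), κ.t_last, κ.t_zero]

variable {y : ℝ → E}

lemma IsControlled.norm_sub_le (hf : IsControlled f x T w)
    (hy : ∀ t ∈ Set.Icc 0 T, IsRSLimit f x 0 t (y t)) :
    ∃ K, 0 ≤ K ∧ ∀ s t, 0 ≤ s → s < t → t ≤ T → ‖y t - y s‖ ≤ K * w s t := by
  obtain ⟨K, hK, H⟩ := hf.bound
  refine ⟨K, hK, fun s t hs hst ht => le_of_forall_pos_lt_add fun ε hε => ?_⟩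
  obtain ⟨κ, hκ⟩ := (hy s ⟨hs, hst.le.trans ht⟩).exists_rsSumE_sub_lt
    (hy t ⟨hs.trans hst.le, ht⟩) hs hst.le hε
  have h1 := H s t hs hst ht κ κ.t κ.isTag_left
  have h2 := norm_sub_norm_le (y t - y s) (rsSumE f x κ κ.t)
  rw [norm_sub_rev _ (rsSumE f x κ κ.t)] at h2
  linarith

/-- The step approximant is constant on an interval that crosses no level, so its sum there is
exactly a multiple of the increment of x. Only the remainder, bounded by ε w, is left. -/
lemma IsControlled.norm_sub_sub_le (hf : IsControlled f x T w)
    (hy : ∀ t ∈ Set.Icc 0 T, IsRSLimit f x 0 t (y t)) {ε : ℝ} (hε : 0 < ε) :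
    ∃ N, IsLevelFunction N f ε 0 T ∧ ∀ s t, 0 ≤ s → s < t → t ≤ T → N s = N t →
      ‖y t - y s - f (levelRep N 0 T (N s)) • (x t - x s)‖ ≤ ε * w s t := by
  obtain ⟨N, hN, H⟩ := hf.approx ε hε
  refine ⟨N, hN, fun s t hs hst ht hNst => le_of_forall_pos_lt_add fun ε' hε' => ?_⟩
  obtain ⟨κ, hκ⟩ := (hy s ⟨hs, hst.le.trans ht⟩).exists_rsSumE_sub_lt
    (hy t ⟨hs.trans hst.le, ht⟩) hs hst.le hε'
  have h1 := H s t hs hst ht κ κ.t κ.isTag_left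
  rw [rsSumE_sub, rsSumE_const_level hN.monotone (fun k => f (levelRep N 0 T k)) hNst] at h1
  calc _ = ‖(rsSumE f x κ κ.t - f (levelRep N 0 T (N s)) • (x t - x s)) -
        (rsSumE f x κ κ.t - (y t - y s))‖ := by congr 1; abel
    _ < _ := (_root_.norm_sub_le _ _).trans_lt (by linarith)

lemma rsSumE_mem_span {a b : ℝ} (ha : 0 ≤ a) (hb : b ≤ T) (κ : IntervalPartition a b)
    (u : ℕ → ℝ) : rsSumE f x κ u ∈ Submodule.span ℝ (x '' Set.Icc 0 T) := by
  refine Submodule.sum_mem _ fun i hi => Submodule.smul_mem _ _ (Submodule.sub_mem _ ?_ ?_) <;>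
  refine Submodule.subset_span (Set.mem_image_of_mem _ ?_)
  · have h := κ.mem_Icc (Finset.mem_range.1 hi)
    exact ⟨ha.trans h.1, h.2.trans hb⟩
  · have h := κ.mem_Icc (Finset.mem_range.1 hi).le
    exact ⟨ha.trans h.1, h.2.trans hb⟩

lemma IsRSLimit.mem_closure {t : ℝ} (ht : t ∈ Set.Icc 0 T) {y : E} (hy : IsRSLimit f x 0 t y) :
    y ∈ (Submodule.span ℝ (x '' Set.Icc 0 T)).topologicalClosure := by
  rw [← SetLike.mem_coe, Submodule.topologicalClosure_coe, Metric.mem_closure_iff]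
  intro ε hε
  obtain ⟨δ, hδ, H⟩ := hy ε hε
  obtain ⟨κ, hκ⟩ := IntervalPartition.exists_mesh_lt ht.1 hδ
  refine ⟨rsSumE f x κ κ.t, rsSumE_mem_span le_rfl ht.2 κ κ.t, ?_⟩
  rw [dist_comm, dist_eq_norm]
  exact H κ κ.t κ.isTag_left hκ

end Integral

end

/-! ### Gaussian subspaces of L². -/

section

open scoped RealInnerProductSpace NNReal

variable {Ω : Type*} [MeasurableSpace Ω] {P : Measure Ω}

section L2

lemma aemeasurable_Lp (g : Lp ℝ 2 P) : AEMeasurable (g : Ω → ℝ) P :=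
  (Lp.aestronglyMeasurable g).aemeasurable

lemma inner_Lp_eq_integral (g h : Lp ℝ 2 P) : ⟪g, h⟫ = ∫ ω, g ω * h ω ∂P := by
  rw [L2.inner_def]
  simp [mul_comm]

lemma norm_sq_Lp_eq_integral (g : Lp ℝ 2 P) : ‖g‖ ^ 2 = ∫ ω, g ω ^ 2 ∂P := by
  rw [← real_inner_self_eq_norm_sq, inner_Lp_eq_integral]
  simp only [pow_two]

lemma charFun_map_Lp (g : Lp ℝ 2 P) (u : ℝ) :
    charFun (P.map g) u = ∫ ω, Complex.exp (u * g ω * Complex.I) ∂P := by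
  rw [charFun_apply_real, integral_map (aemeasurable_Lp g)]
  exact Continuous.aestronglyMeasurable (by fun_prop)

variable [IsProbabilityMeasure P]

lemma integrable_Lp (g : Lp ℝ 2 P) : Integrable (g : Ω → ℝ) P :=
  (Lp.memLp g).integrable (by norm_num)

lemma integral_abs_le_norm (g : Lp ℝ 2 P) : ∫ ω, |g ω| ∂P ≤ ‖g‖ := by
  have h1 : eLpNorm (g : Ω → ℝ) 1 P ≤ eLpNorm (g : Ω → ℝ) 2 P :=
    eLpNorm_le_eLpNorm_of_exponent_le (by norm_num) (Lp.aestronglyMeasurable g)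
  rw [Lp.norm_def]
  have h2 := ENNReal.toReal_mono (Lp.eLpNorm_ne_top g) h1
  refine le_of_eq_of_le ?_ h2
  rw [eLpNorm_one_eq_lintegral_enorm, ← integral_norm_eq_lintegral_enorm
    (Lp.aestronglyMeasurable g)]
  simp only [Real.norm_eq_abs]

lemma norm_exp_mul_I_sub_le (x y : ℝ) :
    ‖Complex.exp (x * Complex.I) - Complex.exp (y * Complex.I)‖ ≤ |x - y| := by
  have h1 : Complex.exp (x * Complex.I) - Complex.exp (y * Complex.I) =
      Complex.exp (y * Complex.I) * (Complex.exp (Complex.I * ((x - y : ℝ) : ℂ)) - 1) := by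
    rw [mul_sub, ← Complex.exp_add, mul_one]
    congr 2
    push_cast
    ring
  rw [h1, norm_mul, Complex.norm_exp_ofReal_mul_I, one_mul]
  exact Real.norm_exp_I_mul_ofReal_sub_one_le

/-- The map is Lipschitz with constant |u|, because x ↦ exp(ix) is 1-Lipschitz and the L¹ norm is at
most the L² norm. -/
lemma continuous_charFun_map (u : ℝ) : Continuous fun g : Lp ℝ 2 P => charFun (P.map g) u := by
  refine (LipschitzWith.of_dist_le_mul (K := ‖u‖₊) fun g h => ?_).continuous
  have hint : ∀ g : Lp ℝ 2 P, Integrable (fun ω => Complex.exp (u * g ω * Complex.I)) P := by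
    intro g
    refine Integrable.of_bound (C := 1) ?_ (.of_forall fun ω => ?_)
    · exact Continuous.comp_aestronglyMeasurable
        (g := fun x : ℝ => Complex.exp (u * x * Complex.I)) (by fun_prop)
        (Lp.aestronglyMeasurable g)
    · rw [← Complex.ofReal_mul, Complex.norm_exp_ofReal_mul_I]
  rw [dist_eq_norm, dist_eq_norm, charFun_map_Lp, charFun_map_Lp, ← integral_sub (hint g) (hint h)]
  calc _ ≤ ∫ ω, |u| * |(g - h : Lp ℝ 2 P) ω| ∂P := by
        refine norm_integral_le_of_norm_le ((integrable_Lp (g - h)).abs.const_mul _) ?_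
        filter_upwards [Lp.coeFn_sub g h] with ω hω
        rw [hω, Pi.sub_apply, ← abs_mul, mul_sub, ← Complex.ofReal_mul, ← Complex.ofReal_mul]
        exact norm_exp_mul_I_sub_le _ _
    _ ≤ _ := by
        rw [integral_const_mul]
        exact mul_le_mul_of_nonneg_left (integral_abs_le_norm _) (abs_nonneg _)

end L2

/-- A subspace of `L²` consisting of centered Gaussian random variables. -/
def IsGaussianSubspace (P : Measure Ω) (H : Submodule ℝ (Lp ℝ 2 P)) : Prop :=
  ∀ g ∈ H, P.map (g : Ω → ℝ) = gaussianReal 0 (‖g‖₊ ^ 2)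

lemma map_eq_gaussianReal_iff [IsProbabilityMeasure P] (g : Lp ℝ 2 P) :
    P.map (g : Ω → ℝ) = gaussianReal 0 (‖g‖₊ ^ 2) ↔
      ∀ u : ℝ, charFun (P.map g) u = Complex.exp (-(‖g‖ ^ 2 * u ^ 2 / 2 : ℝ)) := by
  have key : ∀ u : ℝ, charFun (gaussianReal 0 (‖g‖₊ ^ 2)) u =
      Complex.exp (-(‖g‖ ^ 2 * u ^ 2 / 2 : ℝ)) := by
    intro u
    rw [charFun_gaussianReal]
    congr 1
    push_cast
    simp
  have : IsProbabilityMeasure (P.map (g : Ω → ℝ)) := P.isProbabilityMeasure_map (aemeasurable_Lp g)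
  refine ⟨fun h u => by rw [h, key], fun h => Measure.ext_of_charFun (funext fun u => ?_)⟩
  rw [h, key]

/-- In terms of characteristic functions, being centered Gaussian with variance ‖g‖² is a closed
condition on g. This is what makes the integrals, limits of linear combinations of X, Gaussian. -/
lemma IsGaussianSubspace.topologicalClosure [IsProbabilityMeasure P] {H : Submodule ℝ (Lp ℝ 2 P)}
    (hH : IsGaussianSubspace P H) : IsGaussianSubspace P H.topologicalClosure := by
  intro g hg
  rw [map_eq_gaussianReal_iff]
  intro u
  have hclosed : IsClosed {g : Lp ℝ 2 P | charFun (P.map g) u =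
      Complex.exp (-(‖g‖ ^ 2 * u ^ 2 / 2 : ℝ))} :=
    isClosed_eq (continuous_charFun_map u) (by fun_prop)
  exact closure_minimal (fun g hg => (map_eq_gaussianReal_iff g).1 (hH g hg) u) hclosed hg

lemma coeFn_sum_smul {ι : Type*} (s : Finset ι) (c : ι → ℝ) (z : ι → Lp ℝ 2 P) :
    (↑(∑ i ∈ s, c i • z i : Lp ℝ 2 P) : Ω → ℝ) =ᵐ[P] fun ω => ∑ i ∈ s, c i * z i ω := by
  classical
  induction s using Finset.induction_on with
  | empty =>
    filter_upwards [Lp.coeFn_zero ℝ 2 P] with ω hω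
    simp only [Finset.sum_empty]
    exact hω
  | insert i s hi ih =>
    rw [Finset.sum_insert hi]
    filter_upwards [ih, Lp.coeFn_add (c i • z i) (∑ i ∈ s, c i • z i), Lp.coeFn_smul (c i) (z i)]
      with ω h1 h2 h3
    rw [h2, Pi.add_apply, h3, h1, Finset.sum_insert hi]
    simp

/-- The span of a centered Gaussian process is a Gaussian subspace. -/
theorem isGaussianSubspace_span [IsProbabilityMeasure P] {ι : Type*} {X : ι → Ω → ℝ}
    (hX : IsGaussianProcess X P) (hmean : ∀ i, ∫ ω, X i ω ∂P = 0) {x : ι → Lp ℝ 2 P}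
    (hx : ∀ i, (x i : Ω → ℝ) =ᵐ[P] X i) :
    IsGaussianSubspace P (Submodule.span ℝ (Set.range x)) := by
  intro g hg
  obtain ⟨c, rfl⟩ := Finsupp.mem_span_range_iff_exists_finsupp.1 hg
  set g := c.sum fun i a => a • x i with hgdef
  have hae : (g : Ω → ℝ) =ᵐ[P] fun ω => ∑ i ∈ c.support, c i * X i ω := by
    have h1 := coeFn_sum_smul c.support c x
    have h2 : ∀ᵐ ω ∂P, ∀ i ∈ c.support, x i ω = X i ω :=
      (Finset.eventually_all c.support).2 fun i _ => hx i
    filter_upwards [h1, h2] with ω h1 h2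
    rw [hgdef, Finsupp.sum, h1]
    exact Finset.sum_congr rfl fun i hi => by rw [h2 i hi]
  have hgauss : HasGaussianLaw (g : Ω → ℝ) P := by
    refine HasGaussianLaw.congr ((hX.smul c).hasGaussianLaw_fun_sum (I := c.support)) ?_
    filter_upwards [hae] with ω hω
    rw [hω]
    simp
  have hm : ∫ ω, g ω ∂P = 0 := by
    rw [integral_congr_ae hae, integral_finsetSum]
    · refine Finset.sum_eq_zero fun i _ => ?_
      rw [integral_const_mul, hmean i, mul_zero]
    · exact fun i _ => (hX.hasGaussianLaw_eval i).integrable.const_mul _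
  rw [hgauss.map_eq_gaussianReal, hm, variance_of_integral_eq_zero (aemeasurable_Lp g) hm,
    ← norm_sq_Lp_eq_integral]
  congr 1
  ext
  rw [Real.coe_toNNReal _ (by positivity)]
  simp

section GaussianFamily

variable {H : Submodule ℝ (Lp ℝ 2 P)} {ι : Type*} {z : ι → Lp ℝ 2 P}

/-- A linear functional of finitely many coordinates is again an element of H. Its law, and so the
joint law, depends only on norms in L². -/
lemma IsGaussianSubspace.map_dual_restrict (hH : IsGaussianSubspace P H) (hz : ∀ i, z i ∈ H)
    (I : Finset ι) [DecidableEq I] (L : (I → ℝ) →L[ℝ] ℝ) :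
    (P.map fun ω => I.restrict fun i => z i ω).map L =
      gaussianReal 0 (‖∑ i : I, L (Pi.single i 1) • z i‖₊ ^ 2) := by
  have hmeas : AEMeasurable (fun ω => I.restrict fun i => z i ω) P :=
    aemeasurable_pi_lambda _ fun i => aemeasurable_Lp _
  set g : Lp ℝ 2 P := ∑ i : I, L (Pi.single i 1) • z i with hg
  have hgH : g ∈ H := Submodule.sum_mem _ fun i _ => Submodule.smul_mem _ _ (hz i)
  rw [← hH g hgH, AEMeasurable.map_map_of_aemeasurable (by fun_prop) hmeas]
  refine Measure.map_congr ?_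
  filter_upwards [coeFn_sum_smul Finset.univ (fun i : I => L (Pi.single i 1)) (fun i : I => z i)]
    with ω hω
  rw [hg, hω, Function.comp, ← ContinuousLinearMap.sum_comp_single]
  refine Finset.sum_congr rfl fun i _ => ?_
  have : (Pi.single i (I.restrict (fun i => z i ω) i) : I → ℝ) =
      (z i ω) • (Pi.single i (1 : ℝ) : I → ℝ) := by
    rw [← Pi.single_smul]
    simp
  simp only [ContinuousLinearMap.comp_apply, ContinuousLinearMap.single_apply]
  rw [this, map_smul, smul_eq_mul, mul_comm]

theorem IsGaussianSubspace.isGaussianProcess (hH : IsGaussianSubspace P H) (hz : ∀ i, z i ∈ H) :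
    IsGaussianProcess (fun i => (z i : Ω → ℝ)) P := by
  classical
  exact ⟨fun I => ⟨isGaussian_of_map_eq_gaussianReal fun L => ⟨_, _, hH.map_dual_restrict hz I L⟩⟩⟩

/-- The law of a centered Gaussian process is symmetric. -/
theorem IsGaussianSubspace.map_neg [IsProbabilityMeasure P] [Countable ι]
    (hH : IsGaussianSubspace P H) (hz : ∀ i, z i ∈ H) :
    P.map (fun ω i => z i ω) = P.map fun ω i => (-z i : Lp ℝ 2 P) ω := by
  classical
  rw [map_eq_iff_forall_finset_map_restrict_eq (aemeasurable_pi_lambda _ fun i => aemeasurable_Lp _)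
    (aemeasurable_pi_lambda _ fun i => aemeasurable_Lp _)]
  intro I
  refine Measure.ext_of_charFunDual (funext fun L => ?_)
  rw [charFunDual_eq_charFun_map_one, charFunDual_eq_charFun_map_one,
    hH.map_dual_restrict hz I L, hH.map_dual_restrict (fun i => H.neg_mem (hz i)) I L]
  simp only [smul_neg, Finset.sum_neg_distrib, nnnorm_neg]

lemma IsGaussianSubspace.integral_eq_zero (hH : IsGaussianSubspace P H) {g : Lp ℝ 2 P}
    (hg : g ∈ H) : ∫ ω, g ω ∂P = 0 := by
  have h := integral_id_gaussianReal (μ := 0) (v := ‖g‖₊ ^ 2)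
  rw [← hH g hg, integral_map (aemeasurable_Lp g) (by fun_prop)] at h
  exact h

lemma IsGaussianSubspace.covariance_eq [IsProbabilityMeasure P]
    (hH : IsGaussianSubspace P H) {g h : Lp ℝ 2 P} (hg : g ∈ H) : cov[(g : Ω → ℝ), (h : Ω → ℝ); P] = ⟪g, h⟫ := by
  rw [covariance_eq_sub (Lp.memLp g) (Lp.memLp h), hH.integral_eq_zero hg, zero_mul, sub_zero,
    inner_Lp_eq_integral]
  rfl

/-- Orthogonal families in a Gaussian subspace are independent. -/
theorem IsGaussianSubspace.indepFun [IsProbabilityMeasure P]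
    (hH : IsGaussianSubspace P H) {ι' : Type*}
    {z' : ι' → Lp ℝ 2 P} (hz : ∀ i, z i ∈ H) (hz' : ∀ i, z' i ∈ H)
    (horth : ∀ i j, ⟪z i, z' j⟫ = 0) :
    IndepFun (fun ω i => z i ω) (fun ω j => z' j ω) P := by
  have h1 : IsGaussianProcess (Sum.elim (fun i => (z i : Ω → ℝ)) fun j => (z' j : Ω → ℝ)) P := by
    have := hH.isGaussianProcess (z := Sum.elim z z') (by rintro (i | j); exacts [hz i, hz' j])
    convert! this using 1
    funext i
    cases i <;> rfl
  refine h1.indepFun_of_covariance_eq_zero (fun i => aemeasurable_Lp _)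
    (fun i => aemeasurable_Lp _) fun i j => ?_
  rw [hH.covariance_eq (hz i), horth]

end GaussianFamily

end

/-! ### Gaussian paths do not jump over an interval of values. -/

section

open scoped RealInnerProductSpace NNReal

section Projection

variable {E : Type*} [NormedAddCommGroup E] [InnerProductSpace ℝ E]

/-- An orthonormal basis of the span of finitely many vectors, and the properties of the projection
expressed in it. -/
lemma exists_orthonormal_span_finset (F : Finset E) :
    ∃ (d : ℕ) (e : Fin d → E), (∀ k, e k ∈ Submodule.span ℝ (F : Set E)) ∧
      (∀ v, v ∈ Submodule.span ℝ (F : Set E) → ∑ k, ⟪e k, v⟫ • e k = v) ∧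
      (∀ v k, ⟪v - ∑ j, ⟪e j, v⟫ • e j, e k⟫ = 0) ∧
      ∀ v, ∀ f ∈ F, ‖v - ∑ j, ⟪e j, v⟫ • e j‖ ≤ ‖v - f‖ := by
  set K := Submodule.span ℝ (F : Set E) with hK
  have : FiniteDimensional ℝ K := FiniteDimensional.span_finset ℝ F
  set b := stdOrthonormalBasis ℝ K with hb
  have hmem : ∀ v ∈ K, ∑ k, ⟪(b k : E), v⟫ • (b k : E) = v := by
    intro v hv
    have h1 := congrArg (Subtype.val) (b.sum_repr' ⟨v, hv⟩)
    simpa using h1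
  have horth : ∀ v k, ⟪v - ∑ j, ⟪(b j : E), v⟫ • (b j : E), (b k : E)⟫ = 0 := by
    intro v k
    have h2 : ∀ j, ⟪(b j : E), (b k : E)⟫ = if j = k then 1 else 0 := fun j => by
      have := orthonormal_iff_ite.1 b.orthonormal j k
      simpa using this
    rw [inner_sub_left, sum_inner]
    simp only [real_inner_smul_left, h2]
    simp [real_inner_comm]
  refine ⟨_, fun k => (b k : E), fun k => (b k).2, hmem, horth, fun v f hf => ?_⟩
  have hfK : f ∈ K := Submodule.subset_span hf
  set R := v - ∑ j, ⟪(b j : E), v⟫ • (b j : E) with hR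
  have h3 : ⟪R, (∑ j, ⟪(b j : E), v⟫ • (b j : E)) - f⟫ = 0 := by
    rw [← hmem f hfK, ← Finset.sum_sub_distrib, inner_sum]
    refine Finset.sum_eq_zero fun j _ => ?_
    rw [← sub_smul, real_inner_smul_right, horth, mul_zero]
  have h4 : v - f = R + ((∑ j, ⟪(b j : E), v⟫ • (b j : E)) - f) := by
    rw [hR]
    abel
  have h5 := norm_add_sq_real R ((∑ j, ⟪(b j : E), v⟫ • (b j : E)) - f)
  rw [h3, ← h4] at h5
  refine abs_le_of_sq_le_sq' ?_ (norm_nonneg _) |>.2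
  nlinarith [sq_nonneg ‖(∑ j, ⟪(b j : E), v⟫ • (b j : E)) - f‖]

end Projection

variable {Ω : Type*} [MeasurableSpace Ω] {P : Measure Ω} {H : Submodule ℝ (Lp ℝ 2 P)}
  {z : ℝ → Lp ℝ 2 P}

lemma measure_half_lt_abs_le [IsProbabilityMeasure P] (g : Lp ℝ 2 P) :
    P {ω | 1 / 2 < |g ω|} ≤ ENNReal.ofReal (4 * ‖g‖ ^ 2) := by
  have h1 := mul_meas_ge_le_integral_of_nonneg (μ := P) (f := fun ω => g ω ^ 2)
    (.of_forall fun ω => sq_nonneg _) (Lp.memLp g).integrable_sq (1 / 4)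
  rw [← norm_sq_Lp_eq_integral] at h1
  have h2 : {ω | 1 / 2 < |g ω|} ⊆ {ω | 1 / 4 ≤ g ω ^ 2} := by
    intro ω hω
    have hω' : 1 / 2 < |g ω| := hω
    have : 1 / 4 ≤ g ω ^ 2 := by
      rw [← sq_abs]
      nlinarith
    exact this
  refine (measure_mono h2).trans ?_
  rw [ENNReal.le_ofReal_iff_toReal_le (measure_ne_top _ _) (by positivity)]
  simp only [Measure.real] at h1
  linarith

/-- The projected process, as a function of time and of the coordinates. -/
noncomputable def projPath {d : ℕ} (e : Fin d → Lp ℝ 2 P) (z : ℝ → Lp ℝ 2 P) (t : ℝ)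
    (c : Fin d → ℝ) : ℝ :=
  ∑ k, ⟪e k, z t⟫ * c k

lemma continuous_projPath {d : ℕ} (e : Fin d → Lp ℝ 2 P) (hz : Continuous z) (c : Fin d → ℝ) :
    Continuous fun t => projPath e z t c := by
  unfold projPath
  fun_prop

lemma measurable_projPath {d : ℕ} (e : Fin d → Lp ℝ 2 P) (t : ℝ) :
    Measurable fun c => projPath e z t c := by
  unfold projPath
  fun_prop

lemma projPath_ae {d : ℕ} (e : Fin d → Lp ℝ 2 P) (t : ℝ) :
    ∀ᵐ ω ∂P, z t ω = projPath e z t (fun k => e k ω) +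
      (z t - ∑ j, ⟪e j, z t⟫ • e j : Lp ℝ 2 P) ω := by
  filter_upwards [Lp.coeFn_sub (z t) (∑ j, ⟪e j, z t⟫ • e j),
    coeFn_sum_smul Finset.univ (fun j => ⟪e j, z t⟫) e] with ω h1 h2
  rw [h1, Pi.sub_apply, h2]
  simp [projPath]

/-- Sample paths do not jump over an interval of values. -/
theorem IsGaussianSubspace.ae_not_jump [IsProbabilityMeasure P]
    (hH : IsGaussianSubspace P H) (hz : Continuous z)
    (hzH : ∀ t, z t ∈ H) {s₀ s₁ : ℝ} (hs : s₀ < s₁) :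
    ∀ᵐ ω ∂P, z s₀ ω * z s₁ ω < 0 → ∃ s : ℚ, (s : ℝ) ∈ Set.Ioo s₀ s₁ ∧ |z s ω| ≤ 1 := by
  classical
  have hgoal : ∀ η > 0, P {ω | ¬ (z s₀ ω * z s₁ ω < 0 →
      ∃ s : ℚ, (s : ℝ) ∈ Set.Ioo s₀ s₁ ∧ |z s ω| ≤ 1)} ≤ ENNReal.ofReal (4 * η ^ 2) := by
    intro η hη
    -- By compactness, finitely many values of the process come within η of all its values on [s₀,
    -- s₁], so projecting onto their span leaves residuals of norm at most η. The endpoints are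
    -- added so that the projection is exact there.
    obtain ⟨F₀, hF₀, hcov⟩ := (isCompact_Icc (a := s₀) (b := s₁)).elim_nhds_subcover
      (fun x => {t | dist (z t) (z x) < η})
      (fun x _ => (isOpen_lt (by fun_prop) continuous_const).mem_nhds (by simpa using hη))
    set F : Finset (Lp ℝ 2 P) := (insert s₀ (insert s₁ F₀)).image z with hF
    obtain ⟨d, e, heK, hrepr, horth, hdist⟩ := exists_orthonormal_span_finset F
    have hKH : Submodule.span ℝ (F : Set (Lp ℝ 2 P)) ≤ H := by
      rw [Submodule.span_le]
      intro v hv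
      obtain ⟨s, -, rfl⟩ := Finset.mem_image.1 (Finset.mem_coe.1 hv)
      exact hzH s
    have heH : ∀ k, e k ∈ H := fun k => hKH (heK k)
    set R : ℝ → Lp ℝ 2 P := fun t => z t - ∑ j, ⟪e j, z t⟫ • e j with hR
    have hRH : ∀ t, R t ∈ H := fun t => H.sub_mem (hzH t)
      (H.sum_mem fun j _ => H.smul_mem _ (heH j))
    have hRnorm : ∀ t ∈ Set.Icc s₀ s₁, ‖R t‖ ≤ η := by
      intro t ht
      obtain ⟨x, hx, hxt⟩ := Set.mem_iUnion₂.1 (hcov ht)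
      have hxt' : dist (z t) (z x) < η := hxt
      rw [dist_eq_norm] at hxt'
      exact (hdist (z t) (z x) (Finset.mem_image_of_mem _ (by simp [hx]))).trans hxt'.le
    have hend : ∀ s ∈ insert s₀ (insert s₁ F₀),
        ∀ᵐ ω ∂P, z s ω = projPath e z s (fun k => e k ω) := by
      intro s hs
      have h1 := hrepr (z s) (Submodule.subset_span (Finset.mem_image_of_mem _ hs))
      filter_upwards [coeFn_sum_smul Finset.univ (fun j => ⟪e j, z s⟫) e] with ω h2
      rw [h1] at h2
      rw [h2]
      rfl
    obtain ⟨q, hq⟩ := exists_surjective_nat ℚ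
    -- Disjointifying these sets selects the first rational time at which the projected path is at
    -- most 1/2 in absolute value. The choice depends on the projected coordinates alone, hence is
    -- independent of the residuals.
    set G : ℕ → Set (Fin d → ℝ) := fun j =>
      {c | (q j : ℝ) ∈ Set.Ioo s₀ s₁ ∧ |projPath e z (q j) c| ≤ 1 / 2} with hG
    have hGmeas : ∀ j, MeasurableSet (G j) := by
      intro j
      refine MeasurableSet.inter (MeasurableSet.const _) ?_
      exact measurableSet_le (measurable_projPath e _).abs measurable_const
    set B : ℕ → Set (Fin d → ℝ) := disjointed G with hB
    have hBmeas : ∀ j, MeasurableSet (B j) := fun j => MeasurableSet.disjointed hGmeas j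
    set ξ : Ω → Fin d → ℝ := fun ω k => e k ω with hξ
    have hξmeas : AEMeasurable ξ P := aemeasurable_pi_lambda _ fun k => aemeasurable_Lp _
    have hae : ∀ᵐ ω ∂P, ω ∈ {ω | ¬ (z s₀ ω * z s₁ ω < 0 →
        ∃ s : ℚ, (s : ℝ) ∈ Set.Ioo s₀ s₁ ∧ |z s ω| ≤ 1)} →
        ω ∈ ⋃ j, ξ ⁻¹' B j ∩ {ω | (q j : ℝ) ∈ Set.Ioo s₀ s₁ ∧ 1 / 2 < |R (q j) ω|} := by
      have hall : ∀ᵐ ω ∂P, ∀ s : ℚ, z s ω = projPath e z s (ξ ω) + R s ω :=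
        ae_all_iff.2 fun s => projPath_ae e s
      filter_upwards [hall, hend s₀ (by simp), hend s₁ (by simp)] with ω h1 h2 h3 hω
      simp only [Classical.not_imp, not_exists, not_and, not_le] at hω
      obtain ⟨hneg, hbig⟩ := hω
      rw [h2, h3] at hneg
      have hcont := continuous_projPath e hz (ξ ω)
      -- The projected path is continuous and has the signs of z at both ends. Near its zero it is
      -- small at some rational time, and if z exceeds 1 in absolute value there, the residual must
      -- exceed 1/2.
      have hzero : ∃ ζ ∈ Set.Icc s₀ s₁, projPath e z ζ (ξ ω) = 0 := by
        have h4 := intermediate_value_uIcc (f := fun t => projPath e z t (ξ ω)) (a := s₀) (b := s₁)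
          hcont.continuousOn
        have h5 : (0 : ℝ) ∈ Set.uIcc (projPath e z s₀ (ξ ω)) (projPath e z s₁ (ξ ω)) := by
          rw [Set.mem_uIcc]
          rcases mul_neg_iff.1 hneg with h | h
          · exact Or.inr ⟨h.2.le, h.1.le⟩
          · exact Or.inl ⟨h.1.le, h.2.le⟩
        obtain ⟨ζ, hζ, hζ0⟩ := h4 h5
        rw [Set.uIcc_of_le hs.le] at hζ
        exact ⟨ζ, hζ, hζ0⟩
      obtain ⟨ζ, hζ, hζ0⟩ := hzero
      have hζ1 : ζ ≠ s₀ := by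
        rintro rfl
        rw [hξ] at hζ0
        simp only at hζ0
        rw [hζ0, zero_mul] at hneg
        exact lt_irrefl _ hneg
      have hζ2 : ζ ≠ s₁ := by
        rintro rfl
        rw [hξ] at hζ0
        simp only at hζ0
        rw [hζ0, mul_zero] at hneg
        exact lt_irrefl _ hneg
      have hζ' : ζ ∈ Set.Ioo s₀ s₁ :=
        ⟨lt_of_le_of_ne hζ.1 (Ne.symm hζ1), lt_of_le_of_ne hζ.2 hζ2⟩
      have hopen : IsOpen (Set.Ioo s₀ s₁ ∩ {t | |projPath e z t (ξ ω)| < 1 / 2}) :=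
        isOpen_Ioo.inter (isOpen_lt (by fun_prop) continuous_const)
      obtain ⟨s, hs'⟩ := Rat.denseRange_cast.exists_mem_open hopen
        ⟨ζ, hζ', by simp [hζ0]⟩
      have hmem : ξ ω ∈ ⋃ j, G j := by
        obtain ⟨j, rfl⟩ := hq s
        refine Set.mem_iUnion.2 ⟨j, ?_⟩
        exact ⟨hs'.1, hs'.2.le⟩
      rw [← iUnion_disjointed] at hmem
      obtain ⟨j, hj⟩ := Set.mem_iUnion.1 hmem
      have hjG : ξ ω ∈ G j := disjointed_subset G j hj
      refine Set.mem_iUnion.2 ⟨j, hj, hjG.1, ?_⟩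
      have h6 := hbig (q j) hjG.1
      rw [h1] at h6
      have h7 := abs_add_le (projPath e z (q j) (ξ ω)) (R (q j) ω)
      have h8 := hjG.2
      linarith
    have hterm : ∀ j, P (ξ ⁻¹' B j ∩ {ω | (q j : ℝ) ∈ Set.Ioo s₀ s₁ ∧ 1 / 2 < |R (q j) ω|}) ≤
        P.map ξ (B j) * ENNReal.ofReal (4 * η ^ 2) := by
      intro j
      by_cases hj : (q j : ℝ) ∈ Set.Ioo s₀ s₁
      · have hind : IndepFun ξ (fun ω (_ : Unit) => R (q j) ω) P :=
          hH.indepFun heH (z' := fun _ : Unit => R (q j)) (fun _ => hRH _) fun k _ => by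
            rw [real_inner_comm]
            exact horth _ _
        have h1 := hind.measure_inter_preimage_eq_mul (B j) {c | 1 / 2 < |c ()|} (hBmeas j)
          (measurableSet_lt measurable_const (measurable_pi_apply ()).abs)
        have h2 : ξ ⁻¹' B j ∩ {ω | (q j : ℝ) ∈ Set.Ioo s₀ s₁ ∧ 1 / 2 < |R (q j) ω|} =
            ξ ⁻¹' B j ∩ (fun ω (_ : Unit) => R (q j) ω) ⁻¹' {c | 1 / 2 < |c ()|} := by
          ext ω
          simp only [Set.mem_inter_iff, Set.mem_preimage, Set.mem_ofPred_eq, hj, true_and]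
        rw [h2, h1, Measure.map_apply_of_aemeasurable hξmeas (hBmeas j)]
        gcongr
        refine (measure_half_lt_abs_le (R (q j))).trans (ENNReal.ofReal_le_ofReal ?_)
        have := hRnorm _ ⟨hj.1.le, hj.2.le⟩
        gcongr
      · have : ξ ⁻¹' B j ∩ {ω | (q j : ℝ) ∈ Set.Ioo s₀ s₁ ∧ 1 / 2 < |R (q j) ω|} = ∅ := by
          ext ω
          simp [hj]
        rw [this, measure_empty]
        exact zero_le
    have : IsProbabilityMeasure (P.map ξ) := P.isProbabilityMeasure_map hξmeas
    calc _ ≤ P (⋃ j, ξ ⁻¹' B j ∩ {ω | (q j : ℝ) ∈ Set.Ioo s₀ s₁ ∧ 1 / 2 < |R (q j) ω|}) :=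
          measure_mono_ae hae
      _ ≤ ∑' j, P.map ξ (B j) * ENNReal.ofReal (4 * η ^ 2) :=
          (measure_iUnion_le _).trans (ENNReal.tsum_le_tsum hterm)
      _ = P.map ξ (⋃ j, B j) * ENNReal.ofReal (4 * η ^ 2) := by
          rw [ENNReal.tsum_mul_right, measure_iUnion (disjoint_disjointed G) hBmeas]
      _ ≤ 1 * ENNReal.ofReal (4 * η ^ 2) := by
          gcongr
          exact prob_le_one
      _ = _ := one_mul _
  rw [ae_iff]
  refine le_antisymm (ENNReal.le_of_forall_pos_le_add fun ε hε _ => ?_) zero_le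
  rw [zero_add]
  refine (hgoal (Real.sqrt (ε / 4)) (by positivity)).trans ?_
  rw [Real.sq_sqrt (by positivity), mul_div_cancel₀ _ (by norm_num), ENNReal.ofReal_coe_nnreal]

end

/-! ### One-sided boundedness has probability zero, and paths do not blow up. -/

section

open scoped RealInnerProductSpace NNReal

/-- The functions on `ℚ` with values at least `-M` on `(a, b)`. -/
def geOn (a b : ℝ) (M : ℕ) : Set (ℚ → ℝ) := {c | ∀ s : ℚ, (s : ℝ) ∈ Set.Ioo a b → -(M : ℝ) ≤ c s}

/-- The functions on `ℚ` with values at most `M` on `(a, b)`. -/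
def leOn (a b : ℝ) (M : ℕ) : Set (ℚ → ℝ) := {c | ∀ s : ℚ, (s : ℝ) ∈ Set.Ioo a b → c s ≤ M}

/-- The functions on `ℚ` which are bounded below, but not above, on `(a, b)`. -/
def oneSided (a b : ℝ) : Set (ℚ → ℝ) := (⋃ M, geOn a b M) \ ⋃ M, leOn a b M

section Sets

variable {a b : ℝ}

lemma measurableSet_geOn (M : ℕ) : MeasurableSet (geOn a b M) := by
  have : geOn a b M = ⋂ s : ℚ, ⋂ _ : (s : ℝ) ∈ Set.Ioo a b, {c : ℚ → ℝ | -(M : ℝ) ≤ c s} := by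
    ext c
    simp [geOn]
  rw [this]
  exact MeasurableSet.iInter fun s => MeasurableSet.iInter fun _ =>
    measurableSet_le measurable_const (measurable_pi_apply s)

lemma measurableSet_leOn (M : ℕ) : MeasurableSet (leOn a b M) := by
  have : leOn a b M = ⋂ s : ℚ, ⋂ _ : (s : ℝ) ∈ Set.Ioo a b, {c : ℚ → ℝ | c s ≤ M} := by
    ext c
    simp [leOn]
  rw [this]
  exact MeasurableSet.iInter fun s => MeasurableSet.iInter fun _ =>
    measurableSet_le (measurable_pi_apply s) measurable_const

lemma measurableSet_oneSided : MeasurableSet (oneSided a b) :=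
  (MeasurableSet.iUnion measurableSet_geOn).diff (MeasurableSet.iUnion measurableSet_leOn)

lemma mem_iUnion_geOn_of_bounded_sub {c c' : ℚ → ℝ} {M₀ : ℝ}
    (h : ∀ s : ℚ, (s : ℝ) ∈ Set.Ioo a b → |c s - c' s| ≤ M₀) (hc : c ∈ ⋃ M, geOn a b M) :
    c' ∈ ⋃ M, geOn a b M := by
  obtain ⟨M, hM⟩ := Set.mem_iUnion.1 hc
  obtain ⟨n, hn⟩ := exists_nat_ge (M + M₀)
  refine Set.mem_iUnion.2 ⟨n, fun s hs => ?_⟩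
  have h1 := hM s hs
  have h2 := abs_le.1 (h s hs)
  linarith

lemma mem_iUnion_leOn_of_bounded_sub {c c' : ℚ → ℝ} {M₀ : ℝ}
    (h : ∀ s : ℚ, (s : ℝ) ∈ Set.Ioo a b → |c s - c' s| ≤ M₀) (hc : c ∈ ⋃ M, leOn a b M) :
    c' ∈ ⋃ M, leOn a b M := by
  obtain ⟨M, hM⟩ := Set.mem_iUnion.1 hc
  obtain ⟨n, hn⟩ := exists_nat_ge (M + M₀)
  refine Set.mem_iUnion.2 ⟨n, fun s hs => ?_⟩
  have h1 := hM s hs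
  have h2 := abs_le.1 (h s hs)
  linarith

lemma mem_oneSided_of_bounded_sub {c c' : ℚ → ℝ} {M₀ : ℝ}
    (h : ∀ s : ℚ, (s : ℝ) ∈ Set.Ioo a b → |c s - c' s| ≤ M₀) (hc : c ∈ oneSided a b) :
    c' ∈ oneSided a b :=
  ⟨mem_iUnion_geOn_of_bounded_sub h hc.1, fun hc' => hc.2
    (mem_iUnion_leOn_of_bounded_sub (fun s hs => by rw [abs_sub_comm]; exact h s hs) hc')⟩

end Sets

variable {Ω : Type*} [MeasurableSpace Ω] {P : Measure Ω} [IsProbabilityMeasure P]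
  {H : Submodule ℝ (Lp ℝ 2 P)} {z : ℝ → Lp ℝ 2 P} {a b : ℝ}

/-- The values of the process at rational times. -/
noncomputable def ratPath (z : ℝ → Lp ℝ 2 P) (ω : Ω) (s : ℚ) : ℝ := z s ω

omit [IsProbabilityMeasure P] in
lemma aemeasurable_ratPath : AEMeasurable (ratPath z) P :=
  aemeasurable_pi_lambda _ fun _ => aemeasurable_Lp _

/-- One-sided boundedness is independent of finitely many values of the process. -/
lemma IsGaussianSubspace.measure_oneSided_inter (hH : IsGaussianSubspace P H) (hz : Continuous z)
    (hzH : ∀ t, z t ∈ H) (F : Finset ℚ) (M : ℝ) :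
    P {ω | ratPath z ω ∈ oneSided a b ∧ ∀ s ∈ F, M ≤ z s ω} =
      P {ω | ratPath z ω ∈ oneSided a b} * P {ω | ∀ s ∈ F, M ≤ z s ω} := by
  classical
  obtain ⟨d, e, heK, hrepr, horth, -⟩ :=
    exists_orthonormal_span_finset (F.image fun s : ℚ => z s)
  set K := Submodule.span ℝ ((F.image fun s : ℚ => z s : Finset (Lp ℝ 2 P)) : Set (Lp ℝ 2 P))
  have hKH : K ≤ H := by
    refine Submodule.span_le.2 fun v hv => ?_
    obtain ⟨s, -, rfl⟩ := Finset.mem_image.1 (Finset.mem_coe.1 hv)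
    exact hzH s
  have heH : ∀ k, e k ∈ H := fun k => hKH (heK k)
  set R : ℝ → Lp ℝ 2 P := fun t => z t - ∑ j, ⟪e j, z t⟫ • e j with hR
  have hRH : ∀ t, R t ∈ H := fun t => H.sub_mem (hzH t)
    (H.sum_mem fun j _ => H.smul_mem _ (heH j))
  have hind : IndepFun (ratPath R) (fun ω (s : F) => z s ω) P :=
    hH.indepFun (z := fun s : ℚ => R s) (z' := fun s : F => z s) (fun s => hRH s)
      (fun s => hzH s) fun s s' => by
        have hs' : z (s' : ℚ) ∈ K := Submodule.subset_span (Finset.mem_image_of_mem _ s'.2)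
        rw [← hrepr _ hs', inner_sum]
        refine Finset.sum_eq_zero fun k _ => ?_
        rw [real_inner_smul_right, horth, mul_zero]
  -- The path and its residual differ by a continuous path, bounded on [a, b]; such a change does
  -- not affect one-sided boundedness.
  have hae : ∀ᵐ ω ∂P, ratPath z ω ∈ oneSided a b ↔ ratPath R ω ∈ oneSided a b := by
    have hall : ∀ᵐ ω ∂P, ∀ s : ℚ, z s ω = projPath e z s (fun k => e k ω) + R s ω :=
      ae_all_iff.2 fun s => projPath_ae e s
    filter_upwards [hall] with ω hω
    obtain ⟨M₀, hM₀⟩ := (isCompact_Icc (a := a) (b := b)).exists_bound_of_continuousOn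
      (continuous_projPath e hz fun k => e k ω).continuousOn
    have hbound : ∀ s : ℚ, (s : ℝ) ∈ Set.Ioo a b → |ratPath z ω s - ratPath R ω s| ≤ M₀ := by
      intro s hs
      have := hM₀ s ⟨hs.1.le, hs.2.le⟩
      rw [ratPath, ratPath, hω s, add_sub_cancel_right]
      exact this
    refine ⟨mem_oneSided_of_bounded_sub hbound, mem_oneSided_of_bounded_sub (M₀ := M₀) fun s hs => ?_⟩
    rw [abs_sub_comm]
    exact hbound s hs
  have h1 := hind.measure_inter_preimage_eq_mul (oneSided a b) {c | ∀ s, M ≤ c s}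
    measurableSet_oneSided (by
      rw [Set.ofPred_forall]
      exact MeasurableSet.iInter fun s => measurableSet_le measurable_const (measurable_pi_apply s))
  have h2 : P {ω | ratPath z ω ∈ oneSided a b ∧ ∀ s ∈ F, M ≤ z s ω} =
      P (ratPath R ⁻¹' oneSided a b ∩ (fun ω (s : F) => z s ω) ⁻¹' {c | ∀ s, M ≤ c s}) := by
    refine measure_congr ?_
    filter_upwards [hae] with ω hω
    refine propext ⟨fun h => ⟨hω.1 h.1, fun s => h.2 s s.2⟩, fun h => ⟨hω.2 h.1, fun s hs => ?_⟩⟩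
    exact h.2 ⟨s, hs⟩
  have h3 : P {ω | ratPath z ω ∈ oneSided a b} = P (ratPath R ⁻¹' oneSided a b) := by
    refine measure_congr ?_
    filter_upwards [hae] with ω hω
    exact propext hω
  have h4 : {ω | ∀ s ∈ F, M ≤ z s ω} = (fun ω (s : F) => z s ω) ⁻¹' {c | ∀ s, M ≤ c s} := by
    ext ω
    exact ⟨fun h s => h s s.2, fun h s hs => h ⟨s, hs⟩⟩
  rw [h2, h3, h4, h1]

/-- The lower bound on (a, b) is the decreasing limit of the same bound at finitely many rationals,
for which independence holds. -/
lemma IsGaussianSubspace.map_oneSided_inter_le (hH : IsGaussianSubspace P H) (hz : Continuous z)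
    (hzH : ∀ t, z t ∈ H) (M : ℕ) :
    P.map (ratPath z) (oneSided a b ∩ geOn a b M) ≤
      P.map (ratPath z) (oneSided a b) * P.map (ratPath z) (geOn a b M) := by
  classical
  have : IsProbabilityMeasure (P.map (ratPath z)) := P.isProbabilityMeasure_map aemeasurable_ratPath
  obtain ⟨q, hq⟩ := exists_surjective_nat ℚ
  set F : ℕ → Finset ℚ := fun n =>
    ((Finset.range n).image q).filter fun s => (s : ℝ) ∈ Set.Ioo a b
  set A : ℕ → Set (ℚ → ℝ) := fun n => {c | ∀ s ∈ F n, -(M : ℝ) ≤ c s} with hA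
  have hAmeas : ∀ n, MeasurableSet (A n) := by
    intro n
    have : A n = ⋂ s ∈ F n, {c : ℚ → ℝ | -(M : ℝ) ≤ c s} := by
      ext c
      simp [hA]
    rw [this]
    exact Finset.measurableSet_biInter _ fun s _ =>
      measurableSet_le measurable_const (measurable_pi_apply s)
  have hAanti : Antitone A := by
    intro m n hmn c hc s hs
    refine hc s ?_
    refine Finset.filter_subset_filter _ (Finset.image_subset_image ?_) hs
    exact Finset.range_mono hmn
  have hAinter : ⋂ n, A n = geOn a b M := by
    ext c
    simp only [Set.mem_iInter]
    refine ⟨fun h s hs => ?_, fun h n s hs => h s (Finset.mem_filter.1 hs).2⟩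
    obtain ⟨j, rfl⟩ := hq s
    exact h (j + 1) (q j) (Finset.mem_filter.2 ⟨Finset.mem_image_of_mem _ (by simp), hs⟩)
  have hlim : Tendsto (fun n => P.map (ratPath z) (A n)) atTop
      (𝓝 (P.map (ratPath z) (geOn a b M))) := by
    rw [← hAinter]
    exact tendsto_measure_iInter_atTop (fun n => (hAmeas n).nullMeasurableSet) hAanti
      ⟨0, measure_ne_top _ _⟩
  refine ge_of_tendsto' (ENNReal.Tendsto.const_mul hlim (Or.inr (measure_ne_top _ _))) fun n => ?_
  have h1 := hH.measure_oneSided_inter (a := a) (b := b) hz hzH (F n) (-(M : ℝ))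
  have h2 : P.map (ratPath z) (oneSided a b ∩ A n) =
      P.map (ratPath z) (oneSided a b) * P.map (ratPath z) (A n) := by
    rw [Measure.map_apply_of_aemeasurable aemeasurable_ratPath
        (measurableSet_oneSided.inter (hAmeas n)),
      Measure.map_apply_of_aemeasurable aemeasurable_ratPath measurableSet_oneSided,
      Measure.map_apply_of_aemeasurable aemeasurable_ratPath (hAmeas n)]
    exact h1
  rw [← h2]
  refine measure_mono (Set.inter_subset_inter_right _ ?_)
  rw [← hAinter]
  exact Set.iInter_subset _ _

lemma IsGaussianSubspace.map_iUnion_geOn (hH : IsGaussianSubspace P H) (hzH : ∀ t, z t ∈ H) :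
    P.map (ratPath z) (⋃ M, geOn a b M) = P.map (ratPath z) (⋃ M, leOn a b M) := by
  have h1 : P.map (ratPath z) = P.map (fun ω (s : ℚ) => (-z s : Lp ℝ 2 P) ω) :=
    hH.map_neg fun s : ℚ => hzH s
  have hae : ∀ᵐ ω ∂P, ∀ s : ℚ, (-z s : Lp ℝ 2 P) ω = -z s ω :=
    ae_all_iff.2 fun s => Lp.coeFn_neg (z s)
  conv_rhs => rw [h1]
  rw [Measure.map_apply_of_aemeasurable aemeasurable_ratPath
      (MeasurableSet.iUnion measurableSet_geOn),
    Measure.map_apply_of_aemeasurable (aemeasurable_pi_lambda _ fun _ => aemeasurable_Lp _)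
      (MeasurableSet.iUnion measurableSet_leOn)]
  refine measure_congr ?_
  filter_upwards [hae] with ω hω
  refine propext ?_
  change ratPath z ω ∈ ⋃ M, geOn a b M ↔ (fun s : ℚ => (-z s : Lp ℝ 2 P) ω) ∈ ⋃ M, leOn a b M
  simp only [Set.mem_iUnion]
  refine exists_congr fun M => forall_congr' fun s => imp_congr_right fun _ => ?_
  change -(M : ℝ) ≤ z s ω ↔ (-z s : Lp ℝ 2 P) ω ≤ M
  rw [hω, neg_le]

/-- Almost no sample path is bounded on one side only. -/
theorem IsGaussianSubspace.ae_not_oneSided (hH : IsGaussianSubspace P H) (hz : Continuous z)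
    (hzH : ∀ t, z t ∈ H) : ∀ᵐ ω ∂P, ratPath z ω ∉ oneSided a b := by
  have : IsProbabilityMeasure (P.map (ratPath z)) := P.isProbabilityMeasure_map aemeasurable_ratPath
  set μ := P.map (ratPath z) with hμ
  have hmono : Monotone (geOn a b) := by
    intro m n hmn c hc s hs
    have : (m : ℝ) ≤ n := by exact_mod_cast hmn
    linarith [hc s hs]
  -- On the one-sided event some lower bound holds, so the independence estimate can be summed up by
  -- letting M increase. If the event had positive probability, paths would almost surely be bounded
  -- below, hence by symmetry also above, contradicting the event.
  have hle : μ (oneSided a b) ≤ μ (oneSided a b) * μ (⋃ M, geOn a b M) := by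
    have h1 : oneSided a b = ⋃ M, oneSided a b ∩ geOn a b M := by
      rw [← Set.inter_iUnion]
      exact (Set.inter_eq_left.2 Set.sdiff_subset).symm
    conv_lhs => rw [h1]
    rw [Monotone.measure_iUnion fun m n hmn => Set.inter_subset_inter_right _ (hmono hmn)]
    refine iSup_le fun M => (hH.map_oneSided_inter_le hz hzH M).trans ?_
    gcongr
    exact Set.subset_iUnion (geOn a b) M
  have hzero : μ (oneSided a b) = 0 := by
    by_contra hne
    have h1 : 1 ≤ μ (⋃ M, geOn a b M) := by
      by_contra hlt
      have := ENNReal.mul_lt_mul_right hne (measure_ne_top μ _) (not_le.1 hlt)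
      rw [mul_one] at this
      exact absurd hle (not_le.2 this)
    have h2 : μ (⋃ M, leOn a b M) = 1 := by
      rw [← hH.map_iUnion_geOn hzH]
      exact le_antisymm prob_le_one h1
    have h3 : μ (⋃ M, leOn a b M)ᶜ = 0 :=
      (prob_compl_eq_zero_iff (MeasurableSet.iUnion measurableSet_leOn)).2 h2
    exact hne (measure_mono_null (fun c hc => hc.2) h3)
  rw [hμ, Measure.map_apply_of_aemeasurable aemeasurable_ratPath measurableSet_oneSided] at hzero
  rw [ae_iff]
  convert hzero using 2
  ext ω
  simp

/-- Almost no sample path tends to infinity at any time. -/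
theorem IsGaussianSubspace.ae_not_blowUp (hH : IsGaussianSubspace P H) (hz : Continuous z)
    (hzH : ∀ t, z t ∈ H) :
    ∀ᵐ ω ∂P, ∀ t : ℝ, ∃ M : ℝ, ∀ δ > 0, ∃ s : ℚ, |s - t| < δ ∧ |z s ω| ≤ M := by
  have h1 : ∀ᵐ ω ∂P, ∀ s₀ s₁ : ℚ, s₀ < s₁ → z s₀ ω * z s₁ ω < 0 →
      ∃ s : ℚ, (s : ℝ) ∈ Set.Ioo (s₀ : ℝ) s₁ ∧ |z s ω| ≤ 1 :=
    ae_all_iff.2 fun s₀ => ae_all_iff.2 fun s₁ => by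
      by_cases h : s₀ < s₁
      · filter_upwards [hH.ae_not_jump hz hzH (s₀ := s₀) (s₁ := s₁) (by exact_mod_cast h)]
          with ω hω _ using hω
      · exact .of_forall fun ω h' => absurd h' h
  have h2 : ∀ᵐ ω ∂P, ∀ a b : ℚ, ratPath z ω ∉ oneSided (a : ℝ) b :=
    ae_all_iff.2 fun a => ae_all_iff.2 fun b => hH.ae_not_oneSided hz hzH
  have h3 : ∀ᵐ ω ∂P, ∀ a b : ℚ, ratPath (-z) ω ∉ oneSided (a : ℝ) b :=
    ae_all_iff.2 fun a => ae_all_iff.2 fun b =>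
      hH.ae_not_oneSided hz.neg fun t => H.neg_mem (hzH t)
  have h4 : ∀ᵐ ω ∂P, ∀ s : ℚ, (-z s : Lp ℝ 2 P) ω = -z s ω :=
    ae_all_iff.2 fun s => Lp.coeFn_neg (z s)
  filter_upwards [h1, h2, h3, h4] with ω h1 h2 h3 h4 t
  by_contra! hcon
  obtain ⟨δ, hδ, hbig⟩ := hcon 1
  obtain ⟨a, ha₁, ha₂⟩ := exists_rat_btwn (show t - δ < t by linarith)
  obtain ⟨b, hb₁, hb₂⟩ := exists_rat_btwn (show t < t + δ by linarith)
  have hbig' : ∀ s : ℚ, (s : ℝ) ∈ Set.Ioo (a : ℝ) b → 1 < |z s ω| := fun s hs =>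
    hbig s (abs_lt.2 ⟨by linarith [hs.1], by linarith [hs.2]⟩)
  -- All rational values near t exceed 1 in absolute value, so by the absence of jumps they have one
  -- sign: the path is bounded on one side and, blowing up at t, not on the other.
  have hprod : ∀ s₀ s₁ : ℚ, (s₀ : ℝ) ∈ Set.Ioo (a : ℝ) b → (s₁ : ℝ) ∈ Set.Ioo (a : ℝ) b →
      0 ≤ z s₀ ω * z s₁ ω := by
    have key : ∀ s₀ s₁ : ℚ, (s₀ : ℝ) ∈ Set.Ioo (a : ℝ) b → (s₁ : ℝ) ∈ Set.Ioo (a : ℝ) b →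
        s₀ < s₁ → 0 ≤ z s₀ ω * z s₁ ω := by
      intro s₀ s₁ hs₀ hs₁ hlt
      by_contra! hneg
      obtain ⟨s, hs, hs'⟩ := h1 s₀ s₁ hlt hneg
      exact absurd hs' (not_le.2 (hbig' s ⟨hs₀.1.trans hs.1, hs.2.trans hs₁.2⟩))
    intro s₀ s₁ hs₀ hs₁
    rcases lt_trichotomy s₀ s₁ with h | h | h
    · exact key _ _ hs₀ hs₁ h
    · rw [h]
      exact mul_self_nonneg _
    · rw [mul_comm]
      exact key _ _ hs₁ hs₀ h
  have hnear : ∀ M : ℝ, ∃ s : ℚ, (s : ℝ) ∈ Set.Ioo (a : ℝ) b ∧ M < |z s ω| := by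
    intro M
    obtain ⟨δ', hδ', hM⟩ := hcon M
    obtain ⟨s, hs₁, hs₂⟩ := exists_rat_btwn (show t < min (b : ℝ) (t + δ') from lt_min hb₁ (by linarith))
    refine ⟨s, ⟨ha₂.trans hs₁, hs₂.trans_le (min_le_left _ _)⟩, hM s (abs_lt.2 ⟨?_, ?_⟩)⟩
    · linarith
    · linarith [hs₂.trans_le (min_le_right (b : ℝ) (t + δ'))]
  obtain ⟨c, hc, hc1⟩ := hnear 1
  have hcne : z c ω ≠ 0 := fun h => by
    rw [h, abs_zero] at hc1
    linarith
  rcases lt_or_gt_of_ne hcne with hneg | hpos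
  · have hsign : ∀ s : ℚ, (s : ℝ) ∈ Set.Ioo (a : ℝ) b → z s ω ≤ 0 := fun s hs => by
      by_contra! h
      have := hprod s c hs hc
      nlinarith
    refine h3 a b ⟨Set.mem_iUnion.2 ⟨0, fun s hs => ?_⟩, fun h => ?_⟩
    · have : ratPath (-z) ω s = -z s ω := h4 s
      rw [this]
      simpa using hsign s hs
    · obtain ⟨M, hM⟩ := Set.mem_iUnion.1 h
      obtain ⟨s, hs, hs'⟩ := hnear M
      have h5 := hM s hs
      have : ratPath (-z) ω s = -z s ω := h4 s
      rw [this] at h5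
      rw [abs_of_nonpos (hsign s hs)] at hs'
      linarith
  · have hsign : ∀ s : ℚ, (s : ℝ) ∈ Set.Ioo (a : ℝ) b → 0 ≤ z s ω := fun s hs => by
      by_contra! h
      have := hprod s c hs hc
      nlinarith
    refine h2 a b ⟨Set.mem_iUnion.2 ⟨0, fun s hs => ?_⟩, fun h => ?_⟩
    · simpa [ratPath] using hsign s hs
    · obtain ⟨M, hM⟩ := Set.mem_iUnion.1 h
      obtain ⟨s, hs, hs'⟩ := hnear M
      have h5 : z s ω ≤ M := hM s hs
      rw [abs_of_nonneg (hsign s hs)] at hs'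
      linarith

end

/-! ### A jointly measurable and separable modification. -/

section

open scoped RealInnerProductSpace NNReal

section NearInf

/-- The lower limit at `t` of a function on the rationals, including the value at `t` itself. -/
noncomputable def nearInf (A : ℚ → ℝ≥0∞) (t : ℝ) : ℝ≥0∞ :=
  ⨆ n : ℕ, ⨅ s : ℚ, if |s - t| < 1 / ((n : ℝ) + 1) then A s else ∞

variable {A : ℚ → ℝ≥0∞} {t : ℝ}

lemma exists_lt_of_nearInf_lt {c : ℝ≥0∞} (h : nearInf A t < c) {δ : ℝ} (hδ : 0 < δ) :
    ∃ s : ℚ, |s - t| < δ ∧ A s < c := by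
  obtain ⟨n, hn⟩ := exists_nat_one_div_lt hδ
  have h1 := (le_iSup (fun n : ℕ => ⨅ s : ℚ, if |s - t| < 1 / ((n : ℝ) + 1) then A s else ∞)
    n).trans_lt h
  obtain ⟨s, hs⟩ := iInf_lt_iff.1 h1
  by_cases hst : |s - t| < 1 / ((n : ℝ) + 1)
  · rw [if_pos hst] at hs
    exact ⟨s, hst.trans hn, hs⟩
  · rw [if_neg hst] at hs
    exact absurd hs not_top_lt

lemma exists_forall_lt_of_lt_nearInf {c : ℝ≥0∞} (h : c < nearInf A t) :
    ∃ δ > 0, ∀ s : ℚ, |s - t| < δ → c < A s := by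
  obtain ⟨n, hn⟩ := lt_iSup_iff.1 h
  refine ⟨1 / ((n : ℝ) + 1), Nat.one_div_pos_of_nat, fun s hs => ?_⟩
  have := hn.trans_le (iInf_le _ s)
  rwa [if_pos hs] at this

lemma exists_near_of_nearInf_ne_top (h : nearInf A t ≠ ∞) {δ ε : ℝ} (hδ : 0 < δ) (hε : 0 < ε) :
    ∃ s : ℚ, |s - t| < δ ∧ A s ≠ ∞ ∧ |(A s).toReal - (nearInf A t).toReal| < ε := by
  have hε' : ENNReal.ofReal ε ≠ 0 := by simpa using hε
  have h1 : nearInf A t < nearInf A t + ENNReal.ofReal ε := ENNReal.lt_add_right h hε'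
  -- The value 0 is treated apart, since truncated subtraction of ε does not make it strictly
  -- smaller.
  obtain ⟨δ', hδ', hlow⟩ : ∃ δ' > 0, ∀ s : ℚ, |s - t| < δ' →
      nearInf A t < A s + ENNReal.ofReal ε := by
    rcases eq_or_ne (nearInf A t) 0 with h0 | h0
    · refine ⟨1, one_pos, fun s _ => ?_⟩
      rw [h0]
      exact (pos_iff_ne_zero.2 hε').trans_le le_add_self
    · obtain ⟨δ', hδ', H⟩ := exists_forall_lt_of_lt_nearInf (ENNReal.sub_lt_self h h0 hε')
      refine ⟨δ', hδ', fun s hs => ?_⟩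
      by_contra! hcon
      exact absurd (H s hs) (not_lt.2 (ENNReal.le_sub_of_add_le_right (by simp) hcon))
  obtain ⟨s, hs, hs'⟩ := exists_lt_of_nearInf_lt h1 (lt_min hδ hδ')
  have hfin : A s ≠ ∞ := (hs'.trans_le le_top).ne
  refine ⟨s, hs.trans_le (min_le_left _ _), hfin, ?_⟩
  have h2 := hlow s (hs.trans_le (min_le_right _ _))
  rw [← ENNReal.toReal_lt_toReal h (by simp [hfin]), ENNReal.toReal_add hfin (by simp),
    ENNReal.toReal_ofReal hε.le] at h2
  rw [← ENNReal.toReal_lt_toReal hfin (by simp [h]), ENNReal.toReal_add h (by simp),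
    ENNReal.toReal_ofReal hε.le] at hs'
  rw [abs_lt]
  constructor <;> linarith

lemma measurable_nearInf {Ω : Type*} [MeasurableSpace Ω] {A : ℚ → ℝ × Ω → ℝ≥0∞}
    (hA : ∀ s, Measurable (A s)) : Measurable fun y : ℝ × Ω => nearInf (fun s => A s y) y.1 := by
  refine Measurable.iSup fun n => Measurable.iInf fun s => ?_
  refine Measurable.ite ?_ (hA s) measurable_const
  exact measurableSet_lt (by fun_prop) measurable_const

end NearInf

variable {Ω : Type*} [MeasurableSpace Ω] {P : Measure Ω}

lemma measurable_Lp (g : Lp ℝ 2 P) : Measurable (g : Ω → ℝ) := (Lp.stronglyMeasurable g).measurable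

/-- The largest multiple of `1 / k` below `t`. -/
noncomputable def gridTime (k : ℕ) (t : ℝ) : ℝ := ⌊t * k⌋ / k

lemma abs_gridTime_sub_le {k : ℕ} (hk : 0 < k) (t : ℝ) : |gridTime k t - t| ≤ 1 / k := by
  have hk' : (0 : ℝ) < k := by exact_mod_cast hk
  have h1 := Int.floor_le (t * k)
  have h2 := Int.lt_floor_add_one (t * k)
  have h3 : gridTime k t - t = (⌊t * k⌋ - t * k) / k := by
    rw [gridTime]
    field_simp
  rw [h3, abs_div, abs_of_pos hk']
  gcongr
  rw [abs_le]
  constructor <;> linarith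

lemma exists_rat_eq_gridTime (k : ℕ) (t : ℝ) : ∃ s : ℚ, (s : ℝ) = gridTime k t :=
  ⟨⌊t * k⌋ / k, by simp [gridTime]⟩

lemma measurable_comp_gridTime (z : ℝ → Lp ℝ 2 P) (k : ℕ) :
    Measurable fun y : ℝ × Ω => z (gridTime k y.1) y.2 := by
  have h1 : Measurable fun y : ℤ × Ω => z (y.1 / k) y.2 :=
    measurable_from_prod_countable_right fun m => measurable_Lp (z (m / k))
  exact h1.comp (f := fun y : ℝ × Ω => (⌊y.1 * k⌋, y.2)) (by fun_prop)

/-- Convergence in `L²` with summable rate implies almost sure convergence. -/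
lemma ae_tendsto_of_norm_sub_le [IsProbabilityMeasure P] {g : ℕ → Lp ℝ 2 P} {h : Lp ℝ 2 P}
    (hg : ∀ n, ‖g n - h‖ ≤ (1 / 2) ^ n) :
    ∀ᵐ ω ∂P, Tendsto (fun n => g n ω) atTop (𝓝 (h ω)) := by
  have h1 : ∀ n, ∫⁻ ω, ‖(g n - h : Lp ℝ 2 P) ω‖ₑ ∂P ≤ (1 / 2 : ℝ≥0∞) ^ n := by
    intro n
    have h2 : ENNReal.ofReal (∫ ω, |(g n - h : Lp ℝ 2 P) ω| ∂P) ≤ ENNReal.ofReal ((1 / 2) ^ n) :=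
      ENNReal.ofReal_le_ofReal ((integral_abs_le_norm _).trans (hg n))
    rw [ofReal_integral_eq_lintegral_ofReal (integrable_Lp _).abs
      (.of_forall fun ω => abs_nonneg _), ENNReal.ofReal_pow (by norm_num)] at h2
    refine le_trans (le_of_eq (lintegral_congr fun ω => ?_)) (h2.trans (le_of_eq ?_))
    · rw [← ofReal_norm, Real.norm_eq_abs]
    · rw [ENNReal.ofReal_div_of_pos (by norm_num)]
      simp
  have h2 : ∫⁻ ω, ∑' n, ‖(g n - h : Lp ℝ 2 P) ω‖ₑ ∂P ≠ ∞ := by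
    rw [lintegral_tsum fun n => (measurable_Lp _).enorm.aemeasurable]
    refine ne_top_of_le_ne_top ?_ (ENNReal.tsum_le_tsum h1)
    rw [ENNReal.tsum_geometric]
    simp
  have h3 := ae_lt_top (Measurable.tsum fun n => (measurable_Lp (g n - h)).enorm) h2
  have h4 : ∀ᵐ ω ∂P, ∀ n, (g n - h : Lp ℝ 2 P) ω = g n ω - h ω :=
    ae_all_iff.2 fun n => Lp.coeFn_sub _ _
  filter_upwards [h3, h4] with ω h3 h4
  have h5 := ENNReal.tendsto_atTop_zero_of_tsum_ne_top h3.ne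
  simp only [h4] at h5
  rw [tendsto_iff_edist_tendsto_0]
  simpa only [edist_eq_enorm_sub] using h5

section Modification

variable (z : ℝ → Lp ℝ 2 P) (d : ℕ → ℕ)

/-- The limit of the values of the process along a sequence of grids. -/
noncomputable def gridLimit (t : ℝ) (ω : Ω) : ℝ :=
  (limsup (fun n => ((z (gridTime (d n) t) ω : ℝ) : EReal)) atTop).toReal

lemma measurable_gridLimit : Measurable fun y : ℝ × Ω => gridLimit z d y.1 y.2 :=
  (Measurable.limsup fun n => (measurable_comp_gridTime z (d n)).coe_real_ereal).ereal_toReal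

lemma gridLimit_eq {t : ℝ} {ω : Ω}
    (h : Tendsto (fun n => z (gridTime (d n) t) ω) atTop (𝓝 (z t ω))) :
    gridLimit z d t ω = z t ω := by
  have h1 : Tendsto (fun n => ((z (gridTime (d n) t) ω : ℝ) : EReal)) atTop
      (𝓝 ((z t ω : ℝ) : EReal)) := (continuous_coe_real_ereal.tendsto _).comp h
  rw [gridLimit, h1.limsup_eq, EReal.toReal_coe]

/-- The lower limits of the nonnegative, and of the negated nonpositive, values of a path. -/
noncomputable def signedInf (σ : ℝ) (t : ℝ) (ω : Ω) : ℝ≥0∞ :=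
  nearInf (fun s => if 0 ≤ σ * z s ω then ENNReal.ofReal (σ * z s ω) else ∞) t

lemma measurable_signedInf (σ : ℝ) : Measurable fun y : ℝ × Ω => signedInf z σ y.1 y.2 := by
  refine measurable_nearInf (A := fun (s : ℚ) (y : ℝ × Ω) =>
    if 0 ≤ σ * z s y.2 then ENNReal.ofReal (σ * z s y.2) else ∞) fun s => ?_
  have h1 : Measurable fun y : ℝ × Ω => σ * z s y.2 :=
    ((measurable_Lp (z s)).comp measurable_snd).const_mul σ
  exact Measurable.ite (measurableSet_le measurable_const h1) h1.ennreal_ofReal measurable_const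

/-- The distance of `gridLimit` to the set of limit points of the path. -/
noncomputable def gridGap (t : ℝ) (ω : Ω) : ℝ≥0∞ :=
  nearInf (fun s => ENNReal.ofReal |z s ω - gridLimit z d t ω|) t

lemma measurable_gridGap : Measurable fun y : ℝ × Ω => gridGap z d y.1 y.2 := by
  refine measurable_nearInf (A := fun (s : ℚ) (y : ℝ × Ω) =>
    ENNReal.ofReal |z s y.2 - gridLimit z d y.1 y.2|) fun s => ?_
  exact (((measurable_Lp (z s)).comp measurable_snd).sub (measurable_gridLimit z d)).abs.ennreal_ofReal

open Classical in
/-- A separable modification of the process. -/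
noncomputable def separableMod (t : ℝ) (ω : Ω) : ℝ :=
  -- For each fixed t this case holds almost surely and returns the process itself. The other two
  -- cases keep the value a limit point of the rational values on the exceptional set, which varies
  -- with t.
  if gridGap z d t ω = 0 then gridLimit z d t ω
  else if signedInf z 1 t ω ≠ ∞ then (signedInf z 1 t ω).toReal
  else -(signedInf z (-1) t ω).toReal

lemma measurable_separableMod : Measurable fun y : ℝ × Ω => separableMod z d y.1 y.2 := by
  classical
  refine Measurable.ite (measurable_gridGap z d (measurableSet_singleton 0))
    (measurable_gridLimit z d) (Measurable.ite ?_ (measurable_signedInf z 1).ennreal_toReal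
      (measurable_signedInf z (-1)).ennreal_toReal.neg)
  exact (measurable_signedInf z 1 (measurableSet_singleton ∞)).compl

variable {z d}

/-- Grid times are rational and tend to t, so the limit along them is a limit point of the rational
values and the gap vanishes. -/
lemma separableMod_eq {t : ℝ} {ω : Ω}
    (h : Tendsto (fun n => z (gridTime (d n) t) ω) atTop (𝓝 (z t ω)))
    (hgrid : Tendsto (fun n => gridTime (d n) t) atTop (𝓝 t)) :
    separableMod z d t ω = z t ω := by
  have h1 := gridLimit_eq z d h
  rw [separableMod, if_pos, h1]
  by_contra hne
  obtain ⟨c, hc0, hc⟩ := exists_between (pos_iff_ne_zero.2 hne)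
  obtain ⟨δ, hδ, H⟩ := exists_forall_lt_of_lt_nearInf hc
  rw [h1] at H
  have h2 : ∀ᶠ n in atTop, |gridTime (d n) t - t| < δ := by
    have := hgrid.eventually (Metric.ball_mem_nhds t hδ)
    simpa [Real.dist_eq] using this
  have h3 : Tendsto (fun n => ENNReal.ofReal |z (gridTime (d n) t) ω - z t ω|) atTop (𝓝 0) := by
    have h4 : Tendsto (fun n => |z (gridTime (d n) t) ω - z t ω|) atTop (𝓝 0) := by
      have := (h.sub_const (z t ω)).abs
      rwa [sub_self, abs_zero] at this
    have := (ENNReal.continuous_ofReal.tendsto 0).comp h4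
    rwa [ENNReal.ofReal_zero] at this
  obtain ⟨n, hn1, hn2⟩ := (h2.and (h3.eventually (gt_mem_nhds hc0))).exists
  obtain ⟨s, hs⟩ := exists_rat_eq_gridTime (d n) t
  rw [← hs] at hn1 hn2
  exact absurd (H s hn1) (not_lt.2 hn2.le)

lemma exists_near_of_signedInf {σ t : ℝ} {ω : Ω} (hσ : |σ| = 1) (h : signedInf z σ t ω ≠ ∞)
    {δ ε : ℝ} (hδ : 0 < δ) (hε : 0 < ε) :
    ∃ s : ℚ, |s - t| < δ ∧ |z s ω - σ * (signedInf z σ t ω).toReal| < ε := by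
  obtain ⟨s, hs, hs1, hs2⟩ := exists_near_of_nearInf_ne_top h hδ hε
  have h0 : 0 ≤ σ * z s ω := by
    by_contra hneg
    exact hs1 (if_neg hneg)
  rw [if_pos h0, ENNReal.toReal_ofReal h0] at hs2
  refine ⟨s, hs, ?_⟩
  have hσ2 : σ * σ = 1 := by
    rw [← abs_mul_abs_self, hσ, one_mul]
  have h1 : z s ω - σ * (signedInf z σ t ω).toReal =
      σ * (σ * z s ω - (signedInf z σ t ω).toReal) := by
    rw [mul_sub, ← mul_assoc, hσ2, one_mul]
  rw [h1, abs_mul, hσ, one_mul]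
  exact hs2

lemma separableMod_near {t : ℝ} {ω : Ω}
    (hω : ∃ M : ℝ, ∀ δ > 0, ∃ s : ℚ, |s - t| < δ ∧ |z s ω| ≤ M) {δ ε : ℝ} (hδ : 0 < δ)
    (hε : 0 < ε) : ∃ s : ℚ, |s - t| < δ ∧ |z s ω - separableMod z d t ω| < ε := by
  rw [separableMod]
  split_ifs with h1 h2
  · obtain ⟨s, hs, hs'⟩ := exists_lt_of_nearInf_lt
      (h1.trans_lt (by simpa using hε) : gridGap z d t ω < ENNReal.ofReal ε) hδ
    exact ⟨s, hs, (ENNReal.ofReal_lt_ofReal_iff hε).1 hs'⟩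
  · simpa using exists_near_of_signedInf (σ := 1) (by simp) h2 hδ hε
  · rw [not_not] at h2
    -- If both signed lower limits were infinite, |z| would tend to infinity at t along the
    -- rationals, which the hypothesis excludes.
    have h3 : signedInf z (-1) t ω ≠ ∞ := by
      intro h3
      obtain ⟨M, hM⟩ := hω
      have hlt1 : ENNReal.ofReal M < signedInf z 1 t ω := by simp [h2]
      have hlt2 : ENNReal.ofReal M < signedInf z (-1) t ω := by simp [h3]
      obtain ⟨δ₁, hδ₁, H₁⟩ := exists_forall_lt_of_lt_nearInf hlt1
      obtain ⟨δ₂, hδ₂, H₂⟩ := exists_forall_lt_of_lt_nearInf hlt2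
      obtain ⟨s, hs, hsM⟩ := hM (min δ₁ δ₂) (lt_min hδ₁ hδ₂)
      have e1 := H₁ s (hs.trans_le (min_le_left _ _))
      have e2 := H₂ s (hs.trans_le (min_le_right _ _))
      rcases le_total 0 (z s ω) with h0 | h0
      · rw [if_pos (by simpa using h0), one_mul] at e1
        rw [abs_of_nonneg h0] at hsM
        exact absurd e1 (not_lt.2 (ENNReal.ofReal_le_ofReal hsM))
      · rw [if_pos (by simpa using h0), neg_one_mul] at e2
        rw [abs_of_nonpos h0] at hsM
        exact absurd e2 (not_lt.2 (ENNReal.ofReal_le_ofReal hsM))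
    simpa using exists_near_of_signedInf (σ := -1) (by simp) h3 hδ hε

end Modification

/-- A mean-square uniformly continuous centered Gaussian process has a jointly measurable
modification, the values of which are limit points of the process at rational times. -/
theorem IsGaussianSubspace.exists_modification [IsProbabilityMeasure P]
    {H : Submodule ℝ (Lp ℝ 2 P)} (hH : IsGaussianSubspace P H) {z : ℝ → Lp ℝ 2 P}
    (hz : UniformContinuous z) (hzH : ∀ t, z t ∈ H) :
    ∃ Y : ℝ → Ω → ℝ, Measurable (fun y : ℝ × Ω => Y y.1 y.2) ∧ (∀ t, Y t =ᵐ[P] z t) ∧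
      ∀ᵐ ω ∂P, ∀ t : ℝ, ∀ δ > (0 : ℝ), ∀ ε > (0 : ℝ), ∃ s : ℚ, |s - t| < δ ∧ |z s ω - Y t ω| < ε := by
  -- Uniform continuity gives one sequence of grids for all t, with summable errors, hence almost
  -- sure convergence at each t.
  have hd : ∀ n : ℕ, ∃ k : ℕ, n < k ∧ ∀ t, ‖z (gridTime k t) - z t‖ ≤ (1 / 2) ^ n := by
    intro n
    obtain ⟨δ, hδ, H⟩ := Metric.uniformContinuous_iff.1 hz ((1 / 2) ^ n) (by positivity)
    obtain ⟨m, hm⟩ := exists_nat_one_div_lt hδ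
    refine ⟨max (m + 1) (n + 1), lt_of_lt_of_le (Nat.lt_succ_self n) (le_max_right _ _),
      fun t => ?_⟩
    rw [← dist_eq_norm]
    refine (H ?_).le
    rw [Real.dist_eq]
    refine (abs_gridTime_sub_le (lt_of_lt_of_le (Nat.succ_pos m) (le_max_left _ _)) t).trans_lt
      (lt_of_le_of_lt ?_ hm)
    gcongr
    exact_mod_cast le_max_left (m + 1) (n + 1)
  choose d hdn hd using hd
  have hgrid : ∀ t, Tendsto (fun n => gridTime (d n) t) atTop (𝓝 t) := by
    intro t
    rw [tendsto_iff_dist_tendsto_zero]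
    refine squeeze_zero (fun n => dist_nonneg) (fun n => ?_)
      (tendsto_one_div_add_atTop_nhds_zero_nat (𝕜 := ℝ))
    rw [Real.dist_eq]
    refine (abs_gridTime_sub_le ((Nat.zero_le n).trans_lt (hdn n)) t).trans ?_
    gcongr
    exact_mod_cast hdn n
  refine ⟨separableMod z d, measurable_separableMod z d, fun t => ?_, ?_⟩
  · filter_upwards [ae_tendsto_of_norm_sub_le fun n => hd n t] with ω hω
    exact separableMod_eq hω (hgrid t)
  · filter_upwards [hH.ae_not_blowUp hz.continuous hzH] with ω hω t δ hδ ε hε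
    exact separableMod_near (hω t) hδ hε

end

/-! ### Perturbed Riemann sums, Gaussian moments and the variance scale. -/

section

open scoped RealInnerProductSpace NNReal

section RiemannSum

variable {f : ℝ → ℝ} {T : ℝ}

/-- A function with level functions of arbitrarily small oscillation is measurable. -/
lemma aestronglyMeasurable_of_isLevelFunction
    (hf : ∀ ε > 0, ∃ N, IsLevelFunction N f ε 0 T) :
    AEStronglyMeasurable f (volume.restrict (Set.Icc 0 T)) := by
  choose N hN using fun n : ℕ => hf (1 / ((n : ℝ) + 1)) Nat.one_div_pos_of_nat
  refine aestronglyMeasurable_of_tendsto_ae (u := atTop)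
    (f := fun n x => f (levelRep (N n) 0 T (N n x))) (fun n => ?_) ?_
  · have h1 : Measurable fun x => f (levelRep (N n) 0 T (N n x)) :=
      (measurable_from_nat (f := fun k => f (levelRep (N n) 0 T k))).comp (hN n).monotone.measurable
    exact h1.aestronglyMeasurable
  · filter_upwards [ae_restrict_mem measurableSet_Icc] with x hx
    rw [tendsto_iff_dist_tendsto_zero]
    refine squeeze_zero (fun n => dist_nonneg) (fun n => ?_)
      (tendsto_one_div_add_atTop_nhds_zero_nat (𝕜 := ℝ))
    rw [dist_comm, Real.dist_eq]
    exact (hN n).abs_sub_rep_le hx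

lemma integrableOn_abs_rpow {r : ℝ} (hr : 0 < r) (hf : ∀ ε > 0, ∃ N, IsLevelFunction N f ε 0 T) :
    IntegrableOn (fun x => |f x| ^ r) (Set.Icc 0 T) := by
  obtain ⟨N, hN⟩ := hf 1 one_pos
  obtain ⟨M, hM⟩ := hN.bounded_on
  refine Integrable.of_bound (C := M ^ r) ?_ ?_
  · have h1 : AEMeasurable f (volume.restrict (Set.Icc 0 T)) :=
      (aestronglyMeasurable_of_isLevelFunction hf).aemeasurable
    exact (h1.abs.pow_const r).aestronglyMeasurable
  · filter_upwards [ae_restrict_mem measurableSet_Icc] with x hx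
    rw [Real.norm_of_nonneg (by positivity)]
    exact Real.rpow_le_rpow (abs_nonneg _) (hM x hx) hr.le

/-- Subintervals that start before ε end before ε plus the mesh; truncating the partition points
there makes the sum telescope. -/
lemma IntervalPartition.sum_step_lt_le (κ : IntervalPartition 0 T) {ε : ℝ} (hε : 0 ≤ ε) :
    ∑ i ∈ Finset.range κ.n, (if κ.t i < ε then κ.step i else 0) ≤ ε + κ.mesh := by
  have h1 : ∀ i ∈ Finset.range κ.n, (if κ.t i < ε then κ.step i else 0) ≤
      min (κ.t (i + 1)) (ε + κ.mesh) - min (κ.t i) (ε + κ.mesh) := by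
    intro i hi
    have hi' := Finset.mem_range.1 hi
    have h2 := κ.step_le_mesh hi'
    have h3 := κ.lt_succ hi'
    have h4 := κ.mesh_nonneg
    split_ifs with h
    · rw [step] at h2 ⊢
      rw [min_eq_left (by linarith), min_eq_left (by linarith)]
    · exact sub_nonneg.2 (min_le_min_right _ h3.le)
  refine (Finset.sum_le_sum h1).trans ?_
  rw [Finset.sum_range_sub fun i => min (κ.t i) (ε + κ.mesh), κ.t_zero,
    min_eq_left (add_nonneg hε κ.mesh_nonneg), sub_zero]
  exact min_le_right _ _

lemma IntervalPartition.sum_step_card_le (κ : IntervalPartition 0 T) {N : ℝ → ℕ} (hN : Monotone N)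
    {B : ℕ} (hB : ∀ x, N x ≤ B) :
    ∑ i ∈ Finset.range κ.n, (if N (κ.t i) ≠ N (κ.t (i + 1)) then κ.step i else 0) ≤
      (B + 1) * κ.mesh := by
  rw [← Finset.sum_filter]
  have h1 := Finset.sum_le_card_nsmul ((Finset.range κ.n).filter fun i =>
    N (κ.t i) ≠ N (κ.t (i + 1))) κ.step κ.mesh fun i hi =>
      κ.step_le_mesh (Finset.mem_range.1 (Finset.mem_filter.1 hi).1)
  refine h1.trans ?_
  rw [nsmul_eq_mul]
  refine mul_le_mul_of_nonneg_right ?_ κ.mesh_nonneg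
  exact_mod_cast card_level_ne_le hN hB κ

/-- Convergence of generalized Riemann sums of `|f| ^ r`: the values `R s t` have to be close to
`|f|` only on short intervals `[s, t]` away from `0` which do not cross levels of `f`. -/
theorem tendsto_sum_rpow_mul_step {r : ℝ} (hr : 0 < r)
    (hf : ∀ ε > 0, ∃ N, IsLevelFunction N f ε 0 T) {R : ℝ → ℝ → ℝ} {K : ℝ}
    (hR : ∀ s t, 0 ≤ s → s < t → t ≤ T → 0 ≤ R s t ∧ R s t ≤ K)
    (hloc : ∀ ε > 0, ∃ N : ℝ → ℕ, Monotone N ∧ (∃ B, ∀ x, N x ≤ B) ∧ ∃ δ > 0, ∀ s t, ε ≤ s → s < t →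
      t ≤ T → t - s ≤ δ → N s = N t → ∀ x ∈ Set.Icc s t, |R s t - (|f x|)| ≤ ε)
    {κ : ℕ → IntervalPartition 0 T} (hκ : Tendsto (fun n => (κ n).mesh) atTop (𝓝 0)) :
    Tendsto (fun n => ∑ i ∈ Finset.range (κ n).n,
      R ((κ n).t i) ((κ n).t (i + 1)) ^ r * (κ n).step i) atTop
      (𝓝 (∫ x in (0 : ℝ)..T, |f x| ^ r)) := by
  have hT : 0 ≤ T := (κ 0).le
  obtain ⟨N₀, hN₀⟩ := hf 1 one_pos
  obtain ⟨M₀, hM₀⟩ := hN₀.bounded_on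
  set M := max K M₀ with hM
  have hMf : ∀ x ∈ Set.Icc 0 T, |f x| ≤ M := fun x hx => (hM₀ x hx).trans (le_max_right _ _)
  have hM0 : 0 ≤ M := (abs_nonneg _).trans (hMf 0 ⟨le_rfl, hT⟩)
  set A := M ^ r with hA
  have hA0 : 0 ≤ A := by positivity
  have hint := integrableOn_abs_rpow hr hf
  rw [Metric.tendsto_atTop]
  intro e he
  -- The good subintervals cost η * T, the bad ones A times their total length, which is at most 2 *
  -- η; the extra 1 makes the final bound strict.
  set η := e / (T + 2 * A + 1) with hη
  have hη0 : 0 < η := by positivity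
  have hunif : UniformContinuousOn (fun x : ℝ => x ^ r) (Set.Icc 0 M) :=
    isCompact_Icc.uniformContinuousOn_of_continuous
      (continuousOn_id.rpow_const fun x _ => Or.inr hr.le)
  obtain ⟨ε₁, hε₁, hunif⟩ := Metric.uniformContinuousOn_iff.1 hunif η hη0
  set ε := min (ε₁ / 2) η with hε
  have hε0 : 0 < ε := by positivity
  obtain ⟨N, hN, ⟨B, hB⟩, δ, hδ, hloc⟩ := hloc ε hε0
  have hmesh : ∀ᶠ n in atTop, (κ n).mesh < min δ (η / (B + 2)) :=
    hκ.eventually (gt_mem_nhds (by positivity))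
  obtain ⟨n₀, hn₀⟩ := eventually_atTop.1 hmesh
  refine ⟨n₀, fun n hn => ?_⟩
  have hm := hn₀ n hn
  set l := κ n with hl
  have hsub : ∀ i < l.n, Set.Icc (l.t i) (l.t (i + 1)) ⊆ Set.Icc 0 T := fun i hi =>
    Set.Icc_subset_Icc (l.mem_Icc hi.le).1 (l.mem_Icc hi).2
  have hintI : ∀ i < l.n, IntervalIntegrable (fun x => |f x| ^ r) volume (l.t i) (l.t (i + 1)) :=
    fun i hi => (hint.mono_set (by
      rw [Set.uIcc_of_le (l.lt_succ hi).le]; exact hsub i hi)).intervalIntegrable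
  have hsum : ∫ x in (0 : ℝ)..T, |f x| ^ r =
      ∑ i ∈ Finset.range l.n, ∫ x in (l.t i)..(l.t (i + 1)), |f x| ^ r := by
    rw [intervalIntegral.sum_integral_adjacent_intervals hintI, l.t_zero, l.t_last]
  have hterm : ∀ i ∈ Finset.range l.n, ‖R (l.t i) (l.t (i + 1)) ^ r * l.step i -
      ∫ x in (l.t i)..(l.t (i + 1)), |f x| ^ r‖ ≤ η * l.step i +
        A * ((if N (l.t i) ≠ N (l.t (i + 1)) then l.step i else 0) +
          if l.t i < ε then l.step i else 0) := by
    intro i hi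
    have hi := Finset.mem_range.1 hi
    have hlt := l.lt_succ hi
    have hst := l.step_pos hi
    obtain ⟨hR0, hRK⟩ := hR _ _ (l.mem_Icc hi.le).1 hlt (l.mem_Icc hi).2
    have hRM : R (l.t i) (l.t (i + 1)) ≤ M := hRK.trans (le_max_left _ _)
    have hconst : R (l.t i) (l.t (i + 1)) ^ r * l.step i =
        ∫ _ in (l.t i)..(l.t (i + 1)), R (l.t i) (l.t (i + 1)) ^ r := by
      rw [intervalIntegral.integral_const, smul_eq_mul, mul_comm, IntervalPartition.step]
    rw [hconst, ← intervalIntegral.integral_sub intervalIntegrable_const (hintI i hi)]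
    have hbound : ∀ C, (∀ x ∈ Set.Icc (l.t i) (l.t (i + 1)),
        |R (l.t i) (l.t (i + 1)) ^ r - |f x| ^ r| ≤ C) →
        ‖∫ x in (l.t i)..(l.t (i + 1)), (R (l.t i) (l.t (i + 1)) ^ r - |f x| ^ r)‖ ≤
          C * l.step i := by
      intro C hC
      refine (intervalIntegral.norm_integral_le_of_norm_le_const (C := C) fun x hx => ?_).trans
        (le_of_eq ?_)
      · rw [Set.uIoc_of_le hlt.le] at hx
        exact hC x (Set.Ioc_subset_Icc_self hx)
      · rw [IntervalPartition.step, abs_of_pos (sub_pos.2 hlt)]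
    -- Good subintervals cross no level and stay away from 0. On the others the integrand is only
    -- known to be at most A in absolute value.
    by_cases hgood : N (l.t i) = N (l.t (i + 1)) ∧ ε ≤ l.t i
    · rw [if_neg (not_not.2 hgood.1), if_neg (not_lt.2 hgood.2), add_zero, mul_zero, add_zero]
      refine hbound η fun x hx => ?_
      have hstep : l.t (i + 1) - l.t i ≤ δ :=
        (l.step_le_mesh hi).trans (hm.le.trans (min_le_left _ _))
      have h1 := hloc _ _ hgood.2 hlt (l.mem_Icc hi).2 hstep hgood.1 x hx
      refine (hunif _ ⟨hR0, hRM⟩ _ ⟨abs_nonneg _, hMf x (hsub i hi hx)⟩ ?_).le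
      rw [Real.dist_eq]
      exact h1.trans_lt ((min_le_left _ _).trans_lt (half_lt_self hε₁))
    · have h1 : l.step i ≤ (if N (l.t i) ≠ N (l.t (i + 1)) then l.step i else 0) +
          if l.t i < ε then l.step i else 0 := by
        rw [not_and_or, not_le] at hgood
        rcases hgood with h | h
        · rw [if_pos h]
          split_ifs <;> linarith
        · rw [if_pos h]
          split_ifs <;> linarith
      refine (hbound A fun x hx => ?_).trans ?_
      · have h2 : R (l.t i) (l.t (i + 1)) ^ r ≤ A := Real.rpow_le_rpow hR0 hRM hr.le
        have h3 : |f x| ^ r ≤ A :=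
          Real.rpow_le_rpow (abs_nonneg _) (hMf x (hsub i hi hx)) hr.le
        have h4 : 0 ≤ R (l.t i) (l.t (i + 1)) ^ r := by positivity
        have h5 : 0 ≤ |f x| ^ r := by positivity
        rw [abs_le]
        constructor <;> linarith
      · have := mul_le_mul_of_nonneg_left h1 hA0
        have := mul_pos hη0 hst
        linarith
  rw [dist_eq_norm, hsum, ← Finset.sum_sub_distrib]
  refine (norm_sum_le _ _).trans_lt ((Finset.sum_le_sum hterm).trans_lt ?_)
  rw [Finset.sum_add_distrib, ← Finset.mul_sum, ← Finset.mul_sum, Finset.sum_add_distrib,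
    l.sum_step, sub_zero]
  have h1 := l.sum_step_card_le hN hB
  have h2 := l.sum_step_lt_le hε0.le
  have h3 : (B + 2) * l.mesh ≤ η := by
    have := hm.le.trans (min_le_right _ _)
    rwa [le_div_iff₀ (by positivity), mul_comm] at this
  have h4 : ε ≤ η := min_le_right _ _
  have h5 : η * (T + 2 * A + 1) = e := by
    rw [hη]
    field_simp
  have h6 : A * (∑ i ∈ Finset.range l.n, (if N (l.t i) ≠ N (l.t (i + 1)) then l.step i else 0) +
      ∑ i ∈ Finset.range l.n, (if l.t i < ε then l.step i else 0)) ≤ A * (2 * η) :=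
    mul_le_mul_of_nonneg_left (by linarith) hA0
  linarith

end RiemannSum

section Moments

variable {Ω : Type*} [MeasurableSpace Ω] {P : Measure Ω}

lemma integrable_abs_rpow_gaussianReal {r : ℝ} (hr : 0 < r) (v : ℝ≥0) :
    Integrable (fun x => |x| ^ r) (gaussianReal 0 v) := by
  have h1 := (memLp_id_gaussianReal (μ := 0) (v := v) r.toNNReal).integrable_norm_rpow
    (by simpa using hr) ENNReal.coe_ne_top
  simpa [hr.le] using h1

lemma IsGaussianSubspace.integrable_abs_rpow {H : Submodule ℝ (Lp ℝ 2 P)}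
    (hH : IsGaussianSubspace P H) {g : Lp ℝ 2 P} (hg : g ∈ H) {r : ℝ} (hr : 0 < r) :
    Integrable (fun ω => |g ω| ^ r) P := by
  have h1 := integrable_abs_rpow_gaussianReal hr (‖g‖₊ ^ 2)
  rw [← hH g hg] at h1
  exact h1.comp_aemeasurable (aemeasurable_Lp g)

lemma IsGaussianSubspace.integral_abs_rpow {H : Submodule ℝ (Lp ℝ 2 P)}
    (hH : IsGaussianSubspace P H) {g : Lp ℝ 2 P} (hg : g ∈ H) (r : ℝ) :
    ∫ ω, |g ω| ^ r ∂P = ‖g‖ ^ r * ∫ x, |x| ^ r ∂(gaussianReal 0 1) := by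
  have hmeas : ∀ μ : Measure ℝ, AEStronglyMeasurable (fun x : ℝ => |x| ^ r) μ := fun μ =>
    Measurable.aestronglyMeasurable (by fun_prop)
  have h1 : P.map (g : Ω → ℝ) = (gaussianReal 0 1).map (‖g‖ * ·) := by
    rw [hH g hg, gaussianReal_map_const_mul, mul_zero, mul_one]
    congr 1
  rw [← integral_map (aemeasurable_Lp g) (hmeas _) (f := fun x : ℝ => |x| ^ r), h1,
    integral_map (by fun_prop) (hmeas _), ← integral_const_mul]
  refine integral_congr_ae (.of_forall fun x => ?_)
  simp only [abs_mul, abs_norm]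
  exact Real.mul_rpow (norm_nonneg _) (abs_nonneg _)

end Moments

section Scale

variable {T : ℝ} {ρ : ℝ → ℝ}

lemma IsVarianceScale.pos (h : IsVarianceScale T ρ) {u : ℝ} (hu : u ∈ Set.Ioc 0 T) : 0 < ρ u := by
  have hT : 0 < T := hu.1.trans_le hu.2
  -- The positivity condition is available only for δ < T, whereas u may equal T.
  set δ := min u (T / 2) with hδ
  have hδ0 : 0 < δ := lt_min hu.1 (by linarith)
  have hδT : δ < T := (min_le_right _ _).trans_lt (by linarith)
  refine (h.inf_pos δ ⟨hδ0, hδT⟩).trans_le (csInf_le ⟨0, ?_⟩ ⟨u, ⟨min_le_left _ _, hu.2⟩, rfl⟩)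
  rintro _ ⟨v, hv, rfl⟩
  exact h.nonneg v ⟨hδ0.le.trans hv.1, hv.2⟩

lemma IsVarianceScale.exists_lt (h : IsVarianceScale T ρ) {ε : ℝ} (hε : 0 < ε) :
    ∃ δ > 0, ∀ u ∈ Set.Icc 0 T, u < δ → ρ u < ε := by
  obtain ⟨δ, hδ, H⟩ := Metric.continuousWithinAt_iff.1 h.continuous_zero ε hε
  refine ⟨δ, hδ, fun u hu hu' => ?_⟩
  have h1 := H hu (by rwa [Real.dist_eq, sub_zero, abs_of_nonneg hu.1])
  rw [h.zero, Real.dist_eq, sub_zero] at h1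
  exact (le_abs_self _).trans_lt h1

/-- A map whose increments are controlled by a variance scale is continuous. -/
lemma IsVarianceScale.continuousOn (h : IsVarianceScale T ρ) {E : Type*} [NormedAddCommGroup E]
    {x : ℝ → E} {L : ℝ} (hx : ∀ s t, 0 ≤ s → s < t → t ≤ T → ‖x t - x s‖ ≤ L * ρ (t - s)) :
    ContinuousOn x (Set.Icc 0 T) := by
  have key : ∀ ε > 0, ∃ δ > 0, ∀ s t, 0 ≤ s → s < t → t ≤ T → t - s < δ → ‖x t - x s‖ < ε := by
    intro ε hε
    obtain ⟨δ, hδ, H⟩ := h.exists_lt (show 0 < ε / (|L| + 1) by positivity)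
    refine ⟨δ, hδ, fun s t hs hst ht hd => (hx s t hs hst ht).trans_lt ?_⟩
    have hmem : t - s ∈ Set.Icc 0 T := ⟨by linarith, by linarith⟩
    have h1 := H _ hmem hd
    rw [lt_div_iff₀ (by positivity)] at h1
    have h2 := h.nonneg _ hmem
    have h3 := mul_le_mul_of_nonneg_right (le_abs_self L) h2
    linarith
  rw [Metric.continuousOn_iff]
  intro b hb ε hε
  obtain ⟨δ, hδ, H⟩ := key ε hε
  refine ⟨δ, hδ, fun a ha hab => ?_⟩
  rw [Real.dist_eq, abs_lt] at hab
  rcases lt_trichotomy a b with hlt | rfl | hlt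
  · rw [dist_comm, dist_eq_norm]
    exact H a b ha.1 hlt hb.2 (by linarith)
  · rwa [dist_self]
  · rw [dist_eq_norm]
    exact H b a hb.1 hlt ha.2 (by linarith)

end Scale

end

/-! ### Transfer between the process and its path in L². -/

section

open scoped RealInnerProductSpace NNReal

variable {Ω : Type*} [MeasurableSpace Ω] {P : Measure Ω} {T : ℝ} {X : ℝ → Ω → ℝ}

section Path

/-- A second order process as a path in `L²`. -/
noncomputable def l2Path (P : Measure Ω) (X : ℝ → Ω → ℝ) (t : ℝ) : Lp ℝ 2 P :=
  open Classical in if h : MemLp (X t) 2 P then h.toLp (X t) else 0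

lemma coeFn_l2Path {t : ℝ} (h : MemLp (X t) 2 P) : l2Path P X t =ᵐ[P] X t := by
  rw [l2Path, dif_pos h]
  exact h.coeFn_toLp

lemma coeFn_l2Path_sub {s t : ℝ} (hs : MemLp (X s) 2 P) (ht : MemLp (X t) 2 P) :
    (l2Path P X t - l2Path P X s : Lp ℝ 2 P) =ᵐ[P] fun ω => X t ω - X s ω := by
  filter_upwards [Lp.coeFn_sub (l2Path P X t) (l2Path P X s), coeFn_l2Path hs, coeFn_l2Path ht]
    with ω h1 h2 h3
  rw [h1, Pi.sub_apply, h2, h3]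

lemma norm_l2Path_sub {s t : ℝ} (hs : MemLp (X s) 2 P) (ht : MemLp (X t) 2 P) :
    ‖l2Path P X t - l2Path P X s‖ = incrStd P X s t := by
  rw [incrStd, ← Real.sqrt_sq (norm_nonneg _), norm_sq_Lp_eq_integral]
  congr 1
  refine integral_congr_ae ?_
  filter_upwards [coeFn_l2Path_sub hs ht] with ω h
  rw [h]

lemma inner_l2Path {s t : ℝ} (hs : MemLp (X s) 2 P) (ht : MemLp (X t) 2 P) :
    ⟪l2Path P X s, l2Path P X t⟫ = covFun P X s t := by
  rw [inner_Lp_eq_integral, covFun]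
  refine integral_congr_ae ?_
  filter_upwards [coeFn_l2Path hs, coeFn_l2Path ht] with ω h1 h2
  rw [h1, h2]

variable (hX : ∀ t ∈ Set.Icc 0 T, MemLp (X t) 2 P)
include hX

/-- The covariance variation of the process bounds the Gram variation of its path. -/
lemma gramVariationLE_l2Path {p : ℝ} (hp : 1 ≤ p) {w : ℝ → ℝ → ℝ}
    (hV : ∀ s t : ℝ, 0 ≤ s → s < t → t ≤ T →
      pVariation₂ p (covFun P X) s t s t ≤ ENNReal.ofReal (w s t ^ 2)) :
    GramVariationLE p T (l2Path P X) w := by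
  intro s t hs hst ht κ
  have hmem : ∀ i ≤ κ.n, MemLp (X (κ.t i)) 2 P := fun i hi =>
    hX _ ⟨hs.trans (κ.mem_Icc hi).1, (κ.mem_Icc hi).2.trans ht⟩
  set S := ∑ i ∈ Finset.range κ.n, ∑ j ∈ Finset.range κ.n,
    |doubleIncrement (covFun P X) (κ.t i) (κ.t (i + 1)) (κ.t j) (κ.t (j + 1))| ^ p with hS
  have hS0 : 0 ≤ S := Finset.sum_nonneg fun i _ => Finset.sum_nonneg fun j _ => by positivity
  have h1 : ENNReal.ofReal (S ^ (1 / p)) ≤ ENNReal.ofReal (w s t ^ 2) := by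
    refine le_trans ?_ (hV s t hs hst ht)
    exact le_iSup₂ (f := fun (κ l : IntervalPartition s t) =>
      ENNReal.ofReal ((∑ i ∈ Finset.range κ.n, ∑ j ∈ Finset.range l.n,
        |doubleIncrement (covFun P X) (κ.t i) (κ.t (i + 1)) (l.t j) (l.t (j + 1))| ^ p)
          ^ (1 / p))) κ κ
  rw [ENNReal.ofReal_le_ofReal_iff (by positivity)] at h1
  have h2 := Real.rpow_le_rpow (by positivity) h1 (by linarith : (0 : ℝ) ≤ p)
  rw [← Real.rpow_mul hS0, one_div, inv_mul_cancel₀ (by linarith), Real.rpow_one] at h2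
  refine le_of_eq_of_le (Finset.sum_congr rfl fun i hi => Finset.sum_congr rfl fun j hj => ?_) h2
  have hi := Finset.mem_range.1 hi
  have hj := Finset.mem_range.1 hj
  rw [inner_sub_left, inner_sub_right, inner_sub_right, inner_l2Path (hmem _ hi) (hmem _ hj),
    inner_l2Path (hmem _ hi) (hmem _ hj.le), inner_l2Path (hmem _ hi.le) (hmem _ hj),
    inner_l2Path (hmem _ hi.le) (hmem _ hj.le), doubleIncrement]
  congr 2
  ring

lemma coeFn_rsSumE_l2Path {f : ℝ → ℝ} {t : ℝ} (ht : t ∈ Set.Icc 0 T) (κ : IntervalPartition 0 t)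
    (u : ℕ → ℝ) : (rsSumE f (l2Path P X) κ u : Lp ℝ 2 P) =ᵐ[P] rsSum f X κ u := by
  have hmem : ∀ i ≤ κ.n, MemLp (X (κ.t i)) 2 P := fun i hi =>
    hX _ ⟨(κ.mem_Icc hi).1, (κ.mem_Icc hi).2.trans ht.2⟩
  have h1 : ∀ᵐ ω ∂P, ∀ i ∈ Finset.range κ.n,
      (l2Path P X (κ.t (i + 1)) - l2Path P X (κ.t i) : Lp ℝ 2 P) ω =
        X (κ.t (i + 1)) ω - X (κ.t i) ω :=
    (Finset.eventually_all _).2 fun i hi =>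
      coeFn_l2Path_sub (hmem _ (Finset.mem_range.1 hi).le) (hmem _ (Finset.mem_range.1 hi))
  filter_upwards [h1, coeFn_sum_smul (Finset.range κ.n) (fun i => f (u i))
    fun i => (l2Path P X (κ.t (i + 1)) - l2Path P X (κ.t i) : Lp ℝ 2 P)] with ω h1 h2
  rw [rsSumE, h2, rsSum]
  exact Finset.sum_congr rfl fun i hi => by rw [h1 i hi]

lemma integral_rsSum_sub_sq {f : ℝ → ℝ} {t : ℝ} (ht : t ∈ Set.Icc 0 T)
    (κ : IntervalPartition 0 t) (u : ℕ → ℝ) {I : Ω → ℝ} {g : Lp ℝ 2 P} (hg : g =ᵐ[P] I) :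
    ∫ ω, (rsSum f X κ u ω - I ω) ^ 2 ∂P = ‖rsSumE f (l2Path P X) κ u - g‖ ^ 2 := by
  rw [norm_sq_Lp_eq_integral]
  refine integral_congr_ae ?_
  filter_upwards [hg, Lp.coeFn_sub (rsSumE f (l2Path P X) κ u) g,
    coeFn_rsSumE_l2Path hX ht κ u (f := f)] with ω h1 h2 h3
  rw [h2, Pi.sub_apply, h1, h3]

lemma IsRSLimit.isQMIntegral {f : ℝ → ℝ} {t : ℝ} (ht : t ∈ Set.Icc 0 T) {y : Lp ℝ 2 P}
    (hy : IsRSLimit f (l2Path P X) 0 t y) : IsQMIntegral P f X 0 t y := by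
  refine ⟨Lp.memLp y, fun ε hε => ?_⟩
  obtain ⟨δ, hδ, H⟩ := hy (Real.sqrt ε) (Real.sqrt_pos.2 hε)
  refine ⟨δ, hδ, fun κ u hu hm => ?_⟩
  rw [integral_rsSum_sub_sq hX ht κ u (Filter.EventuallyEq.refl _ _)]
  have h1 := pow_lt_pow_left₀ (H κ u hu hm) (norm_nonneg _) two_ne_zero
  rwa [Real.sq_sqrt hε.le] at h1

/-- Quadratic mean integrals are unique. -/
lemma IsQMIntegral.ae_eq {f : ℝ → ℝ} {t : ℝ} (ht : t ∈ Set.Icc 0 T) {I : Ω → ℝ}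
    (hI : IsQMIntegral P f X 0 t I) {y : Lp ℝ 2 P} (hy : IsRSLimit f (l2Path P X) 0 t y) :
    I =ᵐ[P] y := by
  obtain ⟨hI2, hI⟩ := hI
  have hg : hI2.toLp I = y := by
    refine eq_of_forall_dist_le fun ε hε => ?_
    obtain ⟨δ₁, hδ₁, H₁⟩ := hI ((ε / 2) ^ 2) (by positivity)
    obtain ⟨δ₂, hδ₂, H₂⟩ := hy (ε / 2) (by positivity)
    obtain ⟨κ, hκ⟩ := IntervalPartition.exists_mesh_lt ht.1 (lt_min hδ₁ hδ₂)
    have h1 := H₁ κ κ.t κ.isTag_left (hκ.trans_le (min_le_left _ _))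
    have h2 := H₂ κ κ.t κ.isTag_left (hκ.trans_le (min_le_right _ _))
    rw [integral_rsSum_sub_sq hX ht κ κ.t hI2.coeFn_toLp] at h1
    have h3 := lt_of_pow_lt_pow_left₀ 2 (by positivity) h1
    rw [← dist_eq_norm] at h2 h3
    rw [dist_comm] at h3
    have := dist_triangle (hI2.toLp I) (rsSumE f (l2Path P X) κ κ.t) y
    linarith
  rw [← hg]
  exact hI2.coeFn_toLp.symm

end Path

/-- The integrand and the path of an integral process with a controlled covariance. -/
lemma isControlled_of_memW {p : ℝ} (hp : 1 ≤ p) {x : ℝ → Lp ℝ 2 P} {w : ℝ → ℝ → ℝ}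
    (hx : GramVariationLE p T x w) (hT : 0 ≤ T)
    (hw : ∀ s t, 0 ≤ s → s ≤ t → t ≤ T → 0 ≤ w s t) {f : ℝ → ℝ} {q : ℝ≥0∞} (hq : q ∈ Q p)
    (hf : MemW q f 0 T) : IsControlled f x T w := by
  rcases hq with ⟨rfl, hq⟩ | ⟨hp1, hq1, hqp⟩
  · exact isControlled_of_isRegulatedOn hx hT hw (hf.1 hq)
  · have hqt : q ≠ ∞ := (hqp.trans_le le_top).ne
    have h1 : 1 ≤ q.toReal := by
      have := ENNReal.toReal_mono hqt hq1
      rwa [ENNReal.toReal_one] at this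
    have h2 : q.toReal < p / (p - 1) := by
      rw [ENNReal.lt_ofReal_iff_toReal_lt hqt] at hqp
      exact hqp
    have hq0 : 0 < q.toReal := by linarith
    obtain ⟨C, hC, hfC⟩ := exists_variationLE_of_pVariation hq0 (hf.2 hqt)
    refine isControlled_of_variationLE hx hp hT hw hq0 ?_ hC hfC
    -- The bound on q is the Young condition 1/p + 1/q > 1 in another form.
    have h3 : (p - 1) / p < 1 / q.toReal := by
      rw [lt_div_iff₀ (by linarith)] at h2
      rw [div_lt_div_iff₀ (by linarith) hq0]
      linarith
    have h4 : (p - 1) / p = 1 - 1 / p := by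
      field_simp
    linarith

section IntegralProcess

variable {y : ℝ → Lp ℝ 2 P} {f : ℝ → ℝ}

/-- Existence of the integral process from the existence of the integrals. -/
theorem exists_isQMIntegralProcess [IsProbabilityMeasure P] (hT : 0 < T)
    (hX : ∀ t ∈ Set.Icc 0 T, MemLp (X t) 2 P) {H : Submodule ℝ (Lp ℝ 2 P)}
    (hH : IsGaussianSubspace P H) (hyH : ∀ t ∈ Set.Icc 0 T, y t ∈ H)
    (hy : ∀ t ∈ Set.Icc 0 T, IsRSLimit f (l2Path P X) 0 t (y t))
    (hcont : ContinuousOn y (Set.Icc 0 T)) :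
    ∃ Y : ℝ → Ω → ℝ, IsQMIntegralProcess P T f X Y := by
  -- The path is extended by constants beyond [0, T], and the images of the rationals under this
  -- projection serve as the countable separating set.
  set π : ℝ → ℝ := fun t => Set.projIcc 0 T hT.le t with hπ
  have hπmem : ∀ t, π t ∈ Set.Icc 0 T := fun t => Subtype.coe_prop _
  have hπfix : ∀ t ∈ Set.Icc 0 T, π t = t := fun t ht => by
    simp only [hπ, Set.projIcc_of_mem hT.le ht]
  have hunif : UniformContinuous fun t => y (π t) := by
    have h1 := uniformContinuousOn_iff_restrict.1
      (isCompact_Icc.uniformContinuousOn_of_continuous hcont)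
    have h2 : LipschitzWith 1 (Set.projIcc 0 T hT.le) := LipschitzWith.projIcc hT.le
    exact h1.comp h2.uniformContinuous
  obtain ⟨Y, hYm, hYz, hYs⟩ := hH.exists_modification hunif fun t => hyH _ (hπmem t)
  have hYt : ∀ t ∈ Set.Icc 0 T, Y t =ᵐ[P] y t := fun t ht => by
    have := hYz t
    rwa [hπfix t ht] at this
  refine ⟨Y, hYm.comp (by fun_prop : Measurable fun z : Set.Icc (0 : ℝ) T × Ω => ((z.1 : ℝ), z.2)),
    ⟨Set.range fun s : ℚ => π s, Set.countable_range _, ?_, ?_⟩,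
    fun t ht => ⟨y t, (hy t ht).isQMIntegral hX ht, hYt t ht⟩⟩
  · rintro _ ⟨s, rfl⟩
    exact hπmem s
  · have hS : ∀ᵐ ω ∂P, ∀ s : ℚ, Y (π s) ω = y (π s) ω :=
      ae_all_iff.2 fun s => hYt _ (hπmem s)
    filter_upwards [hYs, hS] with ω hω hS a b F hF hsF t ht
    refine hF.closure_eq ▸ Metric.mem_closure_iff.2 fun ε hε => ?_
    obtain ⟨⟨ht0, htT⟩, hta, htb⟩ := ht
    obtain ⟨s, hs, hs'⟩ := hω t (min (t - a) (b - t))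
      (lt_min (by linarith) (by linarith)) ε hε
    have h1 := hs.trans_le (min_le_left _ _)
    have h2 := hs.trans_le (min_le_right _ _)
    rw [abs_lt] at h1 h2
    -- Projecting onto [0, T], which contains t, moves s no farther from t, so it does not leave (a,
    -- b).
    have h3 : π s ∈ Set.Ioo a b := by
      have : π s = max 0 (min T s) := Set.coe_projIcc 0 T hT.le s
      rw [this]
      rcases le_total T s with hc | hc
      · rw [min_eq_left hc, max_eq_right hT.le]
        constructor <;> linarith
      · rw [min_eq_right hc]
        rcases le_total 0 (s : ℝ) with hd | hd
        · rw [max_eq_right hd]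
          constructor <;> linarith
        · rw [max_eq_left hd]
          constructor <;> linarith
    refine ⟨Y (π s) ω, hsF _ ⟨⟨s, rfl⟩, h3⟩, ?_⟩
    rw [hS s, dist_comm, Real.dist_eq]
    exact hs'

lemma IsQMIntegralProcess.ae_eq (hX : ∀ t ∈ Set.Icc 0 T, MemLp (X t) 2 P)
    (hy : ∀ t ∈ Set.Icc 0 T, IsRSLimit f (l2Path P X) 0 t (y t)) {Y : ℝ → Ω → ℝ}
    (hY : IsQMIntegralProcess P T f X Y) {t : ℝ} (ht : t ∈ Set.Icc 0 T) : Y t =ᵐ[P] y t := by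
  obtain ⟨I, hI, hYI⟩ := hY.eq_integral t ht
  exact hYI.trans (hI.ae_eq hX ht (hy t ht))

lemma IsQMIntegralProcess.sub_ae_eq (hX : ∀ t ∈ Set.Icc 0 T, MemLp (X t) 2 P)
    (hy : ∀ t ∈ Set.Icc 0 T, IsRSLimit f (l2Path P X) 0 t (y t)) {Y : ℝ → Ω → ℝ}
    (hY : IsQMIntegralProcess P T f X Y) {s t : ℝ} (hs : s ∈ Set.Icc 0 T) (ht : t ∈ Set.Icc 0 T)
    (r : ℝ) : (fun ω => |Y t ω - Y s ω| ^ r) =ᵐ[P] fun ω => |(y t - y s : Lp ℝ 2 P) ω| ^ r := by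
  filter_upwards [hY.ae_eq hX hy hs, hY.ae_eq hX hy ht, Lp.coeFn_sub (y t) (y s)] with ω h1 h2 h3
  rw [h3, Pi.sub_apply, h1, h2]

/-- The increments of the integral process are locally those of `f dX`. -/
lemma LSI.exists_abs_div_sub_le {ρ : ℝ → ℝ} (hX : LSI P T ρ X) {c : ℝ} (hc : 0 ≤ c) (hT : 0 < T)
    (hf : IsControlled f (l2Path P X) T fun s t => c * ρ (t - s))
    (hy : ∀ t ∈ Set.Icc 0 T, IsRSLimit f (l2Path P X) 0 t (y t)) {ε : ℝ} (hε : 0 < ε) :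
    ∃ N : ℝ → ℕ, Monotone N ∧ (∃ B, ∀ x, N x ≤ B) ∧ ∃ δ > 0, ∀ s t, ε ≤ s → s < t →
      t ≤ T → t - s ≤ δ → N s = N t → ∀ x ∈ Set.Icc s t,
        |‖y t - y s‖ / ρ (t - s) - (|f x|)| ≤ ε := by
  obtain ⟨N₀, hN₀, -⟩ := hf.approx 1 one_pos
  obtain ⟨M, hM⟩ := hN₀.bounded_on
  have hM0 : 0 ≤ M := (abs_nonneg _).trans (hM 0 ⟨le_rfl, hT.le⟩)
  -- The error ε is shared between three approximations: of the increment of y by a multiple of that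
  -- of x, of the incremental deviation by ρ, and of f by its value at the representative of the
  -- level.
  obtain ⟨N, hN, H⟩ := hf.norm_sub_sub_le hy (show 0 < ε / (3 * (c + 1)) by positivity)
  obtain ⟨δ, hδ, Hδ⟩ := hX.asymp (min ε (T / 2))
    ⟨lt_min hε (by linarith), (min_le_right _ _).trans_lt (by linarith)⟩
    (ε / (3 * (M + 1))) (by positivity)
  refine ⟨N, hN.monotone, hN.bounded, δ, hδ, fun s t hs hst ht htδ hNst x hx => ?_⟩
  have hs0 : 0 ≤ s := hε.le.trans hs
  have hρ : 0 < ρ (t - s) := hX.scale.pos ⟨by linarith, by linarith⟩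
  have hsm : MemLp (X s) 2 P := hX.second_order s ⟨hs0, hst.le.trans ht⟩
  have htm : MemLp (X t) 2 P := hX.second_order t ⟨hs0.trans hst.le, ht⟩
  have h1 := H s t hs0 hst ht hNst
  have h2 := Hδ s ⟨(min_le_left _ _).trans hs, hst.trans_le ht⟩ (t - s)
    ⟨by linarith, le_min htδ (by linarith)⟩
  rw [add_sub_cancel, ← norm_l2Path_sub hsm htm] at h2
  set z := levelRep N 0 T (N s) with hz
  set Δ := ‖l2Path P X t - l2Path P X s‖ with hΔ
  have hzmem : z ∈ Set.Icc 0 T := hN.rep_mem s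
  have h3 : |‖y t - y s‖ - |f z| * Δ| ≤ ε / (3 * (c + 1)) * (c * ρ (t - s)) := by
    rw [← Real.norm_eq_abs (f z), hΔ, ← norm_smul]
    exact (abs_norm_sub_norm_le _ _).trans h1
  have h4 : |‖y t - y s‖ / ρ (t - s) - |f z| * (Δ / ρ (t - s))| ≤ ε / 3 := by
    rw [← mul_div_assoc, ← sub_div, abs_div, abs_of_pos hρ, div_le_iff₀ hρ]
    refine h3.trans ?_
    rw [← mul_assoc]
    refine mul_le_mul_of_nonneg_right ?_ hρ.le
    rw [div_mul_eq_mul_div, div_le_div_iff₀ (by positivity) (by norm_num)]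
    nlinarith
  have h5 : |(|f z|) * (Δ / ρ (t - s)) - (|f z|)| ≤ ε / 3 := by
    rw [← mul_sub_one, abs_mul, abs_abs]
    calc |f z| * |Δ / ρ (t - s) - 1| ≤ M * (ε / (3 * (M + 1))) :=
          mul_le_mul (hM z hzmem) h2 (abs_nonneg _) hM0
      _ ≤ ε / 3 := by
          rw [mul_div_assoc', div_le_div_iff₀ (by positivity) (by norm_num)]
          nlinarith
  have h6 : |(|f z|) - (|f x|)| ≤ ε / 3 := by
    have hNx : N x = N s :=
      le_antisymm ((hN.monotone hx.2).trans hNst.ge) (hN.monotone hx.1)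
    have h7 := hN.abs_sub_rep_le (x := x) ⟨hs0.trans hx.1, hx.2.trans ht⟩
    rw [hNx, ← hz, abs_sub_comm] at h7
    refine (abs_abs_sub_abs_le_abs_sub _ _).trans (h7.trans ?_)
    gcongr
    linarith
  rw [abs_le] at h4 h5 h6 ⊢
  constructor <;> linarith

end IntegralProcess

end

end QMIntegral

/-! ### The theorem on integral processes. -/

theorem theorem4p1 {Ω : Type*} [MeasurableSpace Ω] (P : Measure Ω) [IsProbabilityMeasure P]
    (r T : ℝ) (hr : 0 < r) (hT : 0 < T)
    (ρ : ℝ → ℝ) (X : ℝ → Ω → ℝ)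
    (hGauss : IsGaussianProcess (fun t : Set.Icc (0 : ℝ) T => X t) P)
    (hmean : ∀ t ∈ Set.Icc 0 T, ∫ ω, X t ω ∂P = 0)
    (hLSI : QMIntegral.LSI P T ρ X)
    (C₁ p : ℝ) (hp : 1 ≤ p)
    (hV : ∀ s t : ℝ, 0 ≤ s → s < t → t ≤ T →
      QMIntegral.pVariation₂ p (QMIntegral.covFun P X) s t s t
        ≤ ENNReal.ofReal (C₁ * ρ (t - s) ^ 2))
    (f : ℝ → ℝ) (q : ℝ≥0∞) (hq : q ∈ QMIntegral.Q p) (hf : QMIntegral.MemW q f 0 T) :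
    (∃ Y : ℝ → Ω → ℝ, QMIntegral.IsQMIntegralProcess P T f X Y) ∧
    IntervalIntegrable (fun x => |f x| ^ r) volume 0 T ∧
    ∀ Y : ℝ → Ω → ℝ, QMIntegral.IsQMIntegralProcess P T f X Y →
      (∀ s ∈ Set.Icc 0 T, ∀ t ∈ Set.Icc 0 T, Integrable (fun ω => |Y t ω - Y s ω| ^ r) P) ∧
      ∀ κ : ℕ → QMIntegral.IntervalPartition 0 T,
        Tendsto (fun n => (κ n).mesh) atTop (𝓝 0) →
        Tendsto
          (fun n => ∑ i ∈ Finset.range (κ n).n,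
            (∫ ω, |Y ((κ n).t (i + 1)) ω - Y ((κ n).t i) ω| ^ r ∂P) / ρ ((κ n).step i) ^ r
              * (κ n).step i)
          atTop
          (𝓝 ((∫ x, |x| ^ r ∂(gaussianReal 0 1)) * ∫ x in (0 : ℝ)..T, |f x| ^ r)) := by
  have hX := hLSI.second_order
  -- The covariance bound is written as the square of c * ρ, as Gram variation requires; the maximum
  -- covers a negative C₁.
  set c := Real.sqrt (max C₁ 0) with hc
  have hc0 : 0 ≤ c := Real.sqrt_nonneg _
  set x := QMIntegral.l2Path P X with hx
  have hρ0 : ∀ s t, 0 ≤ s → s ≤ t → t ≤ T → 0 ≤ ρ (t - s) := fun s t hs hst ht =>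
    hLSI.scale.nonneg _ ⟨by linarith, by linarith⟩
  have hgram : QMIntegral.GramVariationLE p T x fun s t => c * ρ (t - s) := by
    refine QMIntegral.gramVariationLE_l2Path hX hp fun s t hs hst ht => (hV s t hs hst ht).trans ?_
    refine ENNReal.ofReal_le_ofReal ?_
    rw [mul_pow, hc, Real.sq_sqrt (le_max_right _ _)]
    exact mul_le_mul_of_nonneg_right (le_max_left _ _) (sq_nonneg _)
  have hctrl : QMIntegral.IsControlled f x T fun s t => c * ρ (t - s) :=
    QMIntegral.isControlled_of_memW hp hgram hT.le
      (fun s t hs hst ht => mul_nonneg hc0 (hρ0 s t hs hst ht)) hq hf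
  have hxcont : ContinuousOn x (Set.Icc 0 T) := by
    obtain ⟨L, hL⟩ := hLSI.upper
    refine hLSI.scale.continuousOn (L := L) fun s t hs hst ht => ?_
    have hs' : s ∈ Set.Icc 0 T := ⟨hs, hst.le.trans ht⟩
    have ht' : t ∈ Set.Icc 0 T := ⟨hs.trans hst.le, ht⟩
    rw [QMIntegral.norm_l2Path_sub (hX s hs') (hX t ht')]
    have := hL s hs' t ht'
    rwa [abs_of_pos (sub_pos.2 hst)] at this
  choose! y hy using fun t (ht : t ∈ Set.Icc 0 T) => hctrl.exists_isRSLimit hxcont ht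
  obtain ⟨K, hK0, hK⟩ := hctrl.norm_sub_le hy
  have hK' : ∀ s t, 0 ≤ s → s < t → t ≤ T → ‖y t - y s‖ ≤ K * c * ρ (t - s) :=
    fun s t hs hst ht => (hK s t hs hst ht).trans_eq (mul_assoc _ _ _).symm
  set H := (Submodule.span ℝ (x '' Set.Icc 0 T)).topologicalClosure with hH
  have hHg : QMIntegral.IsGaussianSubspace P H := by
    refine QMIntegral.IsGaussianSubspace.topologicalClosure ?_
    rw [Set.image_eq_range]
    exact QMIntegral.isGaussianSubspace_span hGauss (fun t => hmean t t.2) fun t =>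
      QMIntegral.coeFn_l2Path (hX t t.2)
  have hyH : ∀ t ∈ Set.Icc 0 T, y t ∈ H := fun t ht => (hy t ht).mem_closure ht
  have hlevel : ∀ ε > 0, ∃ N, QMIntegral.IsLevelFunction N f ε 0 T := fun ε hε =>
    (hctrl.approx ε hε).imp fun N hN => hN.1
  refine ⟨QMIntegral.exists_isQMIntegralProcess hT hX hHg hyH hy
    (hLSI.scale.continuousOn hK'), ?_, ?_⟩
  · refine IntegrableOn.intervalIntegrable ?_
    rw [Set.uIcc_of_le hT.le]
    exact QMIntegral.integrableOn_abs_rpow hr hlevel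
  intro Y hY
  refine ⟨fun s hs t ht => ?_, fun κ hκ => ?_⟩
  · exact (hHg.integrable_abs_rpow (H.sub_mem (hyH t ht) (hyH s hs)) hr).congr
      (hY.sub_ae_eq hX hy hs ht r).symm
  · have hlim := QMIntegral.tendsto_sum_rpow_mul_step hr hlevel (K := K * c)
      (R := fun s t => ‖y t - y s‖ / ρ (t - s))
      (fun s t hs hst ht => ⟨div_nonneg (norm_nonneg _) (hρ0 s t hs hst.le ht), by
        rw [div_le_iff₀ (hLSI.scale.pos ⟨sub_pos.2 hst, by linarith⟩)]
        exact hK' s t hs hst ht⟩)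
      (fun ε hε => hLSI.exists_abs_div_sub_le hc0 hT hctrl hy hε) hκ
    refine (hlim.const_mul (∫ x, |x| ^ r ∂(gaussianReal 0 1))).congr fun n => ?_
    rw [Finset.mul_sum]
    refine Finset.sum_congr rfl fun i hi => ?_
    have hi := Finset.mem_range.1 hi
    have hs := (κ n).mem_Icc hi.le
    have ht := (κ n).mem_Icc hi
    rw [integral_congr_ae (hY.sub_ae_eq hX hy hs ht r),
      hHg.integral_abs_rpow (H.sub_mem (hyH _ ht) (hyH _ hs)),
      Real.div_rpow (norm_nonneg _) (hρ0 _ _ hs.1 ((κ n).lt_succ hi).le ht.2)]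
    simp only [QMIntegral.IntervalPartition.step]
    ring
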